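/- **Consistency in the vanishing viscosity limit.** Let $d\in\{2,3\}$, $T>0$, $\omega>0$, and let $\Omega=(0,L_1)\times\dots\times(0,L_d)$ with periodic boundary conditions. Let $\mathcal T_h$, $h\to0$ (a sequence), be conforming periodic simplex meshes with mesh size $h$ (largest simplex diameter), regular in the sense that every $d$-simplex of $\mathcal T_h$ contains a ball of radius $\kappa h$ with $\kappa>0$ independent of $h$. Let $\varphi_1,\dots,\varphi_{N_h}$ be the periodic continuous piecewise linear Lagrange basis functions, $\mathcal N_i$ the set of indices $j$ for which $\varphi_i$ and $\varphi_j$ overlap (including $j=i$), and $$m_{ij}=\int_\Omega\varphi_i\varphi_j\,dx,\quad m_i=\int_\Omega\varphi_i\,dx,\quad \mathbf c_{ij}=\int_\Omega\varphi_i\nabla\varphi_j\,dx,\quad s_{ij}=\int_\Omega\nabla\varphi_i\cdot\nabla\varphi_j\,dx .$$ Let $\nu_h\ge0$ with $\nu_h\to0$ (for instance $\nu_h=0$, the scheme for the incompressible Euler equations). Let $d^u_{ij}(t)$ be artificial viscosity coefficients, possibly depending on the numerical solution, with $d^u_{ij}=d^u_{ji}\ge0$ for $j\ne i$, $\sum_jd^u_{ij}=0$,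 and $d^u_{ij}=0$ for $j\notin\mathcal N_i$. Let $d^p_{ij}=\omega m_{ij}$ for $j\neq i$ and $d^p_{ii}=-\sum_{k\in\mathcal N_i\setminus\{i\}}\omega m_{ik}$. Let $\mathbf u_h=\sum_i\mathbf u_i(t)\varphi_i$ and $p_h=\sum_ip_i(t)\varphi_i$ be a solution, for $t\in(0,T)$ and with $\mathbf u_h$ continuous on $[0,T]$, of the stabilized semi-discrete scheme $$m_i\frac{d\mathbf u_i}{dt}=\sum_{j\in\mathcal N_i}\Big[\Big(d^u_{ij}-\frac{\mathbf u_j+\mathbf u_i}2\cdot\mathbf c_{ij}-\nu_hs_{ij}\Big)\mathbf u_j-\mathbf c_{ij}p_j\Big],\qquad 0=\sum_{j\in\mathcal N_i}\big[d^p_{ij}p_j-\mathbf c_{ij}\cdot\mathbf u_j\big],\qquad \int_\Omega p_h\,dx=0,$$ with arbitrary initial values $\mathbf u_i(0)$. Assume that there is a constant $C$ independent of $h$ such that on $(0,T)$ 1. $|\mathbf u_i|\le C$ and $|p_i|\le C$ for all $i$ (uniform boundedness); 2. $d^u_{ij}\le C\,h^{d-1}$ for all $j\ne i$; 3. the dissipation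 controls the velocity jumps up to a bounded remainder, $$\int_0^T h^{d-1}\sum_i\sum_{j\in\mathcal N_i\setminus\{i\}}|\mathbf u_j-\mathbf u_i|^2\,dt\le C\Big(1+\int_0^T\sum_i\sum_{j\in\mathcal N_i\setminus\{i\}}(d^u_{ij}-\nu_hs_{ij})\,|\mathbf u_j-\mathbf u_i|^2\,dt\Big).$$ Then the scheme is consistent with the weak form of the incompressible Euler equations in the following sense. * For every $q\in C^1_c(\Omega)$, the error $e_{q_h}(q,t)=\int_\Omega\mathbf u_h\cdot\nabla q\,dx$ is integrable on $(0,T)$ and $\|e_{q_h}(q,\cdot)\|_{L^1(0,T)}\to0$ as $h\to0$. * For every $\mathbf v\in C^2_c([0,T)\times\Omega;\mathbb R^d)$ with $\nabla\cdot\mathbf v=0$ there is $e_{\mathbf u_h}(\mathbf v,\cdot)\in L^1(0,T)$ such that for all $\tau\in(0,T]$ $$\Big[\int_\Omega\mathbf u_h\cdot\mathbf v\,dx\Big]_{t=0}^{t=\tau}=\int_0^\tau\!\!\int_\Omega\big[\mathbf u_h\cdot\partial_t\mathbf v+(\mathbf u_h\otimes\mathbf u_h):\nabla\mathbf v\big]dx\,dt+\int_0^\tau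 e_{\mathbf u_h}(\mathbf v,t)\,dt,$$ and any such errors satisfy $\|e_{\mathbf u_h}(\mathbf v,\cdot)\|_{L^1(0,T)}\to0$ as $h\to0$. -/

import Mathlib

open MeasureTheory Filter Topology Set

noncomputable section

namespace PeriodicFEM

/-- Points and vectors of `ℝ^d` with the Euclidean norm. -/
abbrev Vec (d : ℕ) := EuclideanSpace ℝ (Fin d)

/-- The open period box `Ω = (0, L₁) × ⋯ × (0, L_d)`. -/
def box {d : ℕ} (L : Fin d → ℝ) : Set (Vec d) := {x | ∀ k, 0 < x k ∧ x k < L k}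

/-- The half-open period box, which contains one representative of every point of the torus. -/
def cellBox {d : ℕ} (L : Fin d → ℝ) : Set (Vec d) := {x | ∀ k, 0 ≤ x k ∧ x k < L k}

/-- Two points are identified by periodicity. -/
def Congr {d : ℕ} (L : Fin d → ℝ) (x y : Vec d) : Prop :=
  ∀ k, ∃ m : ℤ, x k - y k = m * L k

/-- A conforming simplex mesh of the periodic domain, written as a simplicial complex that covers
`ℝ^d`, is invariant under the period translations, consists of `d`-simplices and their faces, and
has finitely many simplices up to period translations. -/
structure PeriodicMesh {d : ℕ} (L : Fin d → ℝ) where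
  complex : Geometry.SimplicialComplex ℝ (Vec d)
  space_eq : complex.space = Set.univ
  translate_mem : ∀ s ∈ complex.faces, ∀ z : Vec d, Congr L z 0 →
    s.map (addRightEmbedding z) ∈ complex.faces
  pure_dim : ∀ s ∈ complex.faces, ∃ t ∈ complex.faces, s ⊆ t ∧ t.card = d + 1
  finite_faces : {s | s ∈ complex.faces ∧ ∃ x ∈ s, x ∈ cellBox L}.Finite

namespace PeriodicMesh

variable {d : ℕ} {L : Fin d → ℝ} (M : PeriodicMesh L)

/-- The nodes: one representative of each class of periodically identified vertices. -/
def Node : Type := {x : Vec d // x ∈ M.complex.vertices ∧ x ∈ cellBox L}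

theorem finite_node : Finite M.Node := by
  have := M.finite_faces.to_subtype
  refine Finite.of_injective
    (fun x : M.Node => (⟨{x.1}, x.2.1, x.1, Finset.mem_singleton_self _, x.2.2⟩ :
      {s | s ∈ M.complex.faces ∧ ∃ x ∈ s, x ∈ cellBox L})) ?_
  intro x y h
  exact Subtype.ext (Finset.singleton_injective (congrArg Subtype.val h))

instance : Fintype M.Node := @Fintype.ofFinite _ M.finite_node

instance : DecidableEq M.Node := Classical.decEq _

/-- The mesh size: the largest diameter of a simplex of the mesh. -/
def h : ℝ := sSup {r | ∃ s ∈ M.complex.faces, r = Metric.diam (convexHull ℝ (s : Set (Vec d)))}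

open Classical in
/-- The value at `x` of the periodic hat function of the vertex `a`: write `x` as a convex
combination of the vertices of a simplex that contains it and add up the weights of the vertices
that are periodic copies of `a`. The set below has exactly one element, see `hat_eq`. -/
def hat (a x : Vec d) : ℝ :=
  sSup {c | ∃ s ∈ M.complex.faces, ∃ w : Vec d → ℝ, (∀ y ∈ s, 0 ≤ w y) ∧ ∑ y ∈ s, w y = 1 ∧
    ∑ y ∈ s, w y • y = x ∧ c = ∑ y ∈ s with Congr L y a, w y}

/-- The weights of a point with respect to an affinely independent set are unique. -/
theorem weights_unique {s : Finset (Vec d)} (hs : s ∈ M.complex.faces) {w w' : Vec d → ℝ}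
    (h1 : ∑ y ∈ s, w y = ∑ y ∈ s, w' y) (h2 : ∑ y ∈ s, w y • y = ∑ y ∈ s, w' y • y) :
    ∀ y ∈ s, w y = w' y := by
  intro y hy
  have h := affineIndependent_iff.1 (M.complex.indep hs) Finset.univ (fun e => w e.1 - w' e.1)
    (by
      rw [Finset.sum_coe_sort s (fun e => w e - w' e), Finset.sum_sub_distrib, h1, sub_self])
    (by
      rw [Finset.sum_coe_sort s (fun e => (w e - w' e) • e)]
      simp only [sub_smul, Finset.sum_sub_distrib, h2, sub_self])
    ⟨y, hy⟩ (Finset.mem_univ _)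
  exact sub_eq_zero.1 h

open Classical in
/-- The hat functions are well defined and can be computed in any simplex. -/
theorem hat_eq (a : Vec d) {s : Finset (Vec d)} (hs : s ∈ M.complex.faces) {w : Vec d → ℝ}
    (h0 : ∀ y ∈ s, 0 ≤ w y) (h1 : ∑ y ∈ s, w y = 1) :
    M.hat a (∑ y ∈ s, w y • y) = ∑ y ∈ s with Congr L y a, w y := by
  have key : {c | ∃ t ∈ M.complex.faces, ∃ w' : Vec d → ℝ, (∀ y ∈ t, 0 ≤ w' y) ∧
      ∑ y ∈ t, w' y = 1 ∧ ∑ y ∈ t, w' y • y = ∑ y ∈ s, w y • y ∧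
      c = ∑ y ∈ t with Congr L y a, w' y} = {∑ y ∈ s with Congr L y a, w y} := by
    ext c
    simp only [mem_ofPred_eq, mem_singleton_iff]
    refine ⟨?_, fun hc => ⟨s, hs, w, h0, h1, rfl, hc⟩⟩
    rintro ⟨t, ht, w', h0', h1', h2', rfl⟩
    have hxs : ∑ y ∈ s, w y • y ∈ convexHull ℝ (s : Set (Vec d)) :=
      Finset.mem_convexHull'.2 ⟨w, h0, h1, rfl⟩
    have hxt : ∑ y ∈ s, w y • y ∈ convexHull ℝ (t : Set (Vec d)) :=
      Finset.mem_convexHull'.2 ⟨w', h0', h1', h2'⟩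
    have hx := M.complex.inter_subset_convexHull hs ht ⟨hxs, hxt⟩
    rw [← Finset.coe_inter] at hx
    obtain ⟨g, -, hg1, hg2⟩ := Finset.mem_convexHull'.1 hx
    have ext1 : ∀ r : Finset (Vec d), s ∩ t ⊆ r →
        ∑ y ∈ r, (if y ∈ s ∩ t then g y else 0) = 1 ∧
        ∑ y ∈ r, (if y ∈ s ∩ t then g y else 0) • y = ∑ y ∈ s, w y • y := by
      intro r hr
      constructor
      · rw [← hg1, Finset.sum_ite_mem, Finset.inter_eq_right.2 hr]
      · simp only [ite_smul, zero_smul]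
        rw [← hg2, Finset.sum_ite_mem, Finset.inter_eq_right.2 hr]
    have es := ext1 s Finset.inter_subset_left
    have et := ext1 t Finset.inter_subset_right
    have ws := M.weights_unique hs (h1.trans es.1.symm) es.2.symm
    have wt := M.weights_unique ht (h1'.trans et.1.symm) (h2'.trans et.2.symm)
    rw [Finset.sum_congr rfl (fun y hy => wt y (Finset.mem_filter.1 hy).1),
      Finset.sum_congr rfl (fun y hy => ws y (Finset.mem_filter.1 hy).1)]
    rw [Finset.sum_ite_mem, Finset.sum_ite_mem]
    refine Finset.sum_congr ?_ fun _ _ => rfl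
    ext y
    simp only [Finset.mem_inter, Finset.mem_filter]
    tauto
  rw [hat, key, csSup_singleton]

/-- The Lagrange basis function of a node. -/
def phi (i : M.Node) (x : Vec d) : ℝ := M.hat i.1 x

/-- `𝒩_i`: the nodes whose basis functions overlap with that of node `i`. -/
def nbr (i : M.Node) : Finset M.Node :=
  open Classical in {j | ∃ x, M.phi i x ≠ 0 ∧ M.phi j x ≠ 0}

/-- The consistent mass matrix. -/
def mass (i j : M.Node) : ℝ := ∫ x in box L, M.phi i x * M.phi j x

/-- The lumped masses. -/
def lump (i : M.Node) : ℝ := ∫ x in box L, M.phi i x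

/-- The coefficients of the discrete gradient. -/
def grad (i j : M.Node) : Vec d := ∫ x in box L, M.phi i x • gradient (M.phi j) x

/-- The stiffness matrix. -/
def stiff (i j : M.Node) : ℝ :=
  ∫ x in box L, inner ℝ (gradient (M.phi i) x) (gradient (M.phi j) x)

/-- The finite element function with given nodal values. -/
def fe {V : Type*} [AddCommGroup V] [Module ℝ V] (c : M.Node → V) (x : Vec d) : V :=
  ∑ i, M.phi i x • c i

/-- The discrete convection operator obtained from the structure-preserving quadrature. -/
def conv (u : M.Node → Vec d) (i j : M.Node) : ℝ :=
  inner ℝ ((1 / 2 : ℝ) • (u j + u i)) (M.grad i j)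

/-- The graph Laplacian of the Becker-Hansbo pressure stabilization with parameter `ω`. -/
def presStab (ω : ℝ) (i j : M.Node) : ℝ :=
  if j = i then -∑ k ∈ (M.nbr i).erase i, ω * M.mass i k else ω * M.mass i j

/-- The artificial viscosity operator is a graph Laplacian: symmetric, with nonnegative
off-diagonal entries, zero row sums, and the sparsity pattern of the mesh. -/
structure IsGraphLaplacian (D : M.Node → M.Node → ℝ) : Prop where
  symm : ∀ i j, D i j = D j i
  nonneg : ∀ i j, j ≠ i → 0 ≤ D i j
  row_sum : ∀ i, ∑ j, D i j = 0
  sparse : ∀ i j, j ∉ M.nbr i → D i j = 0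

/-- Nodal velocities `u` and pressures `p` solve the stabilized semi-discrete scheme with
viscosity `ν`, artificial viscosity coefficients `D t` and pressure stabilization parameter `ω`
on the time interval `[0, T]`. -/
structure IsSolution (ν ω T : ℝ) (D : ℝ → M.Node → M.Node → ℝ)
    (u : ℝ → M.Node → Vec d) (p : ℝ → M.Node → ℝ) : Prop where
  continuousOn : ∀ i, ContinuousOn (fun t => u t i) (Icc 0 T)
  differentiableAt : ∀ i, ∀ t ∈ Ioo 0 T, DifferentiableAt ℝ (fun s => u s i) t
  momentum : ∀ i, ∀ t ∈ Ioo 0 T, M.lump i • deriv (fun s => u s i) t =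
    ∑ j ∈ M.nbr i, ((D t i j - M.conv (u t) i j - ν * M.stiff i j) • u t j - p t j • M.grad i j)
  continuity : ∀ k, ∀ t ∈ Ioo 0 T,
    ∑ j ∈ M.nbr k, (M.presStab ω k j * p t j - inner ℝ (M.grad k j) (u t j)) = 0
  mean_zero : ∀ t ∈ Ioo 0 T, ∫ x in box L, M.fe (p t) x = 0

/-- The consistency error of the divergence-free condition: `∫_Ω u_h ⬝ ∇q dx`. -/
def divError (u : M.Node → Vec d) (q : Vec d → ℝ) : ℝ :=
  ∫ x in box L, inner ℝ (M.fe u x) (gradient q x)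

/-- `e` is the consistency error of the weak momentum equation on `(0, T)` for the test function
`v`. In the integrand, `(u ⊗ u) : ∇v = ∑ u_k u_l ∂_l v_k` is the inner product of the derivative
of `v` in the direction `u` with `u`. -/
def IsMomentumError (T : ℝ) (u : ℝ → M.Node → Vec d) (v : ℝ → Vec d → Vec d) (e : ℝ → ℝ) : Prop :=
  IntegrableOn e (Ioo 0 T) ∧ ∀ τ ∈ Ioc 0 T,
    (∫ x in box L, inner ℝ (M.fe (u τ) x) (v τ x)) - ∫ x in box L, inner ℝ (M.fe (u 0) x) (v 0 x) =
      (∫ t in (0)..τ, ∫ x in box L,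
        (inner ℝ (M.fe (u t) x) (deriv (fun s => v s x) t) +
          inner ℝ (fderiv ℝ (v t) x (M.fe (u t) x)) (M.fe (u t) x))) +
      ∫ t in (0)..τ, e t

end PeriodicMesh

/-- The meshes are uniformly shape regular with respect to their mesh sizes: every `d`-simplex
contains a ball whose radius is a fixed fraction of the mesh size. -/
def ShapeRegular {d : ℕ} {L : Fin d → ℝ} (M : ℕ → PeriodicMesh L) : Prop :=
  ∃ κ > 0, ∀ n, ∀ s ∈ (M n).complex.faces, s.card = d + 1 →
    ∃ x, Metric.ball x (κ * (M n).h) ⊆ convexHull ℝ (s : Set (Vec d))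

/-- The divergence of a vector field. -/
def divergence {d : ℕ} (f : Vec d → Vec d) (x : Vec d) : ℝ :=
  ∑ k, (fderiv ℝ f x (EuclideanSpace.single k 1)) k

end PeriodicFEM

end

/-!
The proof follows one mesh at a time and produces explicit bounds of both consistency errors in
terms of `h` and `ν`, with constants that depend on the meshes only through shape regularity.

*Energy.* The discrete gradient is antisymmetric, so the convective term does no work, and the
stabilized continuity equation makes the pressure dissipative. The dissipation is therefore
bounded by the initial energy (`integral_le_energy`). By the assumed control of the jumps this
bounds `∫ h^(d-1) ∑ ‖u_j - u_i‖²`, and since there are `O(h^(-d))` pairs of neighbours, Young's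
inequality gives `∫ h^d ∑ ‖u_j - u_i‖ = O(√h)` (`integral_jump_le`). It also bounds `∫ ν ‖∇u_h‖²`.

*Momentum error.* Integration in time identifies the error, up to null sets, with the residual
`∑ u_i' ⬝ ∫ φ_i v - ∫ (u_h ⊗ u_h) : ∇v` (`isMomentumError_momentumResidual`,
`IsMomentumError.ae_eq`). To bound it, the scheme is tested with the nodal values of `v`.
Artificial viscosity and pressure contribute `O(h^d ∑ ‖u_j - u_i‖)` and `O(h)`, the latter because
the interpolant of a solenoidal `v` is almost discretely solenoidal. The convective term is
handled by an exact algebraic identity (`sum_conv_add_eq`): it equals the weak convective term up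
to one half of the discrete divergence tested with `u_i ⬝ v_i`, which the continuity equation
turns into a pressure stabilization term, and up to a remainder of third order in the jumps. See
`abs_momentumResidual_le`.

*Mass lumping.* Replacing `∫ φ_i v` by `m_i v_i` costs `O(h ∑ m_i ‖u_i'‖)`, so a bound of the time
derivative is needed. Testing the scheme with `u_i'` turns the viscous and the pressure terms into
time derivatives of nonnegative quadratic forms. For the pressure, `p` need not be differentiable,
but its stabilization energy is a quadratic form of the discrete divergence of the velocity,
written with a generalized inverse (`hasDerivAt_quadratic`). Inverse estimates for the initial
data then show `∫ ∑ m_i ‖u_i'‖² = O(1 + ν / h² + 1 / h)`, hence `h ∫ ∑ m_i ‖u_i'‖ = O(√(h + ν))`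
(`integral_lump_deriv_sq_le`, `integral_lump_deriv_le`).

*Divergence error.* After integration by parts, `∫ u_h ⬝ ∇q` differs from the continuity equation
tested with the nodal values of `q` by `O(h^d ∑ ‖u_j - u_i‖)` (`abs_divError_le`).

All contributions are `O(√(h + ν))` in `L¹(0, T)`.

Test functions vanish near the boundary of the period cell and are not extended periodically; a
vertex outside of the cell is instead compared with its representative inside
(`SupportedInside.apply_eq`).
-/

noncomputable section

namespace PeriodicFEM

/-! ### Periodic identification of points -/

variable {d : ℕ} {L : Fin d → ℝ}

theorem Congr.refl (x : Vec d) : Congr L x x := fun _ => ⟨0, by simp⟩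

theorem Congr.symm {x y : Vec d} (h : Congr L x y) : Congr L y x := fun k => by
  obtain ⟨m, hm⟩ := h k
  exact ⟨-m, by push_cast; linarith⟩

theorem Congr.trans {x y z : Vec d} (h : Congr L x y) (h' : Congr L y z) :
    Congr L x z := fun k => by
  obtain ⟨m, hm⟩ := h k
  obtain ⟨m', hm'⟩ := h' k
  exact ⟨m + m', by push_cast; linarith⟩

theorem congr_sub_zero {x y : Vec d} : Congr L (x - y) 0 ↔ Congr L x y := by
  simp [Congr]

theorem Congr.sub_zero {x y : Vec d} (h : Congr L x y) : Congr L (x - y) 0 := congr_sub_zero.2 h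

theorem congr_add_self {x z : Vec d} (h : Congr L z 0) : Congr L (x + z) x :=
  congr_sub_zero.1 (by simpa using h)

theorem congr_neg {z : Vec d} (h : Congr L z 0) : Congr L (-z) 0 := by
  have := h.symm.sub_zero
  simpa using this

theorem exists_mem_cellBox (hL : ∀ k, 0 < L k) (y : Vec d) : ∃ x ∈ cellBox L, Congr L x y := by
  refine ⟨WithLp.toLp 2 fun k => y k - ⌊y k / L k⌋ * L k, fun k => ?_, fun k => ⟨-⌊y k / L k⌋, ?_⟩⟩
  · have h1 := Int.floor_le (y k / L k)
    have h2 := Int.lt_floor_add_one (y k / L k)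
    rw [le_div_iff₀ (hL k)] at h1
    rw [div_lt_iff₀ (hL k)] at h2
    constructor
    · simpa using h1
    · change y k - ⌊y k / L k⌋ * L k < L k
      linarith
  · change y k - ⌊y k / L k⌋ * L k - y k = _
    push_cast
    ring

theorem eq_of_congr_of_mem_cellBox (hL : ∀ k, 0 < L k) {x y : Vec d} (hx : x ∈ cellBox L)
    (hy : y ∈ cellBox L) (h : Congr L x y) : x = y := by
  ext k
  obtain ⟨m, hm⟩ := h k
  have h1 := hx k
  have h2 := hy k
  have hLk := hL k
  have hm1 : m < 1 := by
    by_contra hc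
    have : (1 : ℝ) ≤ m := by exact_mod_cast not_lt.1 hc
    nlinarith
  have hm2 : -1 < m := by
    by_contra hc
    have : (m : ℝ) ≤ -1 := by exact_mod_cast not_lt.1 hc
    nlinarith
  have : m = 0 := by omega
  subst this
  simp at hm
  linarith

theorem box_subset_cellBox : box L ⊆ cellBox L := fun _ hx k => ⟨(hx k).1.le, (hx k).2⟩

/-- There are only finitely many period vectors in a bounded region. -/
theorem finite_congr_zero (hL : ∀ k, 0 < L k) (R : ℝ) :
    {z : Vec d | Congr L z 0 ∧ ‖z‖ ≤ R}.Finite := by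
  choose N hN using fun k => exists_nat_ge (R / L k)
  have hfin : (Set.pi univ fun k => Set.Icc (-(N k : ℤ)) (N k)).Finite :=
    Set.Finite.pi fun k => Set.finite_Icc _ _
  refine (hfin.image fun m => WithLp.toLp 2 fun k => (m k : ℝ) * L k).subset ?_
  rintro z ⟨hz, hzR⟩
  choose m hm using hz
  refine ⟨m, fun k _ => ?_, ?_⟩
  · have h1 : |(m k : ℝ) * L k| ≤ R := by
      rw [← hm k]
      simpa using (PiLp.norm_apply_le z k).trans hzR
    rw [abs_mul, abs_of_pos (hL k), ← le_div_iff₀ (hL k)] at h1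
    have h2 : |m k| ≤ N k := by exact_mod_cast h1.trans (hN k)
    exact abs_le.1 h2
  · ext k
    have := hm k
    simp at this
    simp [this]

theorem isBounded_cellBox (L : Fin d → ℝ) : Bornology.IsBounded (cellBox L) := by
  refine (isBounded_iff_forall_norm_le).2 ⟨∑ k, |L k|, fun x hx => ?_⟩
  have : ‖x‖ ≤ ∑ k, |x k| := by
    have h := norm_sum_le Finset.univ fun k => x k • (EuclideanSpace.basisFun (Fin d) ℝ) k
    rw [show ∑ k, x k • (EuclideanSpace.basisFun (Fin d) ℝ) k = x by
      simpa using (EuclideanSpace.basisFun (Fin d) ℝ).sum_repr x] at h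
    simpa [norm_smul] using h
  refine this.trans (Finset.sum_le_sum fun k _ => ?_)
  rw [abs_of_nonneg (hx k).1]
  exact (hx k).2.le.trans (le_abs_self _)

namespace PeriodicMesh

variable (M : PeriodicMesh L)

/-! ### Simplices, vertices and the mesh size -/

theorem exists_translate_mem (hL : ∀ k, 0 < L k) {s : Finset (Vec d)} (hs : s ∈ M.complex.faces)
    {y : Vec d} (hy : y ∈ s) : ∃ z, Congr L z 0 ∧ y + z ∈ cellBox L ∧
      s.map (addRightEmbedding z) ∈ M.complex.faces ∧ y + z ∈ s.map (addRightEmbedding z) := by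
  obtain ⟨x, hx, hxy⟩ := exists_mem_cellBox hL y
  refine ⟨x - y, hxy.sub_zero, by simpa using hx, M.translate_mem s hs _ hxy.sub_zero, ?_⟩
  exact Finset.mem_map.2 ⟨y, hy, rfl⟩

theorem diam_convexHull_map (s : Finset (Vec d)) (z : Vec d) :
    Metric.diam (convexHull ℝ ((s.map (addRightEmbedding z) : Finset (Vec d)) : Set (Vec d))) =
      Metric.diam (convexHull ℝ (s : Set (Vec d))) := by
  rw [convexHull_diam, convexHull_diam, Finset.coe_map]
  exact Isometry.diam_image (isometry_add_right z) _

theorem face_nonempty {s : Finset (Vec d)} (hs : s ∈ M.complex.faces) : s.Nonempty :=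
  (M.complex.isRelLowerSet_faces hs).1

theorem bddAbove_diam (hL : ∀ k, 0 < L k) :
    BddAbove {r | ∃ s ∈ M.complex.faces, r = Metric.diam (convexHull ℝ (s : Set (Vec d)))} := by
  refine ((M.finite_faces.image fun s : Finset (Vec d) =>
    Metric.diam (convexHull ℝ (s : Set (Vec d)))).bddAbove).mono ?_
  rintro r ⟨s, hs, rfl⟩
  obtain ⟨y, hy⟩ := M.face_nonempty hs
  obtain ⟨z, -, hz1, hz2, hz3⟩ := M.exists_translate_mem hL hs hy
  exact ⟨_, ⟨hz2, _, hz3, hz1⟩, diam_convexHull_map s z⟩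

theorem dist_le_h (hL : ∀ k, 0 < L k) {s : Finset (Vec d)} (hs : s ∈ M.complex.faces) {x y : Vec d}
    (hx : x ∈ convexHull ℝ (s : Set (Vec d))) (hy : y ∈ convexHull ℝ (s : Set (Vec d))) :
    dist x y ≤ M.h :=
  (Metric.dist_le_diam_of_mem (isBounded_convexHull.2 s.finite_toSet.isBounded) hx hy).trans
    (le_csSup (M.bddAbove_diam hL) ⟨s, hs, rfl⟩)

/-- Every point is a convex combination of the vertices of a simplex of full dimension. -/
theorem exists_weights (x : Vec d) : ∃ s ∈ M.complex.faces, s.card = d + 1 ∧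
    ∃ w : Vec d → ℝ, (∀ y ∈ s, 0 ≤ w y) ∧ ∑ y ∈ s, w y = 1 ∧ ∑ y ∈ s, w y • y = x := by
  have hx : x ∈ M.complex.space := by rw [M.space_eq]; trivial
  obtain ⟨s, hs, hxs⟩ := Geometry.SimplicialComplex.mem_space_iff.1 hx
  obtain ⟨t, ht, hst, hcard⟩ := M.pure_dim s hs
  exact ⟨t, ht, hcard, Finset.mem_convexHull'.1 (convexHull_mono (Finset.coe_subset.2 hst) hxs)⟩

theorem h_pos (hd : 0 < d) (hL : ∀ k, 0 < L k) : 0 < M.h := by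
  obtain ⟨s, hs, hcard, -⟩ := M.exists_weights 0
  obtain ⟨x, hx, y, hy, hxy⟩ := Finset.one_lt_card.1 (show 1 < s.card by omega)
  exact (dist_pos.2 hxy).trans_le
    (M.dist_le_h hL hs (subset_convexHull ℝ _ hx) (subset_convexHull ℝ _ hy))

theorem mem_vertices_of_mem {s : Finset (Vec d)} (hs : s ∈ M.complex.faces) {y : Vec d}
    (hy : y ∈ s) : y ∈ M.complex.vertices :=
  (M.complex.isRelLowerSet_faces hs).2 (Finset.singleton_subset_iff.2 hy)
    (Finset.singleton_nonempty y)

/-- Every vertex is a periodic copy of exactly one node. -/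
theorem existsUnique_node (hL : ∀ k, 0 < L k) {y : Vec d} (hy : y ∈ M.complex.vertices) :
    ∃! i : M.Node, Congr L y i.1 := by
  obtain ⟨x, hx, hxy⟩ := exists_mem_cellBox hL y
  have h1 := M.translate_mem {y} hy (x - y) hxy.sub_zero
  refine ⟨⟨x, ?_, hx⟩, hxy.symm, fun j hj => ?_⟩
  · simpa [Geometry.SimplicialComplex.vertices] using h1
  · exact Subtype.ext (eq_of_congr_of_mem_cellBox hL j.2.2 hx (hj.symm.trans hxy.symm))

/-! ### Elementary properties of the basis functions -/

open Classical in
theorem phi_eq (i : M.Node) {s : Finset (Vec d)} (hs : s ∈ M.complex.faces) {w : Vec d → ℝ}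
    (h0 : ∀ y ∈ s, 0 ≤ w y) (h1 : ∑ y ∈ s, w y = 1) :
    M.phi i (∑ y ∈ s, w y • y) = ∑ y ∈ s, if Congr L y i.1 then w y else 0 := by
  rw [phi, M.hat_eq i.1 hs h0 h1, Finset.sum_filter]

/-- On a simplex, a finite element function is the affine interpolant of its vertex values. -/
theorem fe_eq (hL : ∀ k, 0 < L k) {V : Type*} [AddCommGroup V] [Module ℝ V] {s : Finset (Vec d)}
    (hs : s ∈ M.complex.faces) {w : Vec d → ℝ} (h0 : ∀ y ∈ s, 0 ≤ w y) (h1 : ∑ y ∈ s, w y = 1)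
    (c : M.Node → V) (g : Vec d → V) (hg : ∀ y ∈ s, ∀ i : M.Node, Congr L y i.1 → c i = g y) :
    M.fe c (∑ y ∈ s, w y • y) = ∑ y ∈ s, w y • g y := by
  classical
  simp only [fe, M.phi_eq _ hs h0 h1, Finset.sum_smul]
  rw [Finset.sum_comm]
  refine Finset.sum_congr rfl fun y hy => ?_
  obtain ⟨i, hi, huniq⟩ := M.existsUnique_node hL (M.mem_vertices_of_mem hs hy)
  rw [Finset.sum_eq_single i]
  · simp only [if_pos hi, hg y hy i hi]
  · intro j _ hj
    rw [if_neg fun hc => hj (huniq j hc), zero_smul]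
  · simp

theorem sum_phi (hL : ∀ k, 0 < L k) (x : Vec d) : ∑ i, M.phi i x = 1 := by
  obtain ⟨s, hs, -, w, h0, h1, rfl⟩ := M.exists_weights x
  have := M.fe_eq hL hs h0 h1 (fun _ => (1 : ℝ)) (fun _ => 1) (fun _ _ _ _ => rfl)
  simpa [fe, h1] using this

theorem phi_nonneg (i : M.Node) (x : Vec d) : 0 ≤ M.phi i x := by
  classical
  obtain ⟨s, hs, -, w, h0, h1, rfl⟩ := M.exists_weights x
  rw [M.phi_eq i hs h0 h1]
  exact Finset.sum_nonneg fun y hy => by split_ifs <;> simp [h0 y hy]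

theorem phi_le_one (hL : ∀ k, 0 < L k) (i : M.Node) (x : Vec d) : M.phi i x ≤ 1 := by
  rw [← M.sum_phi hL x]
  exact Finset.single_le_sum (fun j _ => M.phi_nonneg j x) (Finset.mem_univ i)

theorem phi_add_period (i : M.Node) (x : Vec d) {z : Vec d} (hz : Congr L z 0) :
    M.phi i (x + z) = M.phi i x := by
  classical
  obtain ⟨s, hs, -, w, h0, h1, rfl⟩ := M.exists_weights x
  have e : ∑ y ∈ s.map (addRightEmbedding z), w (y - z) • y = ∑ y ∈ s, w y • y + z := by
    rw [Finset.sum_map]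
    simp only [addRightEmbedding_apply, add_sub_cancel_right, smul_add, Finset.sum_add_distrib]
    rw [← Finset.sum_smul, h1, one_smul]
  rw [← e, M.phi_eq i (M.translate_mem s hs z hz) (w := fun y => w (y - z)), M.phi_eq i hs h0 h1,
    Finset.sum_map]
  · refine Finset.sum_congr rfl fun y _ => ?_
    simp only [addRightEmbedding_apply, add_sub_cancel_right]
    exact if_congr ⟨fun h => (congr_add_self hz).symm.trans h, fun h => (congr_add_self hz).trans h⟩
      rfl rfl
  · intro y hy
    obtain ⟨y', hy', rfl⟩ := Finset.mem_map.1 hy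
    simpa using h0 y' hy'
  · simpa [Finset.sum_map] using h1

theorem phi_congr (i : M.Node) {x y : Vec d} (h : Congr L x y) : M.phi i x = M.phi i y := by
  simpa using M.phi_add_period i y h.sub_zero

/-- A point in the support of a basis function lies within distance `h` of a periodic copy of
the node. -/
theorem exists_near_of_phi_ne_zero (hL : ∀ k, 0 < L k) {i : M.Node} {x : Vec d}
    (h : M.phi i x ≠ 0) : ∃ y, Congr L y i.1 ∧ dist x y ≤ M.h := by
  classical
  obtain ⟨s, hs, -, w, h0, h1, rfl⟩ := M.exists_weights x
  rw [M.phi_eq i hs h0 h1] at h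
  obtain ⟨y, hy, hne⟩ := Finset.exists_ne_zero_of_sum_ne_zero h
  refine ⟨y, by_contra fun hc => hne (if_neg hc), M.dist_le_h hL hs ?_ (subset_convexHull ℝ _ hy)⟩
  exact Finset.mem_convexHull'.2 ⟨w, h0, h1, rfl⟩

theorem phi_self (i : M.Node) : M.phi i i.1 = 1 := by
  classical
  have h := M.phi_eq i (s := {i.1}) i.2.1 (w := fun _ => 1) (fun _ _ => zero_le_one) (by simp)
  rw [Finset.sum_singleton, Finset.sum_singleton, one_smul, if_pos (Congr.refl _)] at h
  exact h

theorem mem_nbr {i j : M.Node} : j ∈ M.nbr i ↔ ∃ x, M.phi i x ≠ 0 ∧ M.phi j x ≠ 0 := by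
  simp [nbr]

theorem self_mem_nbr (i : M.Node) : i ∈ M.nbr i :=
  M.mem_nbr.2 ⟨i.1, by simp [M.phi_self i]⟩

/-! ### Lipschitz continuity of the basis functions -/

/-- On a simplex of full dimension the basis functions are affine. -/
theorem exists_affine_eq_phi (i : M.Node) {s : Finset (Vec d)} (hs : s ∈ M.complex.faces)
    (hcard : s.card = d + 1) : ∃ g : Vec d →ᵃ[ℝ] ℝ, (∀ y ∈ s, g y = 0 ∨ g y = 1) ∧
      ∀ x ∈ convexHull ℝ (s : Set (Vec d)), M.phi i x = g x := by
  classical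
  have hind := M.complex.indep hs
  let b : AffineBasis s ℝ (Vec d) := ⟨((↑) : s → Vec d), hind, by
    rw [hind.affineSpan_eq_top_iff_card_eq_finrank_add_one]
    simp [hcard]⟩
  let g : Vec d →ᵃ[ℝ] ℝ := ∑ y : s, if Congr L y i.1 then b.coord y else 0
  have hg : ∀ y : s, g y = if Congr L y i.1 then 1 else 0 := by
    intro y
    have e : g y = ∑ y' : s, (if Congr L y' i.1 then b.coord y' else 0) (b y) := by
      simp only [g]
      induction (Finset.univ : Finset s) using Finset.induction_on with
      | empty => simp
      | insert a t ha ih => rw [Finset.sum_insert ha, Finset.sum_insert ha, ← ih]; rfl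
    rw [e, Finset.sum_eq_single y]
    · split_ifs
      · exact b.coord_apply_eq y
      · rfl
    · intro y' _ hne
      split_ifs
      · exact b.coord_apply_ne hne
      · rfl
    · simp
  refine ⟨g, fun y hy => ?_, fun x hx => ?_⟩
  · rw [hg ⟨y, hy⟩]
    split_ifs <;> simp
  · obtain ⟨w, h0, h1, rfl⟩ := Finset.mem_convexHull'.1 hx
    have e := Finset.map_affineCombination s id w h1 g
    rw [Finset.affineCombination_eq_linear_combination s _ w h1,
      Finset.affineCombination_eq_linear_combination s _ w h1] at e
    refine (M.phi_eq i hs h0 h1).trans (Eq.trans ?_ e.symm)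
    refine Finset.sum_congr rfl fun y hy => ?_
    simp [hg ⟨y, hy⟩]

/-- The mesh is locally finite. -/
theorem finite_faces_meeting (hL : ∀ k, 0 < L k) (R : ℝ) :
    {s | s ∈ M.complex.faces ∧
      (convexHull ℝ (s : Set (Vec d)) ∩ Metric.closedBall 0 R).Nonempty}.Finite := by
  obtain ⟨B, hB⟩ := isBounded_iff_forall_norm_le.1 (isBounded_cellBox L)
  have hfin := (M.finite_faces.prod (finite_congr_zero hL (B + M.h + R)))
  refine (hfin.image fun q => q.1.map (addRightEmbedding q.2)).subset ?_
  rintro s ⟨hs, x, hxs, hxR⟩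
  obtain ⟨y, hy⟩ := M.face_nonempty hs
  obtain ⟨z, hz, hz1, hz2, hz3⟩ := M.exists_translate_mem hL hs hy
  refine ⟨(s.map (addRightEmbedding z), -z), ⟨⟨hz2, _, hz3, hz1⟩, congr_neg hz, ?_⟩, ?_⟩
  · have h1 := hB _ hz1
    have h2 := M.dist_le_h hL hs hxs (subset_convexHull ℝ _ hy)
    rw [mem_closedBall_zero_iff] at hxR
    rw [dist_eq_norm] at h2
    have : -z = (x - (y + z)) - (x - y) := by abel
    calc ‖-z‖ = ‖x - (y + z) - (x - y)‖ := by rw [← this]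
      _ ≤ ‖x‖ + ‖y + z‖ + ‖x - y‖ := by
        refine (norm_sub_le _ _).trans ?_
        gcongr
        exact norm_sub_le _ _
      _ ≤ B + M.h + R := by linarith
  · ext v
    simp

theorem continuous_phi (hL : ∀ k, 0 < L k) (i : M.Node) : Continuous (M.phi i) := by
  let S : Type := {s | s ∈ M.complex.faces ∧ s.card = d + 1}
  have hlf : LocallyFinite fun s : S => convexHull ℝ ((s : Finset (Vec d)) : Set (Vec d)) := by
    intro x
    refine ⟨Metric.ball x 1, Metric.ball_mem_nhds x one_pos, ?_⟩
    refine Set.Finite.preimage (f := Subtype.val)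
      (s := {s | s ∈ M.complex.faces ∧
        (convexHull ℝ (s : Set (Vec d)) ∩ Metric.closedBall 0 (‖x‖ + 1)).Nonempty})
      Subtype.val_injective.injOn (M.finite_faces_meeting hL _) |>.subset ?_
    rintro s ⟨y, hy1, hy2⟩
    refine ⟨s.2.1, y, hy1, ?_⟩
    rw [mem_closedBall_zero_iff]
    rw [Metric.mem_ball, dist_eq_norm] at hy2
    have := norm_le_insert' y x
    linarith
  refine hlf.continuous ?_ (fun s => ?_) (fun s => ?_)
  · refine Set.eq_univ_of_forall fun x => ?_
    obtain ⟨s, hs, hcard, hx⟩ := M.exists_weights x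
    exact Set.mem_iUnion.2 ⟨⟨s, hs, hcard⟩, Finset.mem_convexHull'.2 hx⟩
  · exact (s : Finset (Vec d)).finite_toSet.isClosed_convexHull (𝕜 := ℝ)
  · obtain ⟨g, -, hg⟩ := M.exists_affine_eq_phi i s.2.1 s.2.2
    exact (AffineMap.continuous_of_finiteDimensional g).continuousOn.congr hg

end PeriodicMesh

end PeriodicFEM

namespace PeriodicFEM

variable {d : ℕ} {L : Fin d → ℝ}

/-- A continuous function on an interval that is `K`-Lipschitz on each of finitely many closed sets
covering the interval is `K`-Lipschitz between the end points. -/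
theorem abs_sub_le_of_finite_closed_cover {ι : Type*} {S : Set ι} (hS : S.Finite) {I : ι → Set ℝ}
    (hI : ∀ i ∈ S, IsClosed (I i)) (hcov : Icc (0 : ℝ) 1 ⊆ ⋃ i ∈ S, I i) {f : ℝ → ℝ}
    (hf : Continuous f) {K : ℝ} (hK : ∀ i ∈ S, ∀ a ∈ I i, ∀ b ∈ I i, |f a - f b| ≤ K * |a - b|) :
    |f 1 - f 0| ≤ K := by
  have key : Icc (0 : ℝ) 1 ⊆ {t | |f t - f 0| ≤ K * t} := by
    refine IsClosed.Icc_subset_of_forall_exists_gt ?_ (by simp) ?_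
    · exact (isClosed_le (by fun_prop) (by fun_prop)).inter isClosed_Icc
    · rintro x ⟨hx, hx0, hx1⟩ y (hy : x < y)
      have hev : ∀ᶠ t in 𝓝[>] x, t ∈ Ioc x (min y 1) :=
        Ioc_mem_nhdsGT (lt_min hy hx1)
      -- one of the closed sets contains points arbitrarily close to `x` on its right
      obtain ⟨i, hi, hfreq⟩ : ∃ i ∈ S, ∃ᶠ t in 𝓝[>] x, t ∈ I i := by
        by_contra hc
        push Not at hc
        have hall : ∀ᶠ t in 𝓝[>] x, ∀ i ∈ S, t ∉ I i := (eventually_all_finite hS).2 hc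
        obtain ⟨t, ht1, ht2⟩ := (hall.and hev).exists
        obtain ⟨i, hi, hti⟩ := Set.mem_iUnion₂.1
          (hcov ⟨hx0.trans ht2.1.le, ht2.2.trans (min_le_right _ _)⟩)
        exact ht1 i hi hti
      have hxi : x ∈ I i := by
        rw [← (hI i hi).closure_eq, mem_closure_iff_frequently]
        exact hfreq.filter_mono nhdsWithin_le_nhds
      obtain ⟨t, hti, ht⟩ := (hfreq.and_eventually hev).exists
      refine ⟨t, ?_, ht.1, ht.2.trans (min_le_left _ _)⟩
      have h1 := hK i hi t hti x hxi
      rw [abs_of_pos (sub_pos.2 ht.1)] at h1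
      have h2 := abs_sub_le (f t) (f x) (f 0)
      simp only [Set.mem_ofPred_eq] at hx ⊢
      linarith
  simpa using key (right_mem_Icc.2 zero_le_one)

/-- An affine function with values in `[0, 1]` on a ball of radius `r` is `2 / r`-Lipschitz. -/
theorem affine_abs_sub_le {g : Vec d →ᵃ[ℝ] ℝ} {x₀ : Vec d} {r : ℝ} (hr : 0 < r)
    (hg : ∀ x ∈ Metric.ball x₀ r, 0 ≤ g x ∧ g x ≤ 1) (x y : Vec d) :
    |g x - g y| ≤ 2 / r * ‖x - y‖ := by
  rcases eq_or_ne x y with rfl | hxy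
  · simp
  have hn : 0 < ‖x - y‖ := norm_pos_iff.2 (sub_ne_zero.2 hxy)
  have e : ∀ v : Vec d, g (x₀ + v) = g.linear v + g x₀ := fun v => by
    have := g.map_vadd x₀ v
    rwa [vadd_eq_add, vadd_eq_add, add_comm v] at this
  have e2 : g x - g y = g.linear (x - y) := by
    have := g.linearMap_vsub x y
    simpa using this.symm
  have hc : ‖(r / 2 / ‖x - y‖) • (x - y)‖ < r := by
    rw [norm_smul, Real.norm_of_nonneg (by positivity), div_mul_cancel₀ _ hn.ne']
    linarith
  have h1 := hg (x₀ + (r / 2 / ‖x - y‖) • (x - y)) (by simpa [mem_ball_iff_norm] using hc)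
  have h2 := hg x₀ (Metric.mem_ball_self hr)
  rw [e, map_smul, smul_eq_mul] at h1
  have h3 : |r / 2 / ‖x - y‖ * g.linear (x - y)| ≤ 1 := abs_le.2 ⟨by linarith, by linarith⟩
  rw [abs_mul, abs_of_pos (by positivity), div_mul_eq_mul_div, div_le_one hn] at h3
  rw [e2, div_mul_eq_mul_div, le_div_iff₀ hr]
  linarith

namespace PeriodicMesh

variable (M : PeriodicMesh L)

/-- The inverse estimate for the basis functions in Lipschitz form. On a simplex, a basis function
is affine with values in `[0, 1]`, which bounds its slope by means of the inscribed ball. -/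
theorem phi_abs_sub_le (hL : ∀ k, 0 < L k) {r : ℝ} (hr : 0 < r)
    (hball : ∀ s ∈ M.complex.faces, s.card = d + 1 →
      ∃ x, Metric.ball x r ⊆ convexHull ℝ (s : Set (Vec d)))
    (i : M.Node) (x y : Vec d) : |M.phi i x - M.phi i y| ≤ 2 / r * ‖x - y‖ := by
  set l : ℝ → Vec d := fun t => y + t • (x - y) with hl
  have hlc : Continuous l := by fun_prop
  have hfin := M.finite_faces_meeting hL (‖x‖ + ‖y‖)
  have hln : ∀ t ∈ Icc (0 : ℝ) 1, ‖l t‖ ≤ ‖x‖ + ‖y‖ := by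
    intro t ht
    have e : l t = (1 - t) • y + t • x := by simp only [hl]; module
    rw [e]
    refine (norm_add_le _ _).trans ?_
    rw [norm_smul, norm_smul, Real.norm_of_nonneg ht.1, Real.norm_of_nonneg (by linarith [ht.2])]
    nlinarith [norm_nonneg x, norm_nonneg y, ht.1, ht.2]
  have key := abs_sub_le_of_finite_closed_cover (f := fun t => M.phi i (l t))
    (S := {s | (s ∈ M.complex.faces ∧ (convexHull ℝ (s : Set (Vec d)) ∩
      Metric.closedBall 0 (‖x‖ + ‖y‖)).Nonempty) ∧ s.card = d + 1})
    (hfin.subset fun s hs => hs.1) (I := fun s => l ⁻¹' convexHull ℝ (s : Set (Vec d)))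
    (fun s _ => ((s.finite_toSet.isClosed_convexHull (𝕜 := ℝ))).preimage hlc) ?_
    ((M.continuous_phi hL i).comp hlc) (K := 2 / r * ‖x - y‖) ?_
  · simpa [hl] using key
  · intro t ht
    obtain ⟨s, hs, hcard, hx⟩ := M.exists_weights (l t)
    have hx' := Finset.mem_convexHull'.2 hx
    refine Set.mem_iUnion₂.2 ⟨s, ⟨⟨hs, l t, hx', ?_⟩, hcard⟩, hx'⟩
    exact mem_closedBall_zero_iff.2 (hln t ht)
  · rintro s ⟨⟨hs, -⟩, hcard⟩ a ha b hb
    obtain ⟨g, -, hg⟩ := M.exists_affine_eq_phi i hs hcard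
    obtain ⟨x₀, hx₀⟩ := hball s hs hcard
    simp only [Set.mem_preimage] at ha hb
    rw [hg _ ha, hg _ hb]
    refine (affine_abs_sub_le (x₀ := x₀) hr (fun z hz => ?_) _ _).trans (le_of_eq ?_)
    · rw [← hg z (hx₀ hz)]
      exact ⟨M.phi_nonneg i z, M.phi_le_one hL i z⟩
    · have : l a - l b = (a - b) • (x - y) := by simp only [hl]; module
      rw [this, norm_smul, Real.norm_eq_abs]
      ring

/-- Neighbouring basis functions are both bounded below on a ball of radius comparable to `h`. -/
theorem exists_ball_le_phi (hL : ∀ k, 0 < L k) {κ : ℝ} (hκ : 0 < κ) (hh : 0 < M.h)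
    (hball : ∀ s ∈ M.complex.faces, s.card = d + 1 →
      ∃ x, Metric.ball x (κ * M.h) ⊆ convexHull ℝ (s : Set (Vec d)))
    {i j : M.Node} (hij : j ∈ M.nbr i) : ∃ x₀, ∀ x ∈ Metric.ball x₀ (κ * M.h / 2),
      κ / (4 + κ) ≤ M.phi i x ∧ κ / (4 + κ) ≤ M.phi j x := by
  obtain ⟨x, hxi, hxj⟩ := M.mem_nbr.1 hij
  obtain ⟨s, hs, hcard, w, h0, h1, hw⟩ := M.exists_weights x
  obtain ⟨x₀, hx₀⟩ := hball s hs hcard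
  have hxs : x ∈ convexHull ℝ (s : Set (Vec d)) := Finset.mem_convexHull'.2 ⟨w, h0, h1, hw⟩
  have key : ∀ k : M.Node, M.phi k x ≠ 0 → ∀ z ∈ Metric.ball x₀ (κ * M.h / 2),
      κ / (4 + κ) ≤ M.phi k z := by
    intro k hk z hz
    obtain ⟨g, hg01, hg⟩ := M.exists_affine_eq_phi k hs hcard
    -- a vertex at which the basis function takes the value one
    obtain ⟨y, hy, hgy⟩ : ∃ y ∈ s, g y = 1 := by
      by_contra hc
      push Not at hc
      have hz' : ∀ y ∈ s, g y = 0 := fun y hy => (hg01 y hy).resolve_right (hc y hy)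
      refine hk ?_
      have e := Finset.map_affineCombination s id w h1 g
      rw [Finset.affineCombination_eq_linear_combination s _ w h1,
        Finset.affineCombination_eq_linear_combination s _ w h1] at e
      rw [hg x hxs, ← hw]
      refine e.trans (Finset.sum_eq_zero fun y hy => ?_)
      simp [hz' y hy]
    have hzs : z ∈ convexHull ℝ (s : Set (Vec d)) :=
      hx₀ (Metric.ball_subset_ball (by nlinarith [mul_pos hκ hh]) hz)
    have hys := subset_convexHull ℝ (s : Set (Vec d)) hy
    -- extend the segment from `y` through `z` a little further inside the inscribed ball
    set z' := AffineMap.lineMap y z (1 + κ / 4) with hz'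
    have hz's : z' ∈ convexHull ℝ (s : Set (Vec d)) := by
      refine hx₀ ?_
      have h2 := M.dist_le_h hL hs hzs hys
      rw [Metric.mem_ball] at hz ⊢
      refine (dist_triangle _ z _).trans_lt ?_
      have e : dist z' z = κ / 4 * dist z y := by
        rw [hz', AffineMap.lineMap_apply, dist_eq_norm, dist_eq_norm]
        rw [show ((1 + κ / 4) • (z -ᵥ y) +ᵥ y) - z = (κ / 4) • (z - y) by
          simp only [vsub_eq_sub, vadd_eq_add]; module]
        rw [norm_smul, Real.norm_of_nonneg (by positivity)]
      rw [e]
      nlinarith [mul_pos hκ hh]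
    have h3 := M.phi_nonneg k z'
    rw [hg z' hz's, hz', AffineMap.apply_lineMap, AffineMap.lineMap_apply, hgy] at h3
    rw [hg z hzs, div_le_iff₀ (by positivity)]
    simp only [vsub_eq_sub, vadd_eq_add, smul_eq_mul] at h3
    nlinarith
  exact ⟨x₀, fun z hz => ⟨key i hxi z hz, key j hxj z hz⟩⟩

end PeriodicMesh

/-! ### Integrals of periodic functions -/

/-- The basis of `ℝ^d` formed by the periods. -/
def periodBasis (L : Fin d → ℝ) (hL : ∀ k, 0 < L k) : Module.Basis (Fin d) ℝ (Vec d) :=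
  (EuclideanSpace.basisFun (Fin d) ℝ).toBasis.isUnitSMul fun k => (hL k).ne'.isUnit

theorem fundamentalDomain_periodBasis (hL : ∀ k, 0 < L k) :
    ZSpan.fundamentalDomain (periodBasis L hL) = cellBox L := by
  ext x
  simp only [ZSpan.mem_fundamentalDomain, cellBox, Set.mem_ofPred_eq]
  refine forall_congr' fun k => ?_
  have e : (periodBasis L hL).repr x k = x k / L k := by
    rw [periodBasis, Module.Basis.repr_isUnitSMul]
    simp [Units.smul_def, div_eq_inv_mul]
  rw [e, Set.mem_Ico, div_lt_one (hL k), le_div_iff₀ (hL k), zero_mul]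

theorem congr_zero_of_mem_span (hL : ∀ k, 0 < L k) {z : Vec d}
    (hz : z ∈ Submodule.span ℤ (range (periodBasis L hL))) : Congr L z 0 := by
  intro k
  obtain ⟨m, hm⟩ := ((periodBasis L hL).mem_span_iff_repr_mem ℤ z).1 hz k
  refine ⟨m, ?_⟩
  have e : (periodBasis L hL).repr z k = z k / L k := by
    rw [periodBasis, Module.Basis.repr_isUnitSMul]
    simp [Units.smul_def, div_eq_inv_mul]
  rw [e] at hm
  have := (hL k).ne'
  simp at hm ⊢
  field_simp at hm
  linarith

theorem isOpen_box (L : Fin d → ℝ) : IsOpen (box L) := by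
  have : box L = ⋂ k, {x : Vec d | 0 < x k ∧ x k < L k} := by
    ext; simp [box]
  rw [this]
  refine isOpen_iInter_of_finite fun k => ?_
  have hk : Continuous fun x : Vec d => x k := by fun_prop
  exact (isOpen_lt continuous_const hk).inter (isOpen_lt hk continuous_const)

theorem measurableSet_box (L : Fin d → ℝ) : MeasurableSet (box L) := (isOpen_box L).measurableSet

theorem box_ae_eq_cellBox (L : Fin d → ℝ) : (box L : Set (Vec d)) =ᵐ[volume] cellBox L := by
  have h1 : (Set.pi univ fun k => Ioo (0 : ℝ) (L k)) =ᵐ[volume]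
      (Set.pi univ fun k => Ico (0 : ℝ) (L k)) :=
    (Measure.univ_pi_Ioo_ae_eq_Icc (μ := fun _ : Fin d => (volume : Measure ℝ))
      (f := fun _ => 0) (g := L)).trans
    (Measure.univ_pi_Ico_ae_eq_Icc (μ := fun _ : Fin d => (volume : Measure ℝ))
      (f := fun _ => 0) (g := L)).symm
  have h2 := (EuclideanSpace.volume_preserving_symm_measurableEquiv_toLp
    (Fin d)).quasiMeasurePreserving.preimage_ae_eq h1
  have e1 : box L = (MeasurableEquiv.toLp 2 (Fin d → ℝ)).symm ⁻¹'
      (Set.pi univ fun k => Ioo (0 : ℝ) (L k)) := by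
    ext x; simp [box]
  have e2 : cellBox L = (MeasurableEquiv.toLp 2 (Fin d → ℝ)).symm ⁻¹'
      (Set.pi univ fun k => Ico (0 : ℝ) (L k)) := by
    ext x; simp [cellBox]
  rw [e1, e2]
  exact h2

theorem isBounded_box (L : Fin d → ℝ) : Bornology.IsBounded (box L) :=
  (isBounded_cellBox L).subset box_subset_cellBox

theorem volume_box_ne_top (L : Fin d → ℝ) : volume (box L : Set (Vec d)) ≠ ⊤ :=
  (isBounded_box L).measure_lt_top.ne

open scoped Pointwise in
/-- Integrals of periodic functions do not change when the period cell is translated. -/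
theorem setIntegral_vadd_cellBox (hL : ∀ k, 0 < L k) {f : Vec d → ℝ}
    (hf : ∀ x z, Congr L z 0 → f (x + z) = f x) (a : Vec d) :
    ∫ x in a +ᵥ cellBox L, f x = ∫ x in box L, f x := by
  have hF := ZSpan.isAddFundamentalDomain (periodBasis L hL) (volume : Measure (Vec d))
  rw [fundamentalDomain_periodBasis] at hF
  have : VAddInvariantMeasure (Submodule.span ℤ (range (periodBasis L hL))) (Vec d) volume :=
    ⟨fun g s _ => measure_preimage_add volume (g : Vec d) s⟩
  have hF' : IsAddFundamentalDomain (Submodule.span ℤ (range (periodBasis L hL)))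
    (a +ᵥ cellBox L) (volume : Measure (Vec d)) := hF.vadd_of_comm a
  rw [setIntegral_congr_set (box_ae_eq_cellBox L)]
  refine hF'.setIntegral_eq hF fun g x => ?_
  have := hf x g (congr_zero_of_mem_span hL g.2)
  rwa [add_comm] at this

open scoped Pointwise in
theorem setIntegral_add_right (hL : ∀ k, 0 < L k) {f : Vec d → ℝ}
    (hf : ∀ x z, Congr L z 0 → f (x + z) = f x) (a : Vec d) :
    ∫ x in box L, f (x + a) = ∫ x in box L, f x := by
  rw [← setIntegral_vadd_cellBox hL hf a, setIntegral_congr_set (box_ae_eq_cellBox L)]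
  have h := (measurePreserving_add_right (volume : Measure (Vec d)) a).setIntegral_preimage_emb
    (measurableEmbedding_addRight a) f (a +ᵥ cellBox L)
  rw [← h]
  congr 2
  ext x
  simp [Set.mem_vadd_set_iff_neg_vadd_mem, add_comm]

end PeriodicFEM

namespace PeriodicFEM

variable {d : ℕ} {L : Fin d → ℝ}

theorem exists_pos_le_half_period (hL : ∀ k, 0 < L k) : ∃ r > 0, ∀ k, r ≤ L k / 2 := by
  rcases isEmpty_or_nonempty (Fin d) with h | h
  · exact ⟨1, one_pos, fun k => h.elim k⟩
  · obtain ⟨k, hk⟩ := Finite.exists_min L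
    exact ⟨L k / 2, half_pos (hL k), fun j => by linarith [hk j]⟩

open scoped Pointwise in
theorem mem_vadd_cellBox {x a : Vec d} :
    x ∈ (a - WithLp.toLp 2 fun k => L k / 2) +ᵥ cellBox L ↔
      ∀ k, -(L k / 2) ≤ x k - a k ∧ x k - a k < L k / 2 := by
  rw [Set.mem_vadd_set_iff_neg_vadd_mem]
  refine forall_congr' fun k => ?_
  simp only [vadd_eq_add, PiLp.add_apply, PiLp.neg_apply, PiLp.sub_apply]
  constructor
  · rintro ⟨h1, h2⟩
    constructor <;> linarith
  · rintro ⟨h1, h2⟩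
    constructor <;> linarith

theorem abs_apply_sub_le (x y : Vec d) (k : Fin d) : |x k - y k| ≤ dist x y := by
  rw [dist_eq_norm]
  simpa using PiLp.norm_apply_le (x - y) k

open scoped Pointwise in
/-- A periodic nonnegative function has a large integral over the period cell if it is bounded
below on a ball that embeds into the torus. -/
theorem mul_volume_ball_le_setIntegral (hL : ∀ k, 0 < L k) {f : Vec d → ℝ} (hf0 : ∀ x, 0 ≤ f x)
    (hfc : Continuous f) (hf : ∀ x z, Congr L z 0 → f (x + z) = f x) {x₀ : Vec d} {r c : ℝ}
    (hr : ∀ k, r ≤ L k / 2) (hc : ∀ x ∈ Metric.ball x₀ r, c ≤ f x) :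
    c * volume.real (Metric.ball x₀ r) ≤ ∫ x in box L, f x := by
  rw [← setIntegral_vadd_cellBox hL hf (x₀ - WithLp.toLp 2 fun k => L k / 2)]
  have hsub : Metric.ball x₀ r ⊆ (x₀ - WithLp.toLp 2 fun k => L k / 2) +ᵥ cellBox L := by
    intro x hx
    refine mem_vadd_cellBox.2 fun k => ?_
    have h1 := (abs_apply_sub_le x x₀ k).trans_lt (Metric.mem_ball.1 hx)
    have h2 := abs_lt.1 h1
    have h3 := hr k
    constructor <;> linarith [h2.1, h2.2]
  have hbd : Bornology.IsBounded ((x₀ - WithLp.toLp 2 fun k => L k / 2) +ᵥ cellBox L) :=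
    (isBounded_cellBox L).vadd _
  have hint : IntegrableOn f ((x₀ - WithLp.toLp 2 fun k => L k / 2) +ᵥ cellBox L) :=
    (hfc.continuousOn.integrableOn_compact hbd.isCompact_closure).mono_set subset_closure
  calc c * volume.real (Metric.ball x₀ r) = ∫ x in Metric.ball x₀ r, c := by
        rw [setIntegral_const, smul_eq_mul, mul_comm]
    _ ≤ ∫ x in Metric.ball x₀ r, f x := by
        refine setIntegral_mono_on (integrableOn_const measure_ball_lt_top.ne)
          (hint.mono_set hsub) measurableSet_ball hc
    _ ≤ _ := setIntegral_mono_set hint (ae_of_all _ hf0) hsub.eventuallyLE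

namespace PeriodicMesh

variable (M : PeriodicMesh L)

theorem lump_pos (hL : ∀ k, 0 < L k) (i : M.Node) : 0 < M.lump i := by
  have hc := M.continuous_phi hL i
  have hev : ∀ᶠ x in 𝓝 (i.1 : Vec d), 1 / 2 < M.phi i x :=
    hc.continuousAt.eventually (lt_mem_nhds (by rw [M.phi_self]; norm_num))
  obtain ⟨δ, hδ, hball⟩ := Metric.eventually_nhds_iff_ball.1 hev
  obtain ⟨r, hr, hrL⟩ := exists_pos_le_half_period hL
  have key := mul_volume_ball_le_setIntegral hL (M.phi_nonneg i) hc
    (fun x z hz => M.phi_add_period i x hz) (x₀ := i.1) (r := min δ r) (c := 1 / 2)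
    (fun k => (min_le_right _ _).trans (hrL k))
    (fun x hx => (hball x (Metric.ball_subset_ball (min_le_left _ _) hx)).le)
  refine lt_of_lt_of_le ?_ key
  have : 0 < volume.real (Metric.ball (i.1 : Vec d) (min δ r)) :=
    ENNReal.toReal_pos (Metric.measure_ball_pos _ _ (lt_min hδ hr)).ne' measure_ball_lt_top.ne
  positivity

/-- The mass matrix entries of overlapping basis functions are not small compared to `h ^ d`. -/
theorem le_mass_of_mem_nbr (hL : ∀ k, 0 < L k) {κ : ℝ} (hκ : 0 < κ) (hh : 0 < M.h)
    (hball : ∀ s ∈ M.complex.faces, s.card = d + 1 →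
      ∃ x, Metric.ball x (κ * M.h) ⊆ convexHull ℝ (s : Set (Vec d)))
    (hsmall : ∀ k, κ * M.h / 2 ≤ L k / 2) {i j : M.Node} (hij : j ∈ M.nbr i) :
    (κ / (4 + κ)) ^ 2 * ((κ / 2) ^ d * volume.real (Metric.ball (0 : Vec d) 1)) * M.h ^ d ≤
      M.mass i j := by
  obtain ⟨x₀, hx₀⟩ := M.exists_ball_le_phi hL hκ hh hball hij
  have hci := M.continuous_phi hL i
  have hcj := M.continuous_phi hL j
  have key := mul_volume_ball_le_setIntegral hL
    (f := fun x => M.phi i x * M.phi j x)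
    (fun x => mul_nonneg (M.phi_nonneg i x) (M.phi_nonneg j x))
    (hci.mul hcj) (fun x z hz => by rw [M.phi_add_period i x hz, M.phi_add_period j x hz])
    (c := (κ / (4 + κ)) ^ 2) hsmall (fun x hx => by
      obtain ⟨h1, h2⟩ := hx₀ x hx
      rw [sq]
      exact mul_le_mul h1 h2 (by positivity) (M.phi_nonneg i x))
  refine le_trans (le_of_eq ?_) key
  rw [Measure.real, Measure.real, Measure.addHaar_ball_of_pos _ x₀ (by positivity),
    ENNReal.toReal_mul,
    ENNReal.toReal_ofReal (by positivity), finrank_euclideanSpace_fin]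
  ring

open scoped Pointwise in
/-- The support of a basis function is contained in a single ball of radius `h` up to periodicity.
The volume is computed in the period cell centred at the node, where no other copy of the node is
close enough to matter. -/
theorem volume_support_phi_le (hL : ∀ k, 0 < L k) (hh : 0 < M.h) (hsmall : ∀ k, M.h < L k / 2)
    (i : M.Node) : volume.real {x ∈ box L | M.phi i x ≠ 0} ≤
      volume.real (Metric.ball (0 : Vec d) 1) * M.h ^ d := by
  classical
  have hc := M.continuous_phi hL i
  set S : Set (Vec d) := {x | M.phi i x ≠ 0} with hS
  have hSm : MeasurableSet S := (isOpen_ne_fun hc continuous_const).measurableSet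
  have e1 : {x ∈ box L | M.phi i x ≠ 0} = box L ∩ S := rfl
  set C := (i.1 - WithLp.toLp 2 fun k => L k / 2) +ᵥ cellBox L with hC
  have e2 : volume.real (box L ∩ S) = volume.real (C ∩ S) := by
    have h := setIntegral_vadd_cellBox hL (f := S.indicator 1)
      (fun x z hz => by simp [Set.indicator, hS, M.phi_add_period i x hz])
      (i.1 - WithLp.toLp 2 fun k => L k / 2)
    rw [setIntegral_indicator hSm, setIntegral_indicator hSm] at h
    simpa using h.symm
  have hsub : C ∩ S ⊆ Metric.closedBall i.1 M.h := by
    rintro x ⟨hx, hxS⟩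
    obtain ⟨y, hy, hxy⟩ := M.exists_near_of_phi_ne_zero hL hxS
    have hyi : y = i.1 := by
      ext k
      obtain ⟨m, hm⟩ := hy k
      have h1 := mem_vadd_cellBox.1 hx k
      have h2 := abs_le.1 ((abs_apply_sub_le x y k).trans hxy)
      have h3 := hsmall k
      have hLk := hL k
      have hm1 : m < 1 := by
        by_contra hc
        have : (1 : ℝ) ≤ m := by exact_mod_cast not_lt.1 hc
        nlinarith [h1.1, h1.2, h2.1, h2.2]
      have hm2 : -1 < m := by
        by_contra hc
        have : (m : ℝ) ≤ -1 := by exact_mod_cast not_lt.1 hc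
        nlinarith [h1.1, h1.2, h2.1, h2.2]
      have : m = 0 := by omega
      subst this
      simp at hm
      linarith
    rw [← hyi]
    exact hxy
  rw [e1, e2]
  refine (measureReal_mono hsub measure_closedBall_lt_top.ne).trans (le_of_eq ?_)
  rw [Measure.real, Measure.real, Measure.addHaar_closedBall _ _ hh.le, ENNReal.toReal_mul,
    ENNReal.toReal_ofReal (by positivity), finrank_euclideanSpace_fin]
  ring

/-- Quantitative shape regularity with constant `K`: an inverse estimate for the basis functions in
Lipschitz form, supports of size `h ^ d`, and mass matrix entries of size at least `h ^ d` for
overlapping basis functions. -/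
structure IsRegular (K : ℝ) : Prop where
  h_pos : 0 < M.h
  const_pos : 0 < K
  lip : ∀ i x y, |M.phi i x - M.phi i y| ≤ K / M.h * ‖x - y‖
  volume_le : ∀ i, volume.real {x ∈ box L | M.phi i x ≠ 0} ≤ K * M.h ^ d
  le_mass : ∀ i, ∀ j ∈ M.nbr i, M.h ^ d ≤ K * M.mass i j

end PeriodicMesh

/-- A shape regular family with mesh sizes tending to zero satisfies the quantitative bounds with
a common constant, except for finitely many coarse meshes. -/
theorem ShapeRegular.exists_isRegular (hd : 0 < d) (hL : ∀ k, 0 < L k) {M : ℕ → PeriodicMesh L}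
    (hreg : ShapeRegular M) (hM : Tendsto (fun n => (M n).h) atTop (𝓝 0)) :
    ∃ K, ∀ᶠ n in atTop, (M n).IsRegular K := by
  obtain ⟨κ, hκ, hball⟩ := hreg
  obtain ⟨r, hr, hrL⟩ := exists_pos_le_half_period hL
  set v := volume.real (Metric.ball (0 : Vec d) 1) with hv
  have hvpos : 0 < v :=
    ENNReal.toReal_pos (Metric.measure_ball_pos _ _ one_pos).ne' measure_ball_lt_top.ne
  set c := (κ / (4 + κ)) ^ 2 * ((κ / 2) ^ d * v) with hc
  have hcpos : 0 < c := by positivity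
  refine ⟨2 / κ + v + c⁻¹, ?_⟩
  have h1 : ∀ᶠ n in atTop, (M n).h < r := hM.eventually (gt_mem_nhds hr)
  have h2 : ∀ᶠ n in atTop, κ * (M n).h / 2 < r := by
    have : Tendsto (fun n => κ * (M n).h / 2) atTop (𝓝 (κ * 0 / 2)) := (hM.const_mul κ).div_const 2
    exact this.eventually (gt_mem_nhds (by simpa using hr))
  filter_upwards [h1, h2] with n hn1 hn2
  have hh := (M n).h_pos hd hL
  refine ⟨hh, by positivity, fun i x y => ?_, fun i => ?_, fun i j hij => ?_⟩
  · refine ((M n).phi_abs_sub_le hL (mul_pos hκ hh) (hball n) i x y).trans ?_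
    rw [← div_div]
    gcongr
    have := inv_pos.2 hcpos
    linarith
  · refine ((M n).volume_support_phi_le hL hh (fun k => hn1.trans_le (hrL k)) i).trans ?_
    gcongr
    have h3 : 0 < 2 / κ := by positivity
    have := inv_pos.2 hcpos
    linarith
  · have h3 := (M n).le_mass_of_mem_nbr hL hκ hh (hball n) (fun k => hn2.le.trans (hrL k)) hij
    have h4 : 0 ≤ (M n).mass i j := le_trans (by positivity) h3
    have h5 : (M n).h ^ d ≤ c⁻¹ * (M n).mass i j := by
      rw [inv_mul_eq_div, le_div_iff₀ hcpos, mul_comm]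
      exact h3
    refine h5.trans ?_
    gcongr
    have h6 : 0 < 2 / κ := by positivity
    linarith

end PeriodicFEM

namespace PeriodicFEM

variable {d : ℕ} {L : Fin d → ℝ}

theorem integrableOn_box_of_bound {V : Type*} [NormedAddCommGroup V] {f : Vec d → V}
    (hf : AEStronglyMeasurable f (volume.restrict (box L))) {C : ℝ} (hC : ∀ x ∈ box L, ‖f x‖ ≤ C) :
    IntegrableOn f (box L) := by
  have : IsFiniteMeasure (volume.restrict (box L)) :=
    ⟨by simpa using (volume_box_ne_top L).lt_top⟩
  exact Integrable.of_bound hf C ((ae_restrict_iff' (measurableSet_box L)).2 (ae_of_all _ hC))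

theorem integrableOn_box_of_continuous {V : Type*} [NormedAddCommGroup V] {f : Vec d → V}
    (hf : Continuous f) : IntegrableOn f (box L) :=
  (hf.continuousOn.integrableOn_compact (isBounded_box L).isCompact_closure).mono_set
    subset_closure

theorem measurable_gradient (f : Vec d → ℝ) : Measurable (gradient f) :=
  ((InnerProductSpace.toDual ℝ (Vec d)).symm.continuous.measurable).comp (measurable_fderiv ℝ f)

theorem norm_gradient_eq (f : Vec d → ℝ) (x : Vec d) : ‖gradient f x‖ = ‖fderiv ℝ f x‖ := by
  rw [gradient, LinearIsometryEquiv.norm_map]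

/-- The integral of a derivative of a periodic Lipschitz function over the period cell vanishes. -/
theorem setIntegral_lineDeriv_eq_zero (hL : ∀ k, 0 < L k) {f : Vec d → ℝ} {K : NNReal}
    (hf : LipschitzWith K f) (hper : ∀ x z, Congr L z 0 → f (x + z) = f x) (v : Vec d) :
    ∫ x in box L, lineDeriv ℝ f x v = 0 := by
  have hg : Integrable ((box L).indicator fun _ : Vec d => (1 : ℝ)) :=
    (integrable_indicator_iff (measurableSet_box L)).2 (integrableOn_const (volume_box_ne_top L))
  have key := hf.integral_inv_smul_sub_mul_tendsto_integral_lineDeriv_mul hg v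
  have e : ∀ F : Vec d → ℝ, ∫ x, F x * (box L).indicator (fun _ => (1 : ℝ)) x =
      ∫ x in box L, F x := by
    intro F
    rw [← integral_indicator (measurableSet_box L)]
    refine integral_congr_ae (ae_of_all _ fun x => ?_)
    by_cases hx : x ∈ box L <;> simp [hx]
  simp only [e] at key
  refine tendsto_nhds_unique key (tendsto_const_nhds.congr fun t => ?_)
  have hc := hf.continuous
  simp only [smul_eq_mul]
  rw [integral_const_mul, integral_sub (integrableOn_box_of_continuous (by fun_prop))
      (integrableOn_box_of_continuous hc),
    setIntegral_add_right hL hper, sub_self, mul_zero]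

namespace PeriodicMesh

variable (M : PeriodicMesh L)

/-! ### Matrix coefficients -/

variable {M}

theorem IsRegular.lipschitzWith {K : ℝ} (hK : M.IsRegular K) (i : M.Node) :
    LipschitzWith (K / M.h).toNNReal (M.phi i) := by
  refine LipschitzWith.of_dist_le_mul fun x y => ?_
  rw [Real.dist_eq, dist_eq_norm,
    Real.coe_toNNReal _ (div_nonneg hK.const_pos.le hK.h_pos.le)]
  exact hK.lip i x y

theorem IsRegular.norm_gradient_le {K : ℝ} (hK : M.IsRegular K) (i : M.Node) (x : Vec d) :
    ‖gradient (M.phi i) x‖ ≤ K / M.h := by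
  rw [norm_gradient_eq]
  refine (norm_fderiv_le_of_lipschitz ℝ (hK.lipschitzWith i)).trans (le_of_eq ?_)
  exact Real.coe_toNNReal _ (div_nonneg hK.const_pos.le hK.h_pos.le)

theorem gradient_phi_eq_zero {i : M.Node} {x : Vec d} (h : M.phi i x = 0) :
    gradient (M.phi i) x = 0 := by
  have hmin : IsLocalMin (M.phi i) x :=
    Eventually.of_forall fun y => by rw [h]; exact M.phi_nonneg i y
  rw [gradient, hmin.fderiv_eq_zero, map_zero]

variable (M)

theorem mass_nonneg (i j : M.Node) : 0 ≤ M.mass i j :=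
  integral_nonneg fun x => mul_nonneg (M.phi_nonneg i x) (M.phi_nonneg j x)

theorem mass_comm (i j : M.Node) : M.mass i j = M.mass j i := by
  simp only [mass, mul_comm]

theorem stiff_comm (i j : M.Node) : M.stiff i j = M.stiff j i := by
  simp only [stiff, real_inner_comm]

theorem phi_eq_zero_or_of_notMem_nbr {i j : M.Node} (h : j ∉ M.nbr i) (x : Vec d) :
    M.phi i x = 0 ∨ M.phi j x = 0 := by
  by_contra hc
  push Not at hc
  exact h (M.mem_nbr.2 ⟨x, hc⟩)

theorem mass_eq_zero {i j : M.Node} (h : j ∉ M.nbr i) : M.mass i j = 0 := by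
  refine integral_eq_zero_of_ae (ae_of_all _ fun x => ?_)
  rcases M.phi_eq_zero_or_of_notMem_nbr h x with h | h <;> simp [h]

theorem grad_eq_zero {i j : M.Node} (h : j ∉ M.nbr i) : M.grad i j = 0 := by
  refine integral_eq_zero_of_ae (ae_of_all _ fun x => ?_)
  rcases M.phi_eq_zero_or_of_notMem_nbr h x with h | h <;> simp [h, gradient_phi_eq_zero]

theorem stiff_eq_zero {i j : M.Node} (h : j ∉ M.nbr i) : M.stiff i j = 0 := by
  refine integral_eq_zero_of_ae (ae_of_all _ fun x => ?_)
  rcases M.phi_eq_zero_or_of_notMem_nbr h x with h | h <;> simp [h, gradient_phi_eq_zero]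

theorem sum_mass (hL : ∀ k, 0 < L k) (i : M.Node) : ∑ j, M.mass i j = M.lump i := by
  simp only [mass, lump]
  rw [← integral_finsetSum]
  · simp only [← Finset.mul_sum, M.sum_phi hL, mul_one]
  · intro j _
    exact integrableOn_box_of_continuous ((M.continuous_phi hL i).mul (M.continuous_phi hL j))

theorem sum_lump (hL : ∀ k, 0 < L k) : ∑ i, M.lump i = volume.real (box L) := by
  simp only [lump]
  rw [← integral_finsetSum]
  · simp [M.sum_phi hL]
  · intro j _
    exact integrableOn_box_of_continuous (M.continuous_phi hL j)

variable {M}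
variable {K : NNReal}

theorem norm_gradient_phi_le (hlip : ∀ i, LipschitzWith K (M.phi i)) (i : M.Node) (x : Vec d) :
    ‖gradient (M.phi i) x‖ ≤ K := by
  rw [norm_gradient_eq]
  exact norm_fderiv_le_of_lipschitz ℝ (hlip i)

theorem ae_differentiableAt_phi (hlip : ∀ i, LipschitzWith K (M.phi i)) :
    ∀ᵐ x : Vec d, ∀ i, DifferentiableAt ℝ (M.phi i) x := by
  rw [ae_all_iff]
  exact fun i => (hlip i).ae_differentiableAt

theorem ae_sum_gradient_phi (hL : ∀ k, 0 < L k) (hlip : ∀ i, LipschitzWith K (M.phi i)) :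
    ∀ᵐ x : Vec d, ∑ i, gradient (M.phi i) x = 0 := by
  filter_upwards [ae_differentiableAt_phi hlip] with x hx
  refine ext_inner_right ℝ fun v => ?_
  rw [sum_inner, inner_zero_left]
  simp only [inner_gradient_left]
  have h := fderiv_fun_sum (𝕜 := ℝ) (u := Finset.univ) (A := fun i => M.phi i) (fun i _ => hx i)
  have e : (fun y => ∑ i, M.phi i y) = fun _ => (1 : ℝ) := funext fun y => M.sum_phi hL y
  rw [e, fderiv_fun_const] at h
  have := congrArg (fun A : Vec d →L[ℝ] ℝ => A v) h
  simpa using this.symm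

theorem integrableOn_phi_smul_gradient (hL : ∀ k, 0 < L k)
    (hlip : ∀ i, LipschitzWith K (M.phi i)) (i j : M.Node) :
    IntegrableOn (fun x => M.phi i x • gradient (M.phi j) x) (box L) := by
  refine integrableOn_box_of_bound (C := K) ?_ fun x _ => ?_
  · exact ((M.continuous_phi hL i).measurable.smul (measurable_gradient _)).aestronglyMeasurable
  · rw [norm_smul, Real.norm_of_nonneg (M.phi_nonneg i x)]
    calc M.phi i x * ‖gradient (M.phi j) x‖ ≤ 1 * K :=
          mul_le_mul (M.phi_le_one hL i x) (norm_gradient_phi_le hlip j x) (norm_nonneg _) zero_le_one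
      _ = K := one_mul _

theorem integrableOn_inner_gradient (hlip : ∀ i, LipschitzWith K (M.phi i)) (i j : M.Node) :
    IntegrableOn (fun x => inner ℝ (gradient (M.phi i) x) (gradient (M.phi j) x)) (box L) := by
  refine integrableOn_box_of_bound (C := K * K) ?_ fun x _ => ?_
  · exact ((measurable_gradient _).inner (measurable_gradient _)).aestronglyMeasurable
  · exact (norm_inner_le_norm _ _).trans
      (mul_le_mul (norm_gradient_phi_le hlip i x) (norm_gradient_phi_le hlip j x) (norm_nonneg _)
        K.coe_nonneg)

theorem inner_grad (hL : ∀ k, 0 < L k) (hlip : ∀ i, LipschitzWith K (M.phi i)) (i j : M.Node)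
    (a : Vec d) :
    inner ℝ (M.grad i j) a = ∫ x in box L, M.phi i x * inner ℝ (gradient (M.phi j) x) a := by
  rw [real_inner_comm, grad, ← integral_inner (integrableOn_phi_smul_gradient hL hlip i j)]
  refine integral_congr_ae (ae_of_all _ fun x => ?_)
  simp only [inner_smul_right, real_inner_comm]

theorem integrableOn_phi_mul_inner_gradient (hL : ∀ k, 0 < L k)
    (hlip : ∀ i, LipschitzWith K (M.phi i)) (i j : M.Node) (a : Vec d) :
    IntegrableOn (fun x => M.phi i x * inner ℝ (gradient (M.phi j) x) a) (box L) := by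
  have h := (integrableOn_phi_smul_gradient hL hlip i j).inner_const (𝕜 := ℝ) a
  simp only [real_inner_smul_left] at h
  exact h

/-- Integration by parts for periodic functions: the discrete gradient is antisymmetric. -/
theorem grad_antisymm (hL : ∀ k, 0 < L k) (hlip : ∀ i, LipschitzWith K (M.phi i)) (i j : M.Node) :
    M.grad i j = -M.grad j i := by
  refine eq_neg_of_add_eq_zero_left (ext_inner_right ℝ fun a => ?_)
  rw [inner_add_left, inner_grad hL hlip, inner_grad hL hlip, inner_zero_left,
    ← integral_add (integrableOn_phi_mul_inner_gradient hL hlip i j a)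
      (integrableOn_phi_mul_inner_gradient hL hlip j i a)]
  have hprod : LipschitzWith (1 * K + 1 * K) fun x => M.phi i x * M.phi j x := by
    refine LipschitzWith.of_dist_le_mul fun x y => ?_
    have h1 := (hlip i).dist_le_mul x y
    have h2 := (hlip j).dist_le_mul x y
    rw [Real.dist_eq] at h1 h2 ⊢
    have e : M.phi i x * M.phi j x - M.phi i y * M.phi j y =
      (M.phi i x - M.phi i y) * M.phi j x + M.phi i y * (M.phi j x - M.phi j y) := by ring
    rw [e]
    refine (abs_add_le _ _).trans ?_
    rw [abs_mul, abs_mul, abs_of_nonneg (M.phi_nonneg j x), abs_of_nonneg (M.phi_nonneg i y)]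
    have h3 := M.phi_le_one hL j x
    have h4 := M.phi_le_one hL i y
    push_cast
    nlinarith [M.phi_nonneg j x, M.phi_nonneg i y, abs_nonneg (M.phi i x - M.phi i y),
      abs_nonneg (M.phi j x - M.phi j y)]
  rw [← setIntegral_lineDeriv_eq_zero hL hprod
    (fun x z hz => by rw [M.phi_add_period i x hz, M.phi_add_period j x hz]) a]
  refine integral_congr_ae (ae_restrict_of_ae ?_)
  filter_upwards [ae_differentiableAt_phi hlip] with x hx
  rw [((hx i).fun_mul (hx j)).lineDeriv_eq_fderiv, fderiv_fun_mul (hx i) (hx j)]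
  simp [inner_gradient_left]

theorem sum_grad (hL : ∀ k, 0 < L k) (hlip : ∀ i, LipschitzWith K (M.phi i)) (i : M.Node) :
    ∑ j, M.grad i j = 0 := by
  simp only [grad]
  rw [← integral_finsetSum _ fun j _ => integrableOn_phi_smul_gradient hL hlip i j]
  refine integral_eq_zero_of_ae (ae_restrict_of_ae ?_)
  filter_upwards [ae_sum_gradient_phi hL hlip] with x hx
  simp [← Finset.smul_sum, hx]

theorem sum_stiff (hL : ∀ k, 0 < L k) (hlip : ∀ i, LipschitzWith K (M.phi i)) (i : M.Node) :
    ∑ j, M.stiff i j = 0 := by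
  simp only [stiff]
  rw [← integral_finsetSum _ fun j _ => integrableOn_inner_gradient hlip i j]
  refine integral_eq_zero_of_ae (ae_restrict_of_ae ?_)
  filter_upwards [ae_sum_gradient_phi hL hlip] with x hx
  simp only [← inner_sum, hx, inner_zero_right, Pi.zero_apply]

/-- The stiffness form `∑ s_ij u_i ⬝ v_j`, which equals `∫ ∇u_h : ∇v_h`. -/
def stiffForm (M : PeriodicMesh L) (u v : M.Node → Vec d) : ℝ :=
  ∑ i, ∑ j, M.stiff i j * inner ℝ (u i) (v j)

theorem stiffForm_comm (u v : M.Node → Vec d) : M.stiffForm u v = M.stiffForm v u := by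
  rw [stiffForm, Finset.sum_comm]
  refine Finset.sum_congr rfl fun j _ => Finset.sum_congr rfl fun i _ => ?_
  rw [M.stiff_comm, real_inner_comm]

/-- The stiffness form is positive semidefinite, as the Dirichlet energy of the components. -/
theorem stiffForm_self_nonneg (hlip : ∀ i, LipschitzWith K (M.phi i)) (u : M.Node → Vec d) :
    0 ≤ M.stiffForm u u := by
  have key : ∀ k, 0 ≤ ∑ i, ∑ j, M.stiff i j * (u i k * u j k) := by
    intro k
    have e : ∑ i, ∑ j, M.stiff i j * (u i k * u j k) =
        ∫ x in box L, ‖∑ i, u i k • gradient (M.phi i) x‖ ^ 2 := by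
      simp only [stiff, ← integral_mul_const]
      simp_rw [← integral_finsetSum _ fun j _ =>
        (integrableOn_inner_gradient hlip _ j).mul_const _]
      rw [← integral_finsetSum]
      · refine integral_congr_ae (ae_of_all _ fun x => ?_)
        simp only [← real_inner_self_eq_norm_sq, sum_inner]
        refine Finset.sum_congr rfl fun i _ => ?_
        rw [inner_sum]
        refine Finset.sum_congr rfl fun j _ => ?_
        rw [real_inner_smul_left, real_inner_smul_right]
        ring
      · exact fun i _ => integrable_finsetSum _ fun j _ =>
          (integrableOn_inner_gradient hlip i j).mul_const _
    rw [e]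
    exact integral_nonneg fun x => by positivity
  have e : M.stiffForm u u = ∑ k, ∑ i, ∑ j, M.stiff i j * (u i k * u j k) := by
    rw [stiffForm]
    rw [Finset.sum_comm (s := (Finset.univ : Finset (Fin d)))]
    refine Finset.sum_congr rfl fun i _ => ?_
    rw [Finset.sum_comm]
    refine Finset.sum_congr rfl fun j _ => ?_
    rw [← Finset.mul_sum]
    congr 1
    simp [PiLp.inner_apply, mul_comm]
  rw [e]
  exact Finset.sum_nonneg fun k _ => key k

end PeriodicMesh
end PeriodicFEM

namespace PeriodicFEM

/-! ### Summation by parts -/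

theorem sum_antisymm_left {ι E : Type*} [Fintype ι] [AddCommGroup E] {c : ι → ι → E}
    (hanti : ∀ i j, c i j = -c j i) (hrow : ∀ i, ∑ j, c i j = 0) (j : ι) :
    ∑ i, c i j = 0 := by
  rw [← neg_eq_zero, ← Finset.sum_neg_distrib, ← hrow j]
  exact Finset.sum_congr rfl fun i _ => (hanti j i).symm

section SummationByParts

variable {ι E : Type*} [Fintype ι] [NormedAddCommGroup E] [InnerProductSpace ℝ E]

/-- Summation by parts for a symmetric matrix with zero row sums. -/
theorem sum_mul_inner_eq_neg_half {A : ι → ι → ℝ} (hsymm : ∀ i j, A i j = A j i)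
    (hrow : ∀ i, ∑ j, A i j = 0) (f g : ι → E) :
    ∑ i, ∑ j, A i j * inner ℝ (f i) (g j) =
      -(1 / 2) * ∑ i, ∑ j, A i j * inner ℝ (f j - f i) (g j - g i) := by
  have e1 : ∑ i, ∑ j, A i j * inner ℝ (f i) (g i) = 0 :=
    Finset.sum_eq_zero fun i _ => by rw [← Finset.sum_mul, hrow, zero_mul]
  have e2 : ∑ i, ∑ j, A i j * inner ℝ (f j) (g j) = 0 := by
    rw [Finset.sum_comm, ← e1]
    exact Finset.sum_congr rfl fun i _ => Finset.sum_congr rfl fun j _ => by rw [hsymm]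
  have e3 : ∑ i, ∑ j, A i j * inner ℝ (f j) (g i) = ∑ i, ∑ j, A i j * inner ℝ (f i) (g j) := by
    rw [Finset.sum_comm]
    exact Finset.sum_congr rfl fun i _ => Finset.sum_congr rfl fun j _ => by rw [hsymm]
  have e4 : ∑ i, ∑ j, A i j * inner ℝ (f j - f i) (g j - g i) =
      ∑ i, ∑ j, A i j * inner ℝ (f j) (g j) + ∑ i, ∑ j, A i j * inner ℝ (f i) (g i) -
      ∑ i, ∑ j, A i j * inner ℝ (f i) (g j) - ∑ i, ∑ j, A i j * inner ℝ (f j) (g i) := by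
    simp only [← Finset.sum_add_distrib, ← Finset.sum_sub_distrib]
    refine Finset.sum_congr rfl fun i _ => Finset.sum_congr rfl fun j _ => ?_
    simp only [inner_sub_left, inner_sub_right]
    ring
  rw [e4, e1, e2, e3]
  ring

variable {c : ι → ι → E}

/-- A double sum vanishes if its symmetrization does. -/
theorem sum_eq_zero_of_swap {F : ι → ι → ℝ} (hF : ∑ i, ∑ j, (F i j + F j i) = 0) :
    ∑ i, ∑ j, F i j = 0 := by
  simp only [Finset.sum_add_distrib] at hF
  rw [Finset.sum_comm (f := fun i j => F j i)] at hF
  linarith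

/-- The convective form conserves energy. -/
theorem sum_conv_self (hanti : ∀ i j, c i j = -c j i) (u : ι → E) :
    ∑ i, ∑ j, inner ℝ ((1 / 2 : ℝ) • (u j + u i)) (c i j) * inner ℝ (u j) (u i) = 0 := by
  refine sum_eq_zero_of_swap (Finset.sum_eq_zero fun i _ => Finset.sum_eq_zero fun j _ => ?_)
  rw [hanti j i, inner_neg_right, real_inner_comm (u i) (u j), add_comm (u i) (u j)]
  ring

/-- The skew-symmetric convective form differs from the weak convective form by a term containing
the discrete divergence and by a remainder that is of third order in the jumps. This is an exact
algebraic identity for an antisymmetric discrete gradient with zero row sums. -/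
theorem sum_conv_add_eq (hanti : ∀ i j, c i j = -c j i) (hrow : ∀ i, ∑ j, c i j = 0)
    (u v : ι → E) :
    ∑ i, ∑ j, inner ℝ ((1 / 2 : ℝ) • (u j + u i)) (c i j) * inner ℝ (u j) (v i) +
      ∑ i, ∑ j, inner ℝ (c i j) (u i) * inner ℝ (u i) (v j) +
      1 / 2 * ∑ i, ∑ j, inner ℝ (c i j) (u j) * inner ℝ (u i) (v i) =
    1 / 4 * ∑ i, ∑ j, inner ℝ (c i j) (u j - u i) * inner ℝ (u j - u i) (v j - v i) := by
  have hw1 : ∀ w : ι → E, ∑ i, ∑ j, inner ℝ (c i j) (w i) = 0 := fun w =>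
    Finset.sum_eq_zero fun i _ => by rw [← sum_inner, hrow, inner_zero_left]
  have hw2 : ∀ w : ι → E, ∑ i, ∑ j, inner ℝ (c i j) (w j) = 0 := fun w => by
    rw [Finset.sum_comm]
    exact Finset.sum_eq_zero fun j _ => by
      rw [← sum_inner, sum_antisymm_left hanti hrow, inner_zero_left]
  rw [← sub_eq_zero, Finset.mul_sum, Finset.mul_sum]
  simp only [Finset.mul_sum, ← Finset.sum_add_distrib, ← Finset.sum_sub_distrib]
  refine sum_eq_zero_of_swap ?_
  have h1 := hw1 fun i => inner ℝ (u i) (v i) • u i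
  have h2 := hw2 fun i => inner ℝ (u i) (v i) • u i
  have h3 : ∑ i, ∑ j, (1 / 2 * inner ℝ (c i j) (inner ℝ (u i) (v i) • u i) -
      1 / 2 * inner ℝ (c i j) (inner ℝ (u j) (v j) • u j)) = 0 := by
    simp only [Finset.sum_sub_distrib, ← Finset.mul_sum, h1, h2]
    ring
  rw [← h3]
  refine Finset.sum_congr rfl fun i _ => Finset.sum_congr rfl fun j _ => ?_
  rw [hanti j i]
  simp only [inner_neg_left, inner_neg_right, inner_smul_right, inner_sub_left,
    inner_sub_right, inner_add_right, real_inner_comm (c i j)]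
  ring

end SummationByParts

namespace PeriodicMesh

variable {d : ℕ} {L : Fin d → ℝ} (M : PeriodicMesh L)

/-! ### Sizes of the coefficients on regular meshes -/

/-- The sum of the jumps of nodal values over all pairs of distinct neighbours. -/
def jump {V : Type*} [NormedAddCommGroup V] (u : M.Node → V) : ℝ :=
  ∑ i, ∑ j ∈ (M.nbr i).erase i, ‖u j - u i‖

/-- The sum of the squared jumps of nodal values over all pairs of distinct neighbours. -/
def jumpSq {V : Type*} [NormedAddCommGroup V] (u : M.Node → V) : ℝ :=
  ∑ i, ∑ j ∈ (M.nbr i).erase i, ‖u j - u i‖ ^ 2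

/-- The number of ordered pairs of distinct neighbours. -/
def numPairs : ℝ := ∑ i, (((M.nbr i).erase i).card : ℝ)

theorem jump_nonneg {V : Type*} [NormedAddCommGroup V] (u : M.Node → V) : 0 ≤ M.jump u :=
  Finset.sum_nonneg fun _ _ => Finset.sum_nonneg fun _ _ => norm_nonneg _

theorem jumpSq_nonneg {V : Type*} [NormedAddCommGroup V] (u : M.Node → V) : 0 ≤ M.jumpSq u :=
  Finset.sum_nonneg fun _ _ => Finset.sum_nonneg fun _ _ => by positivity

/-- A sum over all pairs of nodes reduces to the pairs of distinct neighbours if the remaining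
terms vanish. -/
theorem sum_univ_eq_sum_erase {F : M.Node → M.Node → ℝ} (h1 : ∀ i, F i i = 0)
    (h2 : ∀ i, ∀ j ∉ M.nbr i, F i j = 0) :
    ∑ i, ∑ j, F i j = ∑ i, ∑ j ∈ (M.nbr i).erase i, F i j := by
  refine Finset.sum_congr rfl fun i _ => (Finset.sum_subset (Finset.subset_univ _) ?_).symm
  intro j _ hj
  by_cases hji : j = i
  · rw [hji, h1]
  · exact h2 i j fun hc => hj (Finset.mem_erase.2 ⟨hji, hc⟩)

theorem abs_sum_erase_le {F G : M.Node → M.Node → ℝ}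
    (h : ∀ i, ∀ j ∈ (M.nbr i).erase i, |F i j| ≤ G i j) :
    |∑ i, ∑ j ∈ (M.nbr i).erase i, F i j| ≤ ∑ i, ∑ j ∈ (M.nbr i).erase i, G i j :=
  (Finset.abs_sum_le_sum_abs _ _).trans <| Finset.sum_le_sum fun i _ =>
    (Finset.abs_sum_le_sum_abs _ _).trans <| Finset.sum_le_sum fun j hj => h i j hj

theorem sum_erase_const (b : ℝ) : ∑ i, ∑ _j ∈ (M.nbr i).erase i, b = b * M.numPairs := by
  rw [numPairs, Finset.mul_sum]
  exact Finset.sum_congr rfl fun i _ => by rw [Finset.sum_const, nsmul_eq_mul, mul_comm]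

theorem sum_erase_mul_norm {V : Type*} [NormedAddCommGroup V] (b : ℝ) (u : M.Node → V) :
    ∑ i, ∑ j ∈ (M.nbr i).erase i, b * ‖u j - u i‖ = b * M.jump u := by
  simp only [jump, Finset.mul_sum]

/-- Young's inequality: jumps are controlled by squared jumps and the number of pairs. -/
theorem two_mul_jump_le {V : Type*} [NormedAddCommGroup V] (u : M.Node → V) {ε : ℝ} (hε : 0 < ε) :
    2 * M.jump u ≤ ε * M.numPairs + M.jumpSq u / ε := by
  rw [← M.sum_erase_const, jump, jumpSq, Finset.sum_div, Finset.mul_sum, ← Finset.sum_add_distrib]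
  refine Finset.sum_le_sum fun i _ => ?_
  rw [Finset.sum_div, Finset.mul_sum, ← Finset.sum_add_distrib]
  refine Finset.sum_le_sum fun j _ => ?_
  have h := sq_nonneg (ε - ‖u j - u i‖)
  have e : ε + ‖u j - u i‖ ^ 2 / ε - 2 * ‖u j - u i‖ = (ε - ‖u j - u i‖) ^ 2 / ε := by
    field_simp
    ring
  have := div_nonneg h hε.le
  linarith

variable {M} {K : ℝ}

theorem IsRegular.norm_setIntegral_le (hK : M.IsRegular K) {V : Type*} [NormedAddCommGroup V]
    [NormedSpace ℝ V]
    (i : M.Node) {f : Vec d → V} {B : ℝ} (hB : ∀ x ∈ box L, ‖f x‖ ≤ B)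
    (hf : ∀ x ∈ box L, M.phi i x = 0 → f x = 0) (hB0 : 0 ≤ B) :
    ‖∫ x in box L, f x‖ ≤ B * (K * M.h ^ d) := by
  rw [setIntegral_eq_of_subset_of_forall_sdiff_eq_zero (s := {x ∈ box L | M.phi i x ≠ 0})
    (measurableSet_box L) (fun x hx => hx.1) (fun x hx => hf x hx.1 (by
      by_contra hc
      exact hx.2 ⟨hx.1, hc⟩))]
  refine (norm_setIntegral_le_of_norm_le_const (C := B) ?_ fun x hx => hB x hx.1).trans ?_
  · exact (measure_mono fun x hx => hx.1).trans_lt (volume_box_ne_top L).lt_top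
  · exact mul_le_mul_of_nonneg_left (hK.volume_le i) hB0

theorem IsRegular.lump_le (hK : M.IsRegular K) (hL : ∀ k, 0 < L k) (i : M.Node) :
    M.lump i ≤ K * M.h ^ d := by
  have h := hK.norm_setIntegral_le i (f := M.phi i) (B := 1)
    (fun x _ => by rw [Real.norm_of_nonneg (M.phi_nonneg i x)]; exact M.phi_le_one hL i x)
    (fun x _ h => h) zero_le_one
  rw [one_mul] at h
  exact (le_abs_self _).trans h

theorem mass_le_lump (hL : ∀ k, 0 < L k) (i j : M.Node) : M.mass i j ≤ M.lump i := by
  rw [← M.sum_mass hL i]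
  exact Finset.single_le_sum (fun j _ => M.mass_nonneg i j) (Finset.mem_univ j)

theorem IsRegular.mass_le (hK : M.IsRegular K) (hL : ∀ k, 0 < L k) (i j : M.Node) :
    M.mass i j ≤ K * M.h ^ d :=
  (mass_le_lump hL i j).trans (hK.lump_le hL i)

theorem IsRegular.le_lump (hK : M.IsRegular K) (hL : ∀ k, 0 < L k) (i : M.Node) :
    M.h ^ d ≤ K * M.lump i :=
  (hK.le_mass i i (M.self_mem_nbr i)).trans
    (mul_le_mul_of_nonneg_left (mass_le_lump hL i i) hK.const_pos.le)

theorem IsRegular.norm_grad_le (hK : M.IsRegular K) (hL : ∀ k, 0 < L k) (i j : M.Node) :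
    ‖M.grad i j‖ ≤ K / M.h * (K * M.h ^ d) := by
  have hpos := div_pos hK.const_pos hK.h_pos
  refine hK.norm_setIntegral_le i (fun x _ => ?_) (fun x _ h => by simp [h]) hpos.le
  rw [norm_smul, Real.norm_of_nonneg (M.phi_nonneg i x)]
  calc M.phi i x * ‖gradient (M.phi j) x‖ ≤ 1 * (K / M.h) :=
        mul_le_mul (M.phi_le_one hL i x) (hK.norm_gradient_le j x) (norm_nonneg _) zero_le_one
    _ = K / M.h := one_mul _

theorem IsRegular.abs_stiff_le (hK : M.IsRegular K) (i j : M.Node) :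
    |M.stiff i j| ≤ (K / M.h) ^ 2 * (K * M.h ^ d) := by
  rw [← Real.norm_eq_abs, stiff]
  refine hK.norm_setIntegral_le i (fun x _ => ?_)
    (fun x _ h => by rw [gradient_phi_eq_zero h, inner_zero_left]) (sq_nonneg _)
  rw [sq]
  exact (norm_inner_le_norm _ _).trans (mul_le_mul (hK.norm_gradient_le i x)
    (hK.norm_gradient_le j x) (norm_nonneg _) (div_pos hK.const_pos hK.h_pos).le)

theorem IsRegular.card_nbr_le (hK : M.IsRegular K) (hL : ∀ k, 0 < L k) (i : M.Node) :
    ((M.nbr i).card : ℝ) ≤ K ^ 2 := by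
  have hpos : 0 < M.h ^ d := pow_pos hK.h_pos d
  have h1 : ((M.nbr i).card : ℝ) * M.h ^ d ≤ K * M.lump i := by
    rw [← nsmul_eq_mul, ← Finset.sum_const, ← M.sum_mass hL i, Finset.mul_sum]
    refine (Finset.sum_le_sum fun j hj => hK.le_mass i j hj).trans
      (Finset.sum_le_sum_of_subset_of_nonneg (Finset.subset_univ _) fun j _ _ =>
        mul_nonneg hK.const_pos.le (M.mass_nonneg i j))
  have h2 := mul_le_mul_of_nonneg_left (hK.lump_le hL i) hK.const_pos.le
  have h3 : ((M.nbr i).card : ℝ) * M.h ^ d ≤ K ^ 2 * M.h ^ d := by nlinarith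
  exact le_of_mul_le_mul_right h3 hpos

theorem IsRegular.numPairs_mul_le (hK : M.IsRegular K) (hL : ∀ k, 0 < L k) :
    M.numPairs * M.h ^ d ≤ K * volume.real (box L) := by
  rw [mul_comm, ← M.sum_erase_const, ← M.sum_lump hL, Finset.mul_sum]
  refine Finset.sum_le_sum fun i _ => ?_
  rw [← M.sum_mass hL i, Finset.mul_sum]
  exact (Finset.sum_le_sum fun j hj => hK.le_mass i j (Finset.mem_of_mem_erase hj)).trans
    (Finset.sum_le_sum_of_subset_of_nonneg (Finset.subset_univ _) fun j _ _ =>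
      mul_nonneg hK.const_pos.le (M.mass_nonneg i j))

theorem IsRegular.card_node_mul_le (hK : M.IsRegular K) (hL : ∀ k, 0 < L k) :
    (Fintype.card M.Node : ℝ) * M.h ^ d ≤ K * volume.real (box L) := by
  rw [← M.sum_lump hL, Finset.mul_sum]
  have : (Fintype.card M.Node : ℝ) * M.h ^ d = ∑ _i : M.Node, M.h ^ d := by simp
  rw [this]
  exact Finset.sum_le_sum fun i _ => hK.le_lump hL i

/-! ### The pressure stabilization -/

variable (M)

theorem presStab_eq_zero (ω : ℝ) {i j : M.Node} (h : j ∉ M.nbr i) : M.presStab ω i j = 0 := by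
  have hji : j ≠ i := fun hc => h (hc ▸ M.self_mem_nbr i)
  rw [presStab, if_neg hji, M.mass_eq_zero h, mul_zero]

theorem presStab_symm (ω : ℝ) (i j : M.Node) : M.presStab ω i j = M.presStab ω j i := by
  by_cases h : j = i
  · rw [h]
  · rw [presStab, presStab, if_neg h, if_neg (Ne.symm h), M.mass_comm]

theorem sum_presStab (ω : ℝ) (i : M.Node) : ∑ j, M.presStab ω i j = 0 := by
  have h : ∑ j, M.presStab ω i j = ∑ j ∈ M.nbr i, M.presStab ω i j :=
    (Finset.sum_subset (Finset.subset_univ _) fun j _ hj => M.presStab_eq_zero ω hj).symm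
  rw [h, ← Finset.add_sum_erase _ _ (M.self_mem_nbr i), presStab, if_pos rfl,
    neg_add_eq_zero]
  exact Finset.sum_congr rfl fun j hj => by rw [presStab, if_neg (Finset.ne_of_mem_erase hj)]

/-- The quadratic form of the pressure stabilization in terms of the jumps. -/
theorem sum_presStab_mul (ω : ℝ) (p g : M.Node → ℝ) :
    ∑ i, ∑ j, M.presStab ω i j * (g i * p j) =
      -(1 / 2) * ∑ i, ∑ j ∈ (M.nbr i).erase i, ω * M.mass i j * ((g j - g i) * (p j - p i)) := by
  have h := sum_mul_inner_eq_neg_half (M.presStab_symm ω) (M.sum_presStab ω) g p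
  simp only [show ∀ a b : ℝ, inner ℝ a b = a * b from fun a b => by simp [mul_comm]] at h
  rw [h, M.sum_univ_eq_sum_erase (fun i => by simp)
    (fun i j hj => by rw [M.presStab_eq_zero ω hj, zero_mul])]
  congr 1
  refine Finset.sum_congr rfl fun i _ => Finset.sum_congr rfl fun j hj => ?_
  rw [presStab, if_neg (Finset.ne_of_mem_erase hj)]

end PeriodicMesh
end PeriodicFEM

namespace PeriodicFEM

/-! ### Quadratic forms of singular systems -/

/-- Every linear endomorphism `P` of a vector space has a generalized inverse. -/
theorem exists_generalizedInverse {k V : Type*} [Field k] [AddCommGroup V] [Module k V]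
    (P : V →ₗ[k] V) : ∃ g : V →ₗ[k] V, ∀ x, P (g (P x)) = P x := by
  obtain ⟨r, hr⟩ := P.rangeRestrict.exists_rightInverse_of_surjective P.range_rangeRestrict
  obtain ⟨g, hg⟩ := LinearMap.exists_extend r
  refine ⟨g, fun x => ?_⟩
  have h1 : g (P x) = r (P.rangeRestrict x) := LinearMap.congr_fun hg (P.rangeRestrict x)
  have h2 := LinearMap.congr_fun hr (P.rangeRestrict x)
  rw [h1]
  exact congrArg Subtype.val h2

/-- If `b` takes values in the range of a symmetric matrix `P`, the quadratic form of any solution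
of `P p = b` is differentiable, although `p` itself need not be. The quadratic form is written with
a generalized inverse `g` of `P`. -/
theorem hasDerivAt_quadratic {ι : Type*} [Fintype ι] {P g : (ι → ℝ) →ₗ[ℝ] (ι → ℝ)}
    (hg : ∀ x, P (g (P x)) = P x) (hP : ∀ x y, P x ⬝ᵥ y = x ⬝ᵥ P y) {b : ℝ → ι → ℝ} {b' p : ι → ℝ}
    {t : ℝ} (hb : HasDerivAt b b' t) (hrange : ∀ᶠ s in 𝓝 t, ∃ q, P q = b s) (hp : P p = b t) :
    HasDerivAt (fun s => g (b s) ⬝ᵥ b s) (2 * (p ⬝ᵥ b')) t := by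
  have hgb : ∀ A : (ι → ℝ) →ₗ[ℝ] (ι → ℝ), HasDerivAt (fun s => A (b s)) (A b') t := fun A =>
    (LinearMap.toContinuousLinearMap A).hasFDerivAt.comp_hasDerivAt t hb
  have hb' : P (g b') = b' := by
    refine (hgb (P ∘ₗ g)).unique (hb.congr_of_eventuallyEq ?_)
    filter_upwards [hrange] with s ⟨q, hq⟩
    rw [← hq]
    exact hg q
  have e1 : g b' ⬝ᵥ b t = p ⬝ᵥ b' := by
    rw [← hp, ← hP, hb', dotProduct_comm]
  have e2 : g (b t) ⬝ᵥ b' = p ⬝ᵥ b' := by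
    have h : P (g (b t)) = b t := by rw [← hp]; exact hg p
    rw [← hb', ← hP, h, ← hp, hP]
  have h1 : ∀ k, HasDerivAt (fun s => g (b s) k * b s k) (g b' k * b t k + g (b t) k * b' k) t :=
    fun k => ((hasDerivAt_pi.1 (hgb g)) k).mul ((hasDerivAt_pi.1 hb) k)
  have h2 := HasDerivAt.fun_sum (u := Finset.univ) fun k _ => h1 k
  refine h2.congr_deriv ?_
  rw [Finset.sum_add_distrib, two_mul]
  exact congrArg₂ (· + ·) e1 e2

namespace PeriodicMesh

variable {d : ℕ} {L : Fin d → ℝ} (M : PeriodicMesh L)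

/-! ### Testing the scheme -/

/-- The discrete divergence of nodal values. -/
def discDiv (u : M.Node → Vec d) (k : M.Node) : ℝ := ∑ j, inner ℝ (M.grad k j) (u j)

/-- The pressure stabilization as a linear map. -/
def presStabLin (ω : ℝ) : (M.Node → ℝ) →ₗ[ℝ] (M.Node → ℝ) :=
  Matrix.mulVecLin (Matrix.of (M.presStab ω))

theorem presStabLin_apply (ω : ℝ) (p : M.Node → ℝ) (k : M.Node) :
    M.presStabLin ω p k = ∑ j, M.presStab ω k j * p j := rfl

theorem presStabLin_dotProduct (ω : ℝ) (x y : M.Node → ℝ) :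
    M.presStabLin ω x ⬝ᵥ y = x ⬝ᵥ M.presStabLin ω y := by
  simp only [dotProduct, presStabLin_apply, Finset.sum_mul, Finset.mul_sum]
  rw [Finset.sum_comm]
  refine Finset.sum_congr rfl fun i _ => Finset.sum_congr rfl fun j _ => ?_
  rw [M.presStab_symm ω j i]
  ring

theorem dotProduct_presStabLin (ω : ℝ) (p g : M.Node → ℝ) :
    g ⬝ᵥ M.presStabLin ω p = -(1 / 2) *
      ∑ i, ∑ j ∈ (M.nbr i).erase i, ω * M.mass i j * ((g j - g i) * (p j - p i)) := by
  rw [← M.sum_presStab_mul]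
  simp only [dotProduct, presStabLin_apply, Finset.mul_sum]
  refine Finset.sum_congr rfl fun i _ => Finset.sum_congr rfl fun j _ => ?_
  ring

/-- A solution of the scheme with velocities and pressures bounded by `C` and artificial viscosity
coefficients bounded by `C h ^ (d - 1)`. -/
structure IsBoundedSolution (ν ω T C : ℝ) (D : ℝ → M.Node → M.Node → ℝ)
    (u : ℝ → M.Node → Vec d) (p : ℝ → M.Node → ℝ) : Prop extends M.IsSolution ν ω T D u p where
  visc_nonneg : 0 ≤ ν
  laplacian : ∀ t ∈ Ioo 0 T, M.IsGraphLaplacian (D t)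
  norm_le : ∀ t ∈ Ioo 0 T, ∀ i, ‖u t i‖ ≤ C
  abs_le : ∀ t ∈ Ioo 0 T, ∀ i, |p t i| ≤ C
  laplacian_le : ∀ t ∈ Ioo 0 T, ∀ i j, j ≠ i → D t i j ≤ C * M.h ^ (d - 1)
  const_nonneg : 0 ≤ C

variable {M}
variable {ν ω T C : ℝ} {D : ℝ → M.Node → M.Node → ℝ} {u : ℝ → M.Node → Vec d}
  {p : ℝ → M.Node → ℝ}

namespace IsBoundedSolution

theorem presStabLin_eq (hs : M.IsBoundedSolution ν ω T C D u p) {t : ℝ} (ht : t ∈ Ioo 0 T) :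
    M.presStabLin ω (p t) = M.discDiv (u t) := by
  ext k
  have h := hs.continuity k t ht
  rw [Finset.sum_sub_distrib, sub_eq_zero] at h
  rw [presStabLin_apply, discDiv,
    ← Finset.sum_subset (Finset.subset_univ (M.nbr k)) fun j _ hj => by
      rw [M.presStab_eq_zero ω hj, zero_mul],
    h, Finset.sum_subset (Finset.subset_univ (M.nbr k)) fun j _ hj => by
      rw [M.grad_eq_zero hj, inner_zero_left]]

theorem lump_smul_deriv (hs : M.IsBoundedSolution ν ω T C D u p) {t : ℝ} (ht : t ∈ Ioo 0 T)
    (i : M.Node) : M.lump i • deriv (fun s => u s i) t =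
      ∑ j, ((D t i j - M.conv (u t) i j - ν * M.stiff i j) • u t j - p t j • M.grad i j) := by
  rw [hs.momentum i t ht]
  refine Finset.sum_subset (Finset.subset_univ _) fun j _ hj => ?_
  rw [(hs.laplacian t ht).sparse i j hj, conv, M.grad_eq_zero hj, M.stiff_eq_zero hj]
  simp

theorem sum_inner_pressure (hanti : ∀ i j, M.grad i j = -M.grad j i) (q : M.Node → ℝ)
    (w : M.Node → Vec d) :
    ∑ i, ∑ j, q j * inner ℝ (M.grad i j) (w i) = -(q ⬝ᵥ M.discDiv w) := by
  rw [Finset.sum_comm]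
  simp only [dotProduct, discDiv, Finset.mul_sum, ← Finset.sum_neg_distrib]
  refine Finset.sum_congr rfl fun j _ => Finset.sum_congr rfl fun i _ => ?_
  rw [hanti i j, inner_neg_left]
  ring

/-- The momentum equation tested with nodal values `w`. -/
theorem sum_lump_mul_inner (hs : M.IsBoundedSolution ν ω T C D u p)
    (hanti : ∀ i j, M.grad i j = -M.grad j i) {t : ℝ} (ht : t ∈ Ioo 0 T)
    (w : M.Node → Vec d) :
    ∑ i, M.lump i * inner ℝ (deriv (fun s => u s i) t) (w i) =
      ∑ i, ∑ j, D t i j * inner ℝ (u t j) (w i) -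
      ∑ i, ∑ j, M.conv (u t) i j * inner ℝ (u t j) (w i) - ν * M.stiffForm w (u t) +
      p t ⬝ᵥ M.discDiv w := by
  have h1 := sum_inner_pressure hanti (p t) w
  rw [← neg_eq_iff_eq_neg] at h1
  rw [← h1, stiffForm, Finset.mul_sum, ← sub_eq_add_neg]
  simp only [Finset.mul_sum, ← Finset.sum_sub_distrib]
  refine Finset.sum_congr rfl fun i _ => ?_
  rw [← real_inner_smul_left, hs.lump_smul_deriv ht, sum_inner]
  refine Finset.sum_congr rfl fun j _ => ?_
  rw [inner_sub_left, real_inner_smul_left, real_inner_smul_left, real_inner_comm (u t j) (w i)]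
  ring

theorem sum_laplacian_mul_inner (hs : M.IsBoundedSolution ν ω T C D u p) {t : ℝ}
    (ht : t ∈ Ioo 0 T) (w : M.Node → Vec d) :
    ∑ i, ∑ j, D t i j * inner ℝ (u t j) (w i) = -(1 / 2) *
      ∑ i, ∑ j ∈ (M.nbr i).erase i, D t i j * inner ℝ (w j - w i) (u t j - u t i) := by
  have hD := hs.laplacian t ht
  have h := sum_mul_inner_eq_neg_half hD.symm hD.row_sum w (u t)
  rw [M.sum_univ_eq_sum_erase (F := fun i j => D t i j * inner ℝ (w j - w i) (u t j - u t i))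
    (fun i => by simp) (fun i j hj => by rw [hD.sparse i j hj, zero_mul])] at h
  rw [← h]
  exact Finset.sum_congr rfl fun i _ => Finset.sum_congr rfl fun j _ => by rw [real_inner_comm]

end IsBoundedSolution

theorem stiffForm_eq_sum_erase (hrow : ∀ i, ∑ j, M.stiff i j = 0) (u w : M.Node → Vec d) :
    M.stiffForm u w = -(1 / 2) *
      ∑ i, ∑ j ∈ (M.nbr i).erase i, M.stiff i j * inner ℝ (u j - u i) (w j - w i) := by
  rw [stiffForm, sum_mul_inner_eq_neg_half M.stiff_comm hrow,
    M.sum_univ_eq_sum_erase (fun i => by simp) (fun i j hj => by rw [M.stiff_eq_zero hj, zero_mul])]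

theorem dotProduct_presStabLin_self_nonpos (hω : 0 ≤ ω) (p : M.Node → ℝ) :
    p ⬝ᵥ M.presStabLin ω p ≤ 0 := by
  rw [M.dotProduct_presStabLin]
  have : 0 ≤ ∑ i, ∑ j ∈ (M.nbr i).erase i, ω * M.mass i j * ((p j - p i) * (p j - p i)) :=
    Finset.sum_nonneg fun i _ => Finset.sum_nonneg fun j _ =>
      mul_nonneg (mul_nonneg hω (M.mass_nonneg i j)) (mul_self_nonneg _)
  linarith

namespace IsBoundedSolution

/-! ### The energy estimate -/

/-- The velocity bound extends by continuity to the end points, in particular to the initial data.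
-/
theorem norm_le_of_mem_Icc (hs : M.IsBoundedSolution ν ω T C D u p) (hT : 0 < T) {t : ℝ}
    (ht : t ∈ Icc 0 T) (i : M.Node) : ‖u t i‖ ≤ C := by
  have hcl : closure (Ioo 0 T) = Icc 0 T := closure_Ioo hT.ne
  refine le_on_closure (f := fun t => ‖u t i‖) (g := fun _ => C) (s := Ioo 0 T)
    (fun t ht => hs.norm_le t ht i) ?_ continuousOn_const (by rwa [hcl])
  rw [hcl]
  exact (hs.continuousOn i).norm

/-- The energy inequality in differential form: the scheme tested with the velocity. -/
theorem sum_lump_mul_inner_self_le (hs : M.IsBoundedSolution ν ω T C D u p) (hω : 0 ≤ ω)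
    (hanti : ∀ i j, M.grad i j = -M.grad j i) {t : ℝ} (ht : t ∈ Ioo 0 T) :
    2 * ∑ i, M.lump i * inner ℝ (deriv (fun s => u s i) t) (u t i) ≤
      -(∑ i, ∑ j ∈ (M.nbr i).erase i, D t i j * ‖u t j - u t i‖ ^ 2 +
        2 * ν * M.stiffForm (u t) (u t)) := by
  rw [hs.sum_lump_mul_inner hanti ht, hs.sum_laplacian_mul_inner ht]
  have h1 : ∑ i, ∑ j, M.conv (u t) i j * inner ℝ (u t j) (u t i) = 0 := sum_conv_self hanti (u t)
  have h2 := dotProduct_presStabLin_self_nonpos hω (p t)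
  rw [hs.presStabLin_eq ht] at h2
  simp only [real_inner_self_eq_norm_sq]
  rw [h1]
  linarith

theorem hasDerivAt (hs : M.IsBoundedSolution ν ω T C D u p) {t : ℝ} (ht : t ∈ Ioo 0 T)
    (i : M.Node) : HasDerivAt (fun s => u s i) (deriv (fun s => u s i) t) t :=
  (hs.differentiableAt i t ht).hasDerivAt

/-- A dissipation rate that is integrable in time has an integral bounded by the initial energy. -/
theorem integral_le_energy (hs : M.IsBoundedSolution ν ω T C D u p) (hL : ∀ k, 0 < L k)
    (hT : 0 < T) (hω : 0 ≤ ω)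
    (hanti : ∀ i j, M.grad i j = -M.grad j i) {φ : ℝ → ℝ} (hφ : IntegrableOn φ (Icc 0 T))
    (hφle : ∀ t ∈ Ioo 0 T, φ t ≤ ∑ i, ∑ j ∈ (M.nbr i).erase i, D t i j * ‖u t j - u t i‖ ^ 2 +
        2 * ν * M.stiffForm (u t) (u t)) :
    ∫ t in (0)..T, φ t ≤ C ^ 2 * volume.real (box L) := by
  have key := intervalIntegral.integral_le_sub_of_hasDeriv_right_of_le hT.le
    (g := fun t => -∑ i, M.lump i * ‖u t i‖ ^ 2)
    (g' := fun t => -(2 * ∑ i, M.lump i * inner ℝ (deriv (fun s => u s i) t) (u t i)))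
    (φ := φ) ?_ ?_ hφ ?_
  · refine key.trans ?_
    have h0 : ∑ i, M.lump i * ‖u 0 i‖ ^ 2 ≤ C ^ 2 * volume.real (box L) := by
      rw [← M.sum_lump hL, Finset.mul_sum]
      refine Finset.sum_le_sum fun i _ => ?_
      rw [mul_comm]
      refine mul_le_mul_of_nonneg_right ?_ (M.lump_pos hL i).le
      exact pow_le_pow_left₀ (norm_nonneg _) (hs.norm_le_of_mem_Icc hT ⟨le_rfl, hT.le⟩ i) 2
    have h1 : 0 ≤ ∑ i, M.lump i * ‖u T i‖ ^ 2 :=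
      Finset.sum_nonneg fun i _ => mul_nonneg (M.lump_pos hL i).le (sq_nonneg _)
    linarith
  · exact (continuousOn_finsetSum _ fun i _ =>
      continuousOn_const.mul ((hs.continuousOn i).norm.pow 2)).neg
  · intro t ht
    refine (HasDerivAt.neg ?_).hasDerivWithinAt
    rw [Finset.mul_sum]
    refine HasDerivAt.fun_sum fun i _ => ?_
    have h := ((hs.hasDerivAt ht i).norm_sq).const_mul (M.lump i)
    refine h.congr_deriv ?_
    rw [real_inner_comm]
    ring
  · intro t ht
    have := hs.sum_lump_mul_inner_self_le hω hanti ht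
    linarith [hφle t ht]

theorem continuousOn_stiffForm (hs : M.IsBoundedSolution ν ω T C D u p) :
    ContinuousOn (fun t => M.stiffForm (u t) (u t)) (Icc 0 T) :=
  continuousOn_finsetSum _ fun i _ => continuousOn_finsetSum _ fun j _ =>
    continuousOn_const.mul ((hs.continuousOn i).inner (hs.continuousOn j))

theorem continuousOn_jumpSq (hs : M.IsBoundedSolution ν ω T C D u p) :
    ContinuousOn (fun t => M.jumpSq (u t)) (Icc 0 T) :=
  continuousOn_finsetSum _ fun i _ => continuousOn_finsetSum _ fun j _ =>
    ((hs.continuousOn j).sub (hs.continuousOn i)).norm.pow 2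

theorem continuousOn_jump (hs : M.IsBoundedSolution ν ω T C D u p) :
    ContinuousOn (fun t => M.jump (u t)) (Icc 0 T) :=
  continuousOn_finsetSum _ fun i _ => continuousOn_finsetSum _ fun j _ =>
    ((hs.continuousOn j).sub (hs.continuousOn i)).norm

theorem integral_stiffForm_le (hs : M.IsBoundedSolution ν ω T C D u p) (hL : ∀ k, 0 < L k)
    (hT : 0 < T) (hω : 0 ≤ ω) (hanti : ∀ i j, M.grad i j = -M.grad j i) :
    ∫ t in (0)..T, 2 * ν * M.stiffForm (u t) (u t) ≤ C ^ 2 * volume.real (box L) := by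
  refine hs.integral_le_energy hL hT hω hanti
    ((continuousOn_const.mul hs.continuousOn_stiffForm).integrableOn_compact isCompact_Icc)
    fun t ht => ?_
  have : 0 ≤ ∑ i, ∑ j ∈ (M.nbr i).erase i, D t i j * ‖u t j - u t i‖ ^ 2 :=
    Finset.sum_nonneg fun i _ => Finset.sum_nonneg fun j hj =>
      mul_nonneg ((hs.laplacian t ht).nonneg i j (Finset.ne_of_mem_erase hj)) (sq_nonneg _)
  linarith

/-- If the dissipation controls the velocity jumps, then the energy estimate bounds them. Should
the dissipation fail to be integrable in time, its integral is zero by convention and the bound is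
immediate. -/
theorem integral_jumpSq_le (hs : M.IsBoundedSolution ν ω T C D u p) (hL : ∀ k, 0 < L k)
    (hT : 0 < T) (hω : 0 ≤ ω) (hanti : ∀ i j, M.grad i j = -M.grad j i)
    (hrow : ∀ i, ∑ j, M.stiff i j = 0) (hpsd : ∀ w : M.Node → Vec d, 0 ≤ M.stiffForm w w) {C' : ℝ}
    (hmin : ∫ t in (0)..T, M.h ^ (d - 1) *
          ∑ i, ∑ j ∈ (M.nbr i).erase i, ‖u t j - u t i‖ ^ 2 ≤
        C' * (1 + ∫ t in (0)..T, ∑ i, ∑ j ∈ (M.nbr i).erase i,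
          (D t i j - ν * M.stiff i j) * ‖u t j - u t i‖ ^ 2)) :
    ∫ t in (0)..T, M.h ^ (d - 1) * M.jumpSq (u t) ≤ |C'| * (1 + C ^ 2 * volume.real (box L)) := by
  refine hmin.trans ?_
  set I : ℝ → ℝ := fun t => ∑ i, ∑ j ∈ (M.nbr i).erase i,
          (D t i j - ν * M.stiff i j) * ‖u t j - u t i‖ ^ 2 with hI
  have e : ∀ t, I t = ∑ i, ∑ j ∈ (M.nbr i).erase i, D t i j * ‖u t j - u t i‖ ^ 2 +
        2 * ν * M.stiffForm (u t) (u t) := by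
    intro t
    rw [stiffForm_eq_sum_erase hrow]
    simp only [hI, sub_mul, Finset.sum_sub_distrib, mul_assoc, ← Finset.mul_sum,
      real_inner_self_eq_norm_sq]
    ring
  have hI0 : ∀ t ∈ Ioo 0 T, 0 ≤ I t := by
    intro t ht
    rw [e]
    refine add_nonneg (Finset.sum_nonneg fun i _ => Finset.sum_nonneg fun j hj =>
      mul_nonneg ((hs.laplacian t ht).nonneg i j (Finset.ne_of_mem_erase hj)) (sq_nonneg _)) ?_
    exact mul_nonneg (mul_nonneg zero_le_two hs.visc_nonneg) (hpsd _)
  have hint0 : 0 ≤ ∫ t in (0)..T, I t := by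
    rw [intervalIntegral.integral_of_le hT.le, integral_Ioc_eq_integral_Ioo]
    exact setIntegral_nonneg measurableSet_Ioo hI0
  have hint : ∫ t in (0)..T, I t ≤ C ^ 2 * volume.real (box L) := by
    by_cases hii : IntervalIntegrable I volume 0 T
    · refine hs.integral_le_energy hL hT hω hanti ?_ fun t _ => (e t).le
      rwa [intervalIntegrable_iff_integrableOn_Icc_of_le hT.le] at hii
    · rw [intervalIntegral.integral_undef hii]
      positivity
  calc C' * (1 + ∫ t in (0)..T, I t) ≤ |C'| * (1 + ∫ t in (0)..T, I t) :=
        mul_le_mul_of_nonneg_right (le_abs_self _) (by linarith)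
    _ ≤ _ := mul_le_mul_of_nonneg_left (by linarith) (abs_nonneg _)

end IsBoundedSolution
end PeriodicMesh
end PeriodicFEM

namespace PeriodicFEM
namespace PeriodicMesh

variable {d : ℕ} {L : Fin d → ℝ} {M : PeriodicMesh L}
variable {ν ω T C : ℝ} {D : ℝ → M.Node → M.Node → ℝ} {u : ℝ → M.Node → Vec d}
  {p : ℝ → M.Node → ℝ}

namespace IsBoundedSolution

/-! ### The time derivative of the velocity -/

theorem exists_laplacian_bound (hs : M.IsBoundedSolution ν ω T C D u p) :
    ∃ B, ∀ t ∈ Ioo 0 T, ∀ i j, |D t i j| ≤ B := by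
  set b := |C * M.h ^ (d - 1)| with hb
  refine ⟨b + Fintype.card M.Node * b, fun t ht i j => ?_⟩
  have hD := hs.laplacian t ht
  have hoff : ∀ j, j ≠ i → |D t i j| ≤ b := fun j hj => by
    rw [abs_of_nonneg (hD.nonneg i j hj)]
    exact (hs.laplacian_le t ht i j hj).trans (le_abs_self _)
  have hb0 : 0 ≤ b := abs_nonneg _
  by_cases hji : j = i
  · subst hji
    have h := hD.row_sum j
    rw [← Finset.add_sum_erase _ _ (Finset.mem_univ j), add_eq_zero_iff_eq_neg] at h
    rw [h, abs_neg]
    refine (Finset.abs_sum_le_sum_abs _ _).trans ?_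
    refine (Finset.sum_le_card_nsmul _ _ b fun k hk => hoff k (Finset.ne_of_mem_erase hk)).trans ?_
    rw [nsmul_eq_mul]
    have : ((Finset.univ.erase j).card : ℝ) ≤ Fintype.card M.Node := by
      exact_mod_cast Finset.card_le_univ _
    nlinarith
  · have := hoff j hji
    have h2 : (0 : ℝ) ≤ Fintype.card M.Node * b := by positivity
    linarith

/-- On a fixed mesh the time derivative of the velocity is bounded, hence integrable. No uniformity
in the mesh is claimed. -/
theorem exists_deriv_bound (hs : M.IsBoundedSolution ν ω T C D u p) (hL : ∀ k, 0 < L k) :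
    ∃ B, ∀ t ∈ Ioo 0 T, ∀ i, ‖deriv (fun s => u s i) t‖ ≤ B := by
  obtain ⟨BD, hBD⟩ := hs.exists_laplacian_bound
  have hC := hs.const_nonneg
  have key : ∀ i, ∀ t ∈ Ioo 0 T, ‖deriv (fun s => u s i) t‖ ≤ (M.lump i)⁻¹ *
      ∑ j, ((BD + C * ‖M.grad i j‖ + |ν * M.stiff i j|) * C + C * ‖M.grad i j‖) := by
    intro i t ht
    have hpos := M.lump_pos hL i
    rw [inv_mul_eq_div, le_div_iff₀ hpos, mul_comm]
    have h := congrArg norm (hs.lump_smul_deriv ht i)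
    rw [norm_smul, Real.norm_of_nonneg hpos.le] at h
    rw [h]
    refine (norm_sum_le _ _).trans (Finset.sum_le_sum fun j _ => ?_)
    refine (norm_sub_le _ _).trans ?_
    rw [norm_smul, norm_smul, Real.norm_eq_abs, Real.norm_eq_abs]
    have h1 := hBD t ht i j
    have h2 : |M.conv (u t) i j| ≤ C * ‖M.grad i j‖ := by
      refine (abs_real_inner_le_norm _ _).trans (mul_le_mul_of_nonneg_right ?_ (norm_nonneg _))
      rw [norm_smul]
      have := norm_add_le (u t j) (u t i)
      have h3 := hs.norm_le t ht j
      have h4 := hs.norm_le t ht i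
      norm_num
      linarith
    have h3 : |D t i j - M.conv (u t) i j - ν * M.stiff i j| ≤
        BD + C * ‖M.grad i j‖ + |ν * M.stiff i j| := by
      refine (abs_sub _ _).trans (add_le_add ((abs_sub _ _).trans (add_le_add h1 h2)) le_rfl)
    have h4 := hs.norm_le t ht j
    have h5 := hs.abs_le t ht j
    exact add_le_add (mul_le_mul h3 h4 (norm_nonneg _) ((abs_nonneg _).trans h3))
      (mul_le_mul_of_nonneg_right h5 (norm_nonneg _))
  set B : M.Node → ℝ := fun i => (M.lump i)⁻¹ *
      ∑ j, ((BD + C * ‖M.grad i j‖ + |ν * M.stiff i j|) * C + C * ‖M.grad i j‖) with hB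
  refine ⟨∑ i, |B i|, fun t ht i => (key i t ht).trans ((le_abs_self _).trans ?_)⟩
  exact Finset.single_le_sum (f := fun i => |B i|) (fun i _ => abs_nonneg _) (Finset.mem_univ i)

theorem integrableOn_lump_deriv_sq (hs : M.IsBoundedSolution ν ω T C D u p) (hL : ∀ k, 0 < L k) :
    IntegrableOn (fun t => ∑ i, M.lump i * ‖deriv (fun s => u s i) t‖ ^ 2) (Ioo 0 T) := by
  obtain ⟨B, hB⟩ := hs.exists_deriv_bound hL
  refine integrable_finsetSum _ fun i _ => Integrable.const_mul ?_ _
  have : IsFiniteMeasure (volume.restrict (Ioo 0 T)) := ⟨by simp⟩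
  refine Integrable.of_bound ((measurable_deriv _).norm.pow_const 2).aestronglyMeasurable (B ^ 2)
    ((ae_restrict_iff' measurableSet_Ioo).2 (ae_of_all _ fun t ht => ?_))
  rw [norm_pow, norm_norm]
  exact pow_le_pow_left₀ (norm_nonneg _) (hB t ht i) 2

/-- The convective force vanishes for constant velocities and is thus controlled by the jumps. -/
theorem norm_sum_conv_smul_le {w : M.Node → Vec d} (hrow : ∀ i, ∑ j, M.grad i j = 0)
    {G : ℝ} (hG : ∀ i j, ‖M.grad i j‖ ≤ G) (hw : ∀ i, ‖w i‖ ≤ C) (i : M.Node) :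
    ‖∑ j, M.conv w i j • w j‖ ≤ 2 * C * G * ∑ j ∈ (M.nbr i).erase i, ‖w j - w i‖ := by
  have hC : 0 ≤ C := (norm_nonneg _).trans (hw i)
  have e : ∑ j, M.conv w i j • w j =
      ∑ j, (M.conv w i j • (w j - w i) + ((1 / 2 : ℝ) * inner ℝ (w j - w i) (M.grad i j)) • w i) := by
    have h0 : ∑ j, inner ℝ (w i) (M.grad i j) • w i = 0 := by
      rw [← Finset.sum_smul, ← inner_sum, hrow, inner_zero_right, zero_smul]
    rw [← sub_eq_zero, ← Finset.sum_sub_distrib, ← h0]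
    refine Finset.sum_congr rfl fun j _ => ?_
    simp only [conv, real_inner_smul_left, inner_add_left, inner_sub_left]
    module
  rw [e]
  rw [← Finset.sum_subset (Finset.subset_univ ((M.nbr i).erase i))]
  · rw [Finset.mul_sum]
    refine (norm_sum_le _ _).trans (Finset.sum_le_sum fun j _ => ?_)
    refine (norm_add_le _ _).trans ?_
    rw [norm_smul, norm_smul]
    have h1 : ‖M.conv w i j‖ ≤ C * G := by
      refine (norm_inner_le_norm _ _).trans
        (mul_le_mul ?_ (hG i j) (norm_nonneg _) hC)
      rw [norm_smul]
      have h2 := norm_add_le (w j) (w i)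
      have h3 := hw i
      have h4 := hw j
      norm_num
      linarith
    have h2 : ‖(1 / 2 : ℝ) * inner ℝ (w j - w i) (M.grad i j)‖ ≤ ‖w j - w i‖ * G := by
      rw [norm_mul]
      have h3 := (norm_inner_le_norm (𝕜 := ℝ) (w j - w i) (M.grad i j)).trans
        (mul_le_mul_of_nonneg_left (hG i j) (norm_nonneg _))
      have h4 := norm_nonneg (inner ℝ (w j - w i) (M.grad i j))
      rw [Real.norm_of_nonneg (by norm_num : (0 : ℝ) ≤ 1 / 2)]
      linarith
    have h5 := mul_le_mul_of_nonneg_right h1 (norm_nonneg (w j - w i))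
    have h6 := mul_le_mul h2 (hw i) (norm_nonneg _) ((norm_nonneg _).trans h2)
    linarith
  · intro j _ hj
    by_cases hji : j = i
    · subst hji; simp
    · have : j ∉ M.nbr i := fun hc => hj (Finset.mem_erase.2 ⟨hji, hc⟩)
      simp [conv, M.grad_eq_zero this]

/-- The forces due to artificial viscosity and convection are controlled by the jumps. -/
theorem norm_force_le (hs : M.IsBoundedSolution ν ω T C D u p)
    (hrow : ∀ i, ∑ j, M.grad i j = 0) {G : ℝ} (hG : ∀ i j, ‖M.grad i j‖ ≤ G) {t : ℝ}
    (ht : t ∈ Ioo 0 T) (i : M.Node) :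
    ‖∑ j, (D t i j - M.conv (u t) i j) • u t j‖ ≤
      (C * M.h ^ (d - 1) + 2 * C * G) * ∑ j ∈ (M.nbr i).erase i, ‖u t j - u t i‖ := by
  have hD := hs.laplacian t ht
  have e : ∑ j, D t i j • u t j = ∑ j ∈ (M.nbr i).erase i, D t i j • (u t j - u t i) := by
    rw [Finset.sum_subset (Finset.subset_univ ((M.nbr i).erase i))]
    · simp only [smul_sub, Finset.sum_sub_distrib]
      rw [← Finset.sum_smul, hD.row_sum, zero_smul, sub_zero]
    · intro j _ hj
      by_cases hji : j = i
      · subst hji; simp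
      · rw [hD.sparse i j fun hc => hj (Finset.mem_erase.2 ⟨hji, hc⟩), zero_smul]
  simp only [sub_smul, Finset.sum_sub_distrib]
  refine (norm_sub_le _ _).trans ?_
  rw [add_mul, e]
  refine add_le_add ?_ (norm_sum_conv_smul_le hrow hG (fun i => hs.norm_le t ht i) i)
  rw [Finset.mul_sum]
  refine (norm_sum_le _ _).trans (Finset.sum_le_sum fun j hj => ?_)
  have hji := Finset.ne_of_mem_erase hj
  rw [norm_smul, Real.norm_of_nonneg (hD.nonneg i j hji)]
  exact mul_le_mul_of_nonneg_right (hs.laplacian_le t ht i j hji) (norm_nonneg _)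

theorem hasDerivAt_stiffForm (hs : M.IsBoundedSolution ν ω T C D u p) {t : ℝ} (ht : t ∈ Ioo 0 T) :
    HasDerivAt (fun s => M.stiffForm (u s) (u s))
      (2 * M.stiffForm (fun i => deriv (fun s => u s i) t) (u t)) t := by
  have h : HasDerivAt (fun s => M.stiffForm (u s) (u s))
      (∑ i, ∑ j, M.stiff i j * (inner ℝ (u t i) (deriv (fun s => u s j) t) +
        inner ℝ (deriv (fun s => u s i) t) (u t j))) t :=
    HasDerivAt.fun_sum fun i _ => HasDerivAt.fun_sum fun j _ =>
      ((hs.hasDerivAt ht i).inner ℝ (hs.hasDerivAt ht j)).const_mul _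
  refine h.congr_deriv ?_
  rw [two_mul]
  nth_rw 1 [stiffForm_comm]
  simp only [stiffForm, mul_add, Finset.sum_add_distrib]

theorem hasDerivAt_discDiv (hs : M.IsBoundedSolution ν ω T C D u p) {t : ℝ} (ht : t ∈ Ioo 0 T) :
    HasDerivAt (fun s => M.discDiv (u s)) (M.discDiv fun i => deriv (fun s => u s i) t) t := by
  refine hasDerivAt_pi.2 fun k => HasDerivAt.fun_sum fun j _ => ?_
  have h := (hasDerivAt_const t (M.grad k j)).inner ℝ (hs.hasDerivAt ht j)
  simpa using h

theorem continuousOn_discDiv (hs : M.IsBoundedSolution ν ω T C D u p) :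
    ContinuousOn (fun s => M.discDiv (u s)) (Icc 0 T) :=
  continuousOn_pi.2 fun _ => continuousOn_finsetSum _ fun j _ =>
    continuousOn_const.inner (hs.continuousOn j)

theorem inner_le_of_pos {E : Type*} [NormedAddCommGroup E] [InnerProductSpace ℝ E] {m : ℝ}
    (hm : 0 < m) (x y : E) : inner ℝ x y ≤ m / 2 * ‖y‖ ^ 2 + ‖x‖ ^ 2 / (2 * m) := by
  refine (real_inner_le_norm x y).trans ?_
  have e : m / 2 * ‖y‖ ^ 2 + ‖x‖ ^ 2 / (2 * m) - ‖x‖ * ‖y‖ = (m * ‖y‖ - ‖x‖) ^ 2 / (2 * m) := by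
    field_simp
    ring
  have : 0 ≤ (m * ‖y‖ - ‖x‖) ^ 2 / (2 * m) := by positivity
  linarith

/-- The discrete time derivative is bounded by the forces, the initial pressure stabilization and
the initial dissipation. Testing the momentum equation with the time derivative of the velocity
turns the viscous term and, by means of the stabilized continuity equation, also the pressure term
into time derivatives of nonnegative quadratic forms. -/
theorem integral_lump_deriv_sq_le (hs : M.IsBoundedSolution ν ω T C D u p) (hL : ∀ k, 0 < L k)
    (hT : 0 < T) (hω : 0 ≤ ω) (hanti : ∀ i j, M.grad i j = -M.grad j i)
    (hpsd : ∀ w : M.Node → Vec d, 0 ≤ M.stiffForm w w) {N₀ : ℝ}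
    (hN₀ : ∀ t ∈ Ioo 0 T, -(p t ⬝ᵥ M.presStabLin ω (p t)) ≤ N₀) {A : ℝ}
    (hA : ∀ t ∈ Ioo 0 T, ∀ i,
      ‖∑ j, (D t i j - M.conv (u t) i j) • u t j‖ ^ 2 / M.lump i ≤
        A * ∑ j ∈ (M.nbr i).erase i, ‖u t j - u t i‖ ^ 2) :
    ∫ t in (0)..T, ∑ i, M.lump i * ‖deriv (fun s => u s i) t‖ ^ 2 ≤
      N₀ + ν * M.stiffForm (u 0) (u 0) + A * ∫ t in (0)..T, M.jumpSq (u t) := by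
  obtain ⟨g, hg⟩ := exists_generalizedInverse (M.presStabLin ω)
  set N : ℝ → ℝ := fun t => -(g (M.discDiv (u t)) ⬝ᵥ M.discDiv (u t)) with hN
  have hNp : ∀ t ∈ Ioo 0 T, N t = -(p t ⬝ᵥ M.presStabLin ω (p t)) := by
    intro t ht
    simp only [hN]
    rw [← hs.presStabLin_eq ht, ← M.presStabLin_dotProduct, hg, M.presStabLin_dotProduct]
  have hNc : ContinuousOn N (Icc 0 T) := by
    have h1 := hs.continuousOn_discDiv
    have h2 : ContinuousOn (fun s => g (M.discDiv (u s))) (Icc 0 T) :=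
      (LinearMap.continuous_of_finiteDimensional g).comp_continuousOn h1
    exact (continuousOn_finsetSum _ fun k _ =>
      ((continuousOn_pi.1 h2) k).mul ((continuousOn_pi.1 h1) k)).neg
  -- The scheme holds on the open interval only; the form `N` carries the bounds to its end points.
  have hcl : closure (Ioo 0 T) = Icc 0 T := closure_Ioo hT.ne
  have hN0 : N 0 ≤ N₀ := by
    refine le_on_closure (f := N) (g := fun _ => N₀) (s := Ioo 0 T)
      (fun t ht => (hNp t ht).trans_le (hN₀ t ht)) (by rwa [hcl]) continuousOn_const ?_
    rw [hcl]; exact ⟨le_rfl, hT.le⟩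
  have hNT : 0 ≤ N T := by
    refine le_on_closure (f := fun _ => 0) (g := N) (s := Ioo 0 T)
      (fun t ht => ?_) continuousOn_const (by rwa [hcl]) ?_
    · rw [hNp t ht]
      exact neg_nonneg.2 (dotProduct_presStabLin_self_nonpos hω _)
    · rw [hcl]; exact ⟨hT.le, le_rfl⟩
  have hNd : ∀ t ∈ Ioo 0 T, HasDerivAt N
      (-(2 * (p t ⬝ᵥ M.discDiv fun i => deriv (fun s => u s i) t))) t := by
    intro t ht
    refine (hasDerivAt_quadratic hg (M.presStabLin_dotProduct ω) (hs.hasDerivAt_discDiv ht) ?_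
      (hs.presStabLin_eq ht)).neg
    filter_upwards [isOpen_Ioo.mem_nhds ht] with s hst
    exact ⟨p s, hs.presStabLin_eq hst⟩
  have hd2 := hs.integrableOn_lump_deriv_sq hL
  rw [← integrableOn_Icc_iff_integrableOn_Ioo] at hd2
  have hj2 : IntegrableOn (fun t => M.jumpSq (u t)) (Icc 0 T) :=
    hs.continuousOn_jumpSq.integrableOn_compact isCompact_Icc
  have key := intervalIntegral.integral_le_sub_of_hasDeriv_right_of_le hT.le
    (g := fun t => -(N t + ν * M.stiffForm (u t) (u t)))
    (g' := fun t => -(-(2 * (p t ⬝ᵥ M.discDiv fun i => deriv (fun s => u s i) t)) +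
      ν * (2 * M.stiffForm (fun i => deriv (fun s => u s i) t) (u t))))
    (φ := fun t => ∑ i, M.lump i * ‖deriv (fun s => u s i) t‖ ^ 2 - A * M.jumpSq (u t)) ?_ ?_ ?_ ?_
  · rw [intervalIntegral.integral_sub, intervalIntegral.integral_const_mul] at key
    · have h1 := mul_nonneg hs.visc_nonneg (hpsd (u T))
      linarith
    · rwa [intervalIntegrable_iff_integrableOn_Icc_of_le hT.le]
    · rw [intervalIntegrable_iff_integrableOn_Icc_of_le hT.le]
      exact hj2.const_mul A
  · exact (hNc.add (continuousOn_const.mul hs.continuousOn_stiffForm)).neg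
  · intro t ht
    exact ((hNd t ht).add ((hs.hasDerivAt_stiffForm ht).const_mul ν)).neg.hasDerivWithinAt
  · exact hd2.sub (hj2.const_mul A)
  · intro t ht
    have h1 := hs.sum_lump_mul_inner hanti ht fun i => deriv (fun s => u s i) t
    simp only [real_inner_self_eq_norm_sq] at h1
    have h2 : ∑ i, ∑ j, D t i j * inner ℝ (u t j) (deriv (fun s => u s i) t) -
        ∑ i, ∑ j, M.conv (u t) i j * inner ℝ (u t j) (deriv (fun s => u s i) t) =
        ∑ i, inner ℝ (∑ j, (D t i j - M.conv (u t) i j) • u t j) (deriv (fun s => u s i) t) := by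
      rw [← Finset.sum_sub_distrib]
      refine Finset.sum_congr rfl fun i _ => ?_
      rw [sum_inner, ← Finset.sum_sub_distrib]
      refine Finset.sum_congr rfl fun j _ => ?_
      rw [real_inner_smul_left]
      ring
    have h3 : ∑ i, inner ℝ (∑ j, (D t i j - M.conv (u t) i j) • u t j)
        (deriv (fun s => u s i) t) ≤ 1 / 2 * ∑ i, M.lump i * ‖deriv (fun s => u s i) t‖ ^ 2 +
        1 / 2 * (A * M.jumpSq (u t)) := by
      rw [jumpSq, Finset.mul_sum, Finset.mul_sum, Finset.mul_sum, ← Finset.sum_add_distrib]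
      refine Finset.sum_le_sum fun i _ => ?_
      refine (inner_le_of_pos (M.lump_pos hL i) _ _).trans ?_
      have h4 := hA t ht i
      have h5 : ∀ x : ℝ, x / (2 * M.lump i) = 1 / 2 * (x / M.lump i) := fun x => by
        rw [mul_comm, ← div_div]; ring
      rw [h5]
      linarith
    linarith

end IsBoundedSolution
end PeriodicMesh
end PeriodicFEM

namespace PeriodicFEM

variable {d : ℕ} {L : Fin d → ℝ}

/-! ### Test functions and interpolation -/

/-- Functions supported in the period cell, at a distance of at least `ρ` from its boundary. -/
def SupportedInside {V : Type*} [Zero V] (L : Fin d → ℝ) (ρ : ℝ) (f : Vec d → V) : Prop :=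
  ∀ x, f x ≠ 0 → Metric.ball x ρ ⊆ box L

section

variable {V : Type*} [NormedAddCommGroup V] {ρ : ℝ} {f : Vec d → V}

theorem SupportedInside.mem_box_of_mem_closure (hf : SupportedInside L ρ f) (hρ : 0 < ρ) {x : Vec d}
    (hx : x ∈ tsupport f) : x ∈ box L := by
  obtain ⟨y, hy, hxy⟩ := Metric.mem_closure_iff.1 hx ρ hρ
  exact hf y hy hxy

theorem SupportedInside.hasCompactSupport (hf : SupportedInside L ρ f) (hρ : 0 < ρ) :
    HasCompactSupport f :=
  Metric.isCompact_of_isClosed_isBounded (isClosed_tsupport f)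
    ((isBounded_box L).subset fun _ hx => hf.mem_box_of_mem_closure hρ hx)

/-- The value of a test function at a node agrees with its value at any periodic copy of the node
close to the period cell. This replaces periodic extensions of test functions. -/
theorem SupportedInside.apply_eq (hL : ∀ k, 0 < L k) (hf : SupportedInside L ρ f) {x y y' : Vec d}
    (hx : x ∈ cellBox L) (hxy : dist x y < ρ) (hy' : y' ∈ cellBox L) (h : Congr L y y') :
    f y' = f y := by
  have hρ : 0 < ρ := dist_nonneg.trans_lt hxy
  by_cases hy : f y = 0
  · by_contra hc
    have hball := hf y' (by rw [hy] at hc; exact hc)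
    have hmem : x - y + y' ∈ box L := hball (by simpa [mem_ball_iff_norm, dist_eq_norm] using hxy)
    have hcongr : Congr L (x - y + y') x := by
      refine congr_sub_zero.1 ?_
      rw [show x - y + y' - x = y' - y by abel]
      exact h.symm.sub_zero
    have e := eq_of_congr_of_mem_cellBox hL (box_subset_cellBox hmem) hx hcongr
    have : y' = y := by
      calc y' = (x - y + y') - x + y := by abel
        _ = y := by rw [e]; abel
    exact hc (by rw [this])
  · have hmem : y ∈ cellBox L := box_subset_cellBox (hf y hy (Metric.mem_ball_self hρ))
    rw [eq_of_congr_of_mem_cellBox hL hmem hy' h]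

end

theorem SupportedInside.fderiv_eq_zero {V : Type*} [NormedAddCommGroup V] [NormedSpace ℝ V] {ρ : ℝ}
    {f : Vec d → V} (hf : SupportedInside L ρ f) (hρ : 0 < ρ) {x : Vec d} (hx : x ∉ box L) :
    fderiv ℝ f x = 0 := by
  by_contra hc
  exact hx (hf.mem_box_of_mem_closure hρ (support_fderiv_subset ℝ hc))

theorem SupportedInside.eq_zero {V : Type*} [NormedAddCommGroup V] {ρ : ℝ}
    {f : Vec d → V} (hf : SupportedInside L ρ f) (hρ : 0 < ρ) {x : Vec d} (hx : x ∉ box L) :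
    f x = 0 := by
  by_contra hc
  exact hx (hf x hc (Metric.mem_ball_self hρ))

/-- Quantitative properties of a smooth vector field supported inside the period cell: `B` bounds
the field, its derivative, its Lipschitz constant and its second order Taylor remainder, and `ρ` is
the distance of the support from the boundary of the cell. -/
structure IsTestField (L : Fin d → ℝ) (B ρ : ℝ) (w : Vec d → Vec d) : Prop where
  pos : 0 < ρ
  contDiff : ContDiff ℝ 1 w
  supp : SupportedInside L ρ w
  bound_nonneg : 0 ≤ B
  norm_le : ∀ x, ‖w x‖ ≤ B
  norm_fderiv_le : ∀ x, ‖fderiv ℝ w x‖ ≤ B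
  norm_sub_le : ∀ x y, ‖w x - w y‖ ≤ B * ‖x - y‖
  taylor : ∀ x y, ‖w y - w x - fderiv ℝ w x (y - x)‖ ≤ B * ‖y - x‖ ^ 2

namespace PeriodicMesh

variable {M : PeriodicMesh L}

theorem exists_mem_cellBox_of_mem_nbr (hL : ∀ k, 0 < L k) {i j : M.Node} (hij : j ∈ M.nbr i) :
    ∃ x ∈ cellBox L, M.phi i x ≠ 0 ∧ M.phi j x ≠ 0 := by
  obtain ⟨y, hi, hj⟩ := M.mem_nbr.1 hij
  obtain ⟨x, hx, hxy⟩ := exists_mem_cellBox hL y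
  exact ⟨x, hx, by rwa [M.phi_congr i hxy], by rwa [M.phi_congr j hxy]⟩

section

variable {V : Type*} [NormedAddCommGroup V] {ρ B : ℝ} {f : Vec d → V}

theorem norm_sub_node_le (hL : ∀ k, 0 < L k) (hf : SupportedInside L ρ f) (hB : 0 ≤ B)
    (hlip : ∀ x y, ‖f x - f y‖ ≤ B * ‖x - y‖) (hh : M.h < ρ) {x : Vec d} (hx : x ∈ cellBox L)
    {i : M.Node} (hi : M.phi i x ≠ 0) : ‖f x - f i.1‖ ≤ B * M.h := by
  obtain ⟨y, hy, hxy⟩ := M.exists_near_of_phi_ne_zero hL hi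
  rw [hf.apply_eq hL hx (hxy.trans_lt hh) i.2.2 hy]
  refine (hlip x y).trans (mul_le_mul_of_nonneg_left ?_ hB)
  rwa [← dist_eq_norm]

theorem norm_node_sub_node_le (hL : ∀ k, 0 < L k) (hf : SupportedInside L ρ f) (hB : 0 ≤ B)
    (hlip : ∀ x y, ‖f x - f y‖ ≤ B * ‖x - y‖) (hh : M.h < ρ) {i j : M.Node} (hij : j ∈ M.nbr i) :
    ‖f j.1 - f i.1‖ ≤ 2 * B * M.h := by
  obtain ⟨x, hx, hi, hj⟩ := exists_mem_cellBox_of_mem_nbr hL hij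
  have h1 := norm_sub_node_le hL hf hB hlip hh hx hi
  have h2 := norm_sub_node_le hL hf hB hlip hh hx hj
  have e : f j.1 - f i.1 = (f x - f i.1) - (f x - f j.1) := by abel
  rw [e]
  refine (norm_sub_le _ _).trans ?_
  linarith

end

/-- Interpolation of a test field is of second order in the mesh size. -/
theorem norm_interpolation_sub_le (hL : ∀ k, 0 < L k) {B ρ : ℝ} {w : Vec d → Vec d}
    (hw : IsTestField L B ρ w) (hh : M.h < ρ) {x : Vec d} (hx : x ∈ cellBox L) :
    ‖M.fe (fun i => w i.1) x - w x‖ ≤ B * M.h ^ 2 := by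
  obtain ⟨s, hs, -, l, h0, h1, hl⟩ := M.exists_weights x
  have hxs : x ∈ convexHull ℝ (s : Set (Vec d)) := Finset.mem_convexHull'.2 ⟨l, h0, h1, hl⟩
  have hd : ∀ y ∈ s, dist x y ≤ M.h := fun y hy => M.dist_le_h hL hs hxs (subset_convexHull ℝ _ hy)
  have e := M.fe_eq hL hs h0 h1 (fun i => w i.1) w fun y hy i hyi =>
    hw.supp.apply_eq hL hx ((hd y hy).trans_lt hh) i.2.2 hyi
  rw [hl] at e
  -- the linear part of the Taylor polynomial at `x` averages to zero
  have e2 : M.fe (fun i => w i.1) x - w x =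
      ∑ y ∈ s, l y • (w y - w x - fderiv ℝ w x (y - x)) := by
    rw [e]
    simp only [smul_sub, Finset.sum_sub_distrib, map_sub, ← map_smul, ← map_sum, hl,
      ← Finset.sum_smul, h1, one_smul]
    abel
  rw [e2]
  refine (norm_sum_le _ _).trans ?_
  rw [← one_mul (B * M.h ^ 2), ← h1, Finset.sum_mul]
  refine Finset.sum_le_sum fun y hy => ?_
  rw [norm_smul, Real.norm_of_nonneg (h0 y hy)]
  refine mul_le_mul_of_nonneg_left ((hw.taylor x y).trans ?_) (h0 y hy)
  refine mul_le_mul_of_nonneg_left (pow_le_pow_left₀ (norm_nonneg _) ?_ 2) hw.bound_nonneg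
  rw [← dist_eq_norm, dist_comm]
  exact hd y hy

theorem continuous_fe (hL : ∀ k, 0 < L k) {V : Type*} [NormedAddCommGroup V] [NormedSpace ℝ V]
    (c : M.Node → V) : Continuous (M.fe c) :=
  continuous_finsetSum _ fun i _ => (M.continuous_phi hL i).smul continuous_const

theorem norm_fe_le (hL : ∀ k, 0 < L k) {V : Type*} [NormedAddCommGroup V] [NormedSpace ℝ V]
    {c : M.Node → V} {C : ℝ} (hc : ∀ i, ‖c i‖ ≤ C) (x : Vec d) : ‖M.fe c x‖ ≤ C := by
  refine (norm_sum_le _ _).trans ?_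
  rw [← one_mul C, ← M.sum_phi hL x, Finset.sum_mul]
  refine Finset.sum_le_sum fun i _ => ?_
  rw [norm_smul, Real.norm_of_nonneg (M.phi_nonneg i x)]
  exact mul_le_mul_of_nonneg_left (hc i) (M.phi_nonneg i x)

theorem norm_sub_fe_le (hL : ∀ k, 0 < L k) {V : Type*} [NormedAddCommGroup V] [NormedSpace ℝ V]
    (c : M.Node → V) (i : M.Node) (x : Vec d) :
    ‖c i - M.fe c x‖ ≤ ∑ j, M.phi j x * ‖c j - c i‖ := by
  have e : c i - M.fe c x = ∑ j, M.phi j x • (c i - c j) := by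
    simp only [smul_sub, Finset.sum_sub_distrib, ← Finset.sum_smul, M.sum_phi hL, one_smul, fe]
  rw [e]
  refine (norm_sum_le _ _).trans (Finset.sum_le_sum fun j _ => ?_)
  rw [norm_smul, Real.norm_of_nonneg (M.phi_nonneg j x), norm_sub_rev]

theorem exists_bound_on_box {V : Type*} [NormedAddCommGroup V] {g : Vec d → V} (hg : Continuous g) :
    ∃ B, ∀ x ∈ box L, ‖g x‖ ≤ B := by
  obtain ⟨B, hB⟩ := (isBounded_box L).isCompact_closure.exists_bound_of_continuousOn hg.continuousOn
  exact ⟨B, fun x hx => hB x (subset_closure hx)⟩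

variable {K : NNReal}

theorem integrableOn_inner_gradient_continuous (hlip : ∀ i, LipschitzWith K (M.phi i)) (i : M.Node)
    {g : Vec d → Vec d} (hg : Continuous g) :
    IntegrableOn (fun x => inner ℝ (gradient (M.phi i) x) (g x)) (box L) := by
  obtain ⟨B, hB⟩ := exists_bound_on_box (L := L) hg
  refine integrableOn_box_of_bound (C := K * B) ?_ fun x hx => ?_
  · exact ((measurable_gradient _).inner hg.measurable).aestronglyMeasurable
  · exact (norm_inner_le_norm _ _).trans
      (mul_le_mul (norm_gradient_phi_le hlip i x) (hB x hx) (norm_nonneg _) K.coe_nonneg)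

/-- Integration by parts against a function supported inside the period cell. -/
theorem setIntegral_inner_gradient_smul (hlip : ∀ i, LipschitzWith K (M.phi i)) (i : M.Node)
    {ρ : ℝ} (hρ : 0 < ρ) {g : Vec d → ℝ} (hg : Differentiable ℝ g) {B : NNReal}
    (hgl : LipschitzWith B g) (hsupp : SupportedInside L ρ g) (a : Vec d) :
    ∫ x in box L, inner ℝ (gradient (M.phi i) x) (g x • a) =
      -∫ x in box L, M.phi i x * fderiv ℝ g x a := by
  have key := (hlip i).integral_lineDeriv_mul_eq (μ := volume) hgl (hsupp.hasCompactSupport hρ) a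
  rw [← integral_neg, setIntegral_eq_integral_of_forall_compl_eq_zero,
    setIntegral_eq_integral_of_forall_compl_eq_zero]
  · refine Eq.trans (integral_congr_ae ?_) (key.trans (integral_congr_ae (ae_of_all _ fun x => ?_)))
    · filter_upwards [(hlip i).ae_differentiableAt] with x hx
      rw [hx.lineDeriv_eq_fderiv, inner_smul_right, inner_gradient_left, mul_comm]
    · simp only [(hg x).lineDeriv_eq_fderiv, map_neg]
      ring
  · intro x hx
    rw [hsupp.fderiv_eq_zero hρ hx]
    simp
  · intro x hx
    rw [hsupp.eq_zero hρ hx, zero_smul, inner_zero_right]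

theorem SupportedInside.comp_inner {ρ : ℝ} {w : Vec d → Vec d} (hw : SupportedInside L ρ w)
    (a : Vec d) : SupportedInside L ρ fun x => inner ℝ a (w x) := fun x hx =>
  hw x fun hc => hx (by simp [hc])

theorem lipschitzWith_inner_testField {B ρ : ℝ} {w : Vec d → Vec d} (hw : IsTestField L B ρ w)
    (a : Vec d) : LipschitzWith (‖a‖ * B).toNNReal fun x => inner ℝ a (w x) := by
  refine LipschitzWith.of_dist_le_mul fun x y => ?_
  rw [Real.coe_toNNReal _ (mul_nonneg (norm_nonneg _) hw.bound_nonneg), Real.dist_eq, dist_eq_norm,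
    ← inner_sub_right, mul_assoc]
  exact (abs_real_inner_le_norm _ _).trans
    (mul_le_mul_of_nonneg_left (hw.norm_sub_le x y) (norm_nonneg _))

theorem setIntegral_inner_gradient_inner_smul (hlip : ∀ i, LipschitzWith K (M.phi i)) (i : M.Node)
    {B ρ : ℝ} {w : Vec d → Vec d} (hw : IsTestField L B ρ w) (a b : Vec d) :
    ∫ x in box L, inner ℝ (gradient (M.phi i) x) (inner ℝ b (w x) • a) =
      -∫ x in box L, M.phi i x * inner ℝ b (fderiv ℝ w x a) := by
  have hwd : Differentiable ℝ w := hw.contDiff.differentiable one_ne_zero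
  have hd : Differentiable ℝ fun x => inner ℝ b (w x) := (differentiable_const b).inner ℝ hwd
  rw [setIntegral_inner_gradient_smul hlip i hw.pos hd (lipschitzWith_inner_testField hw b)
    (SupportedInside.comp_inner hw.supp b)]
  congr 1
  refine integral_congr_ae (ae_of_all _ fun x => ?_)
  have e := ((hasFDerivAt_const b x).inner ℝ (hwd x).hasFDerivAt).fderiv
  simp only [e]
  simp

/-- Divergence-free test fields are orthogonal to the gradients of the basis functions. -/
theorem setIntegral_inner_gradient_testField (hL : ∀ k, 0 < L k)
    (hlip : ∀ i, LipschitzWith K (M.phi i)) (i : M.Node) {B ρ : ℝ} {w : Vec d → Vec d}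
    (hw : IsTestField L B ρ w) (hdiv : ∀ x ∈ box L, divergence w x = 0) :
    ∫ x in box L, inner ℝ (gradient (M.phi i) x) (w x) = 0 := by
  set e : Fin d → Vec d := fun k => EuclideanSpace.single k 1 with he
  have hsum : ∀ y : Vec d, ∑ k, (inner ℝ (e k) y) • e k = y := by
    intro y
    have := (EuclideanSpace.basisFun (Fin d) ℝ).sum_repr' y
    simpa [he] using this
  have h1 : ∀ x, inner ℝ (gradient (M.phi i) x) (w x) =
      ∑ k, inner ℝ (gradient (M.phi i) x) (inner ℝ (e k) (w x) • e k) := fun x => by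
    rw [← inner_sum, hsum]
  have hwc : Continuous w := hw.contDiff.continuous
  have hwd : Continuous (fderiv ℝ w) := hw.contDiff.continuous_fderiv one_ne_zero
  have hphi := M.continuous_phi hL i
  simp only [h1]
  rw [integral_finsetSum _ fun k _ => integrableOn_inner_gradient_continuous hlip i (by fun_prop)]
  simp only [setIntegral_inner_gradient_inner_smul hlip i hw]
  rw [Finset.sum_neg_distrib, ← integral_finsetSum _ fun k _ =>
    integrableOn_box_of_continuous (by fun_prop), neg_eq_zero]
  refine integral_eq_zero_of_ae ((ae_restrict_iff' (measurableSet_box L)).2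
    (ae_of_all _ fun x hx => ?_))
  have h2 := hdiv x hx
  rw [divergence] at h2
  have h3 : ∑ k, inner ℝ (e k) (fderiv ℝ w x (e k)) = 0 := by
    rw [← h2]
    exact Finset.sum_congr rfl fun k _ => by
      rw [he, EuclideanSpace.inner_single_left, map_one, one_mul]
  simp only [← Finset.mul_sum, h3, mul_zero, Pi.zero_apply]

end PeriodicMesh
end PeriodicFEM

namespace PeriodicFEM
namespace PeriodicMesh

variable {d : ℕ} {L : Fin d → ℝ} {M : PeriodicMesh L}
variable {ν ω T C : ℝ} {D : ℝ → M.Node → M.Node → ℝ} {u : ℝ → M.Node → Vec d}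
  {p : ℝ → M.Node → ℝ} {K B ρ : ℝ}

/-! ### Consistency at a fixed time -/

/-- The pressure stabilization tested with nodal values whose jumps are controlled. -/
theorem IsRegular.abs_dotProduct_presStabLin_le (hK : M.IsRegular K) (hL : ∀ k, 0 < L k)
    (hω : 0 ≤ ω) {q r : M.Node → ℝ} (hr : ∀ i, |r i| ≤ C) {G : M.Node → M.Node → ℝ}
    (hq : ∀ i, ∀ j ∈ (M.nbr i).erase i, |q j - q i| ≤ G i j) :
    |q ⬝ᵥ M.presStabLin ω r| ≤
      ω * K * M.h ^ d * C * ∑ i, ∑ j ∈ (M.nbr i).erase i, G i j := by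
  rw [M.dotProduct_presStabLin, abs_mul]
  have h : |∑ i, ∑ j ∈ (M.nbr i).erase i, ω * M.mass i j * ((q j - q i) * (r j - r i))| ≤
      ∑ i, ∑ j ∈ (M.nbr i).erase i, 2 * (ω * K * M.h ^ d * C) * G i j := by
    refine M.abs_sum_erase_le fun i j hj => ?_
    have h1 := hq i j hj
    have h2 : |r j - r i| ≤ 2 * C := by
      have := abs_sub (r j) (r i)
      have h3 := hr i
      have h4 := hr j
      linarith
    have h3 : ω * M.mass i j ≤ ω * (K * M.h ^ d) := mul_le_mul_of_nonneg_left (hK.mass_le hL i j) hω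
    rw [abs_mul, abs_of_nonneg (mul_nonneg hω (M.mass_nonneg i j)), abs_mul]
    calc ω * M.mass i j * (|q j - q i| * |r j - r i|) ≤ ω * (K * M.h ^ d) * (G i j * (2 * C)) := by
          refine mul_le_mul h3 (mul_le_mul h1 h2 (abs_nonneg _) ((abs_nonneg _).trans h1))
            (by positivity) ?_
          have := hK.const_pos
          have := hK.h_pos
          positivity
      _ = _ := by ring
  simp only [← Finset.mul_sum] at h
  rw [show |(-(1 / 2) : ℝ)| = 1 / 2 by norm_num]
  linarith

theorem IsRegular.antisymm (hK : M.IsRegular K) (hL : ∀ k, 0 < L k) (i j : M.Node) :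
    M.grad i j = -M.grad j i :=
  grad_antisymm hL hK.lipschitzWith i j

/-- The interpolant of a divergence-free test field is almost discretely divergence-free. -/
theorem IsRegular.abs_discDiv_le (hK : M.IsRegular K) (hL : ∀ k, 0 < L k) {w : Vec d → Vec d}
    (hw : IsTestField L B ρ w) (hdiv : ∀ x ∈ box L, divergence w x = 0) (hh : M.h < ρ)
    (j : M.Node) : |M.discDiv (fun i => w i.1) j| ≤ B * K ^ 2 * M.h * M.h ^ d := by
  have hlip := hK.lipschitzWith
  have hB := hw.bound_nonneg
  have hhp := hK.h_pos
  have hKp := hK.const_pos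
  have e : M.discDiv (fun i => w i.1) j =
      -∫ x in box L, inner ℝ (gradient (M.phi j) x) (M.fe (fun i => w i.1) x - w x) := by
    have h1 : M.discDiv (fun i => w i.1) j = -∑ i, inner ℝ (M.grad i j) (w i.1) := by
      rw [discDiv, ← Finset.sum_neg_distrib]
      exact Finset.sum_congr rfl fun i _ => by rw [hK.antisymm hL j i, inner_neg_left]
    have h2 : ∑ i, inner ℝ (M.grad i j) (w i.1) =
        ∫ x in box L, inner ℝ (gradient (M.phi j) x) (M.fe (fun i => w i.1) x) := by
      simp only [inner_grad hL hlip]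
      rw [← integral_finsetSum _ fun i _ => integrableOn_phi_mul_inner_gradient hL hlip i j _]
      refine integral_congr_ae (ae_of_all _ fun x => ?_)
      simp only [fe, inner_sum, real_inner_smul_right]
    simp only [inner_sub_right]
    rw [h1, h2, integral_sub (integrableOn_inner_gradient_continuous hlip j (continuous_fe hL _))
      (integrableOn_inner_gradient_continuous hlip j hw.contDiff.continuous),
      setIntegral_inner_gradient_testField hL hlip j hw hdiv, sub_zero]
  rw [e, abs_neg, ← Real.norm_eq_abs]
  refine (hK.norm_setIntegral_le j (B := K / M.h * (B * M.h ^ 2)) (fun x hx => ?_)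
    (fun x _ h => by rw [gradient_phi_eq_zero h, inner_zero_left]) (by positivity)).trans
    (le_of_eq ?_)
  · exact (norm_inner_le_norm _ _).trans (mul_le_mul (hK.norm_gradient_le j x)
      (norm_interpolation_sub_le hL hw hh (box_subset_cellBox hx)) (norm_nonneg _) (by positivity))
  · field_simp

/-- Replacing a test field by its interpolant in the weak convective term. -/
theorem IsRegular.abs_convection_sub_le (hK : M.IsRegular K) (hL : ∀ k, 0 < L k)
    {w : Vec d → Vec d} (hw : IsTestField L B ρ w) (hh : M.h < ρ) {c : M.Node → Vec d}
    (hc : ∀ i, ‖c i‖ ≤ C) :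
    |∑ i, ∑ j, inner ℝ (M.grad i j) (c i) * inner ℝ (c i) (w j.1) -
      ∑ i, ∫ x in box L, M.phi i x * inner ℝ (c i) (fderiv ℝ w x (c i))| ≤
      C ^ 2 * B * K ^ 3 * volume.real (box L) * M.h := by
  have hlip := hK.lipschitzWith
  have hB := hw.bound_nonneg
  have hhp := hK.h_pos
  have hKp := hK.const_pos
  have hwc : Continuous w := hw.contDiff.continuous
  have e : ∀ i, ∑ j, inner ℝ (M.grad i j) (c i) * inner ℝ (c i) (w j.1) -
      ∫ x in box L, M.phi i x * inner ℝ (c i) (fderiv ℝ w x (c i)) =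
      -∫ x in box L, inner ℝ (gradient (M.phi i) x)
        (inner ℝ (c i) (M.fe (fun j => w j.1) x - w x) • c i) := by
    intro i
    have h1 := setIntegral_inner_gradient_inner_smul hlip i hw (c i) (c i)
    have h2 : ∑ j, inner ℝ (M.grad i j) (c i) * inner ℝ (c i) (w j.1) =
        -∫ x in box L, inner ℝ (gradient (M.phi i) x)
          (inner ℝ (c i) (M.fe (fun j => w j.1) x) • c i) := by
      have h3 : ∀ j, inner ℝ (M.grad i j) (c i) * inner ℝ (c i) (w j.1) =
          -∫ x in box L, M.phi j x * inner ℝ (gradient (M.phi i) x) (c i) *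
            inner ℝ (c i) (w j.1) := fun j => by
        rw [hK.antisymm hL i j, inner_neg_left, inner_grad hL hlip, integral_mul_const, neg_mul]
      simp only [h3]
      rw [Finset.sum_neg_distrib, ← integral_finsetSum _ fun j _ =>
        (integrableOn_phi_mul_inner_gradient hL hlip j i _).mul_const _]
      congr 1
      refine integral_congr_ae (ae_of_all _ fun x => ?_)
      simp only [fe, inner_sum, real_inner_smul_right, Finset.sum_mul]
      exact Finset.sum_congr rfl fun j _ => by ring
    have hfe := continuous_fe (M := M) hL fun j => w j.1
    simp only [inner_sub_right, sub_smul]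
    rw [integral_sub (integrableOn_inner_gradient_continuous hlip i (by fun_prop))
      (integrableOn_inner_gradient_continuous hlip i (by fun_prop)), h1, h2]
    ring
  rw [← Finset.sum_sub_distrib]
  simp only [e]
  have hone : ∀ i, |-∫ x in box L, inner ℝ (gradient (M.phi i) x)
        (inner ℝ (c i) (M.fe (fun j => w j.1) x - w x) • c i)| ≤
      C ^ 2 * B * K ^ 2 * M.h * M.h ^ d := by
    intro i
    have hC : 0 ≤ C := (norm_nonneg _).trans (hc i)
    rw [abs_neg, ← Real.norm_eq_abs]
    refine (hK.norm_setIntegral_le i (B := K / M.h * (C * (B * M.h ^ 2) * C)) (fun x hx => ?_)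
      (fun x _ h => by rw [gradient_phi_eq_zero h, inner_zero_left]) (by positivity)).trans
      (le_of_eq ?_)
    · refine (norm_inner_le_norm _ _).trans (mul_le_mul (hK.norm_gradient_le i x) ?_
        (norm_nonneg _) (by positivity))
      rw [norm_smul]
      refine mul_le_mul ((norm_inner_le_norm _ _).trans (mul_le_mul (hc i)
        (norm_interpolation_sub_le hL hw hh (box_subset_cellBox hx)) (norm_nonneg _) hC)) (hc i)
        (norm_nonneg _) (by positivity)
    · field_simp
  refine (Finset.abs_sum_le_sum_abs _ _).trans ((Finset.sum_le_sum fun i _ => hone i).trans ?_)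
  rw [Finset.sum_const, nsmul_eq_mul, Finset.card_univ]
  have h1 := mul_le_mul_of_nonneg_left (hK.card_node_mul_le hL)
    (show 0 ≤ C ^ 2 * B * K ^ 2 * M.h by positivity)
  calc (Fintype.card M.Node : ℝ) * (C ^ 2 * B * K ^ 2 * M.h * M.h ^ d) =
      C ^ 2 * B * K ^ 2 * M.h * (Fintype.card M.Node * M.h ^ d) := by ring
    _ ≤ _ := h1
    _ = _ := by ring

/-- Interpolating the product `u_h ⊗ u_h` instead of its factors changes the weak convective term by
at most a multiple of the jumps. -/
theorem IsRegular.abs_convection_sub_exact_le (hK : M.IsRegular K) (hL : ∀ k, 0 < L k)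
    {w : Vec d → Vec d} (hw : IsTestField L B ρ w) {c : M.Node → Vec d} (hC : 0 ≤ C)
    (hc : ∀ i, ‖c i‖ ≤ C) :
    |(∑ i, ∫ x in box L, M.phi i x * inner ℝ (c i) (fderiv ℝ w x (c i))) -
      ∫ x in box L, inner ℝ (fderiv ℝ w x (M.fe c x)) (M.fe c x)| ≤
      2 * B * C * K * (M.h ^ d * M.jump c) := by
  have hB := hw.bound_nonneg
  have hwd : Continuous (fderiv ℝ w) := hw.contDiff.continuous_fderiv one_ne_zero
  have hphi := M.continuous_phi hL
  have hfe := continuous_fe (M := M) hL c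
  have hint : ∀ i, IntegrableOn (fun x => M.phi i x * inner ℝ (c i) (fderiv ℝ w x (c i)))
      (box L) := fun i => by
    have := hphi i
    exact integrableOn_box_of_continuous (by fun_prop)
  rw [← integral_finsetSum _ fun i _ => hint i,
    ← integral_sub (integrable_finsetSum _ fun i _ => hint i)
      (integrableOn_box_of_continuous (by fun_prop))]
  have hpt : ∀ x, ‖∑ i, M.phi i x * inner ℝ (c i) (fderiv ℝ w x (c i)) -
      inner ℝ (fderiv ℝ w x (M.fe c x)) (M.fe c x)‖ ≤
      ∑ i, ∑ j, 2 * B * C * ‖c j - c i‖ * (M.phi i x * M.phi j x) := by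
    intro x
    set A := fderiv ℝ w x with hA
    set U := M.fe c x with hU
    have hU' : ‖U‖ ≤ C := norm_fe_le hL hc x
    have e : ∑ i, M.phi i x * inner ℝ (c i) (A (c i)) - inner ℝ (A U) U =
        ∑ i, M.phi i x * (inner ℝ (c i - U) (A (c i)) + inner ℝ U (A (c i - U))) := by
      have h0 : inner ℝ (A U) U = ∑ i, M.phi i x * inner ℝ U (A U) := by
        rw [← Finset.sum_mul, M.sum_phi hL, one_mul, real_inner_comm]
      rw [h0, ← Finset.sum_sub_distrib]
      refine Finset.sum_congr rfl fun i _ => ?_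
      simp only [map_sub, inner_sub_left, inner_sub_right]
      ring
    rw [e]
    refine (norm_sum_le _ _).trans (Finset.sum_le_sum fun i _ => ?_)
    rw [norm_mul, Real.norm_of_nonneg (M.phi_nonneg i x)]
    have h1 : ‖inner ℝ (c i - U) (A (c i)) + inner ℝ U (A (c i - U))‖ ≤ 2 * B * C * ‖c i - U‖ := by
      refine (norm_add_le _ _).trans ?_
      have hAB : ‖A‖ ≤ B := hw.norm_fderiv_le x
      have h2 : ‖inner ℝ (c i - U) (A (c i))‖ ≤ ‖c i - U‖ * (B * C) :=
        (norm_inner_le_norm _ _).trans (mul_le_mul_of_nonneg_left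
          ((A.le_opNorm _).trans (mul_le_mul hAB (hc i) (norm_nonneg _) hB)) (norm_nonneg _))
      have h3 : ‖inner ℝ U (A (c i - U))‖ ≤ C * (B * ‖c i - U‖) :=
        (norm_inner_le_norm _ _).trans (mul_le_mul hU'
          ((A.le_opNorm _).trans (mul_le_mul_of_nonneg_right hAB (norm_nonneg _)))
          (norm_nonneg _) hC)
      linarith
    have h4 := norm_sub_fe_le (M := M) hL c i x
    calc M.phi i x * _ ≤ M.phi i x * (2 * B * C * ∑ j, M.phi j x * ‖c j - c i‖) :=
          mul_le_mul_of_nonneg_left (h1.trans (mul_le_mul_of_nonneg_left h4 (by positivity)))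
            (M.phi_nonneg i x)
      _ = _ := by
        rw [Finset.mul_sum, Finset.mul_sum]
        exact Finset.sum_congr rfl fun j _ => by ring
  have hint2 : ∀ i j, IntegrableOn (fun x => 2 * B * C * ‖c j - c i‖ * (M.phi i x * M.phi j x))
      (box L) := fun i j => integrableOn_box_of_continuous
        (continuous_const.mul ((hphi i).mul (hphi j)))
  refine (norm_integral_le_of_norm_le (integrable_finsetSum _ fun i _ =>
    integrable_finsetSum _ fun j _ => hint2 i j) (ae_of_all _ hpt)).trans ?_
  rw [integral_finsetSum _ fun i _ => integrable_finsetSum _ fun j _ => hint2 i j]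
  simp_rw [integral_finsetSum _ fun j _ => hint2 _ j, integral_const_mul]
  have e2 : ∑ i, ∑ j, 2 * B * C * ‖c j - c i‖ * ∫ x in box L, M.phi i x * M.phi j x =
      ∑ i, ∑ j ∈ (M.nbr i).erase i, 2 * B * C * ‖c j - c i‖ * M.mass i j :=
    M.sum_univ_eq_sum_erase (F := fun i j => 2 * B * C * ‖c j - c i‖ * M.mass i j)
      (fun i => by simp) (fun i j hj => by rw [M.mass_eq_zero hj, mul_zero])
  rw [e2, show 2 * B * C * K * (M.h ^ d * M.jump c) = 2 * B * C * K * M.h ^ d * M.jump c by ring,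
    ← M.sum_erase_mul_norm]
  refine Finset.sum_le_sum fun i _ => Finset.sum_le_sum fun j _ => ?_
  have h1 := mul_le_mul_of_nonneg_left (hK.mass_le hL i j)
    (show 0 ≤ 2 * B * C * ‖c j - c i‖ by positivity)
  linarith

/-- The artificial viscosity tested with the interpolant of a test field. -/
theorem IsBoundedSolution.abs_laplacian_le (hs : M.IsBoundedSolution ν ω T C D u p) (hd : 0 < d)
    (hL : ∀ k, 0 < L k) (hh0 : 0 < M.h) {w : Vec d → Vec d} (hw : IsTestField L B ρ w)
    (hh : M.h < ρ) {t : ℝ} (ht : t ∈ Ioo 0 T) :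
    |∑ i, ∑ j, D t i j * inner ℝ (u t j) (w i.1)| ≤ C * B * (M.h ^ d * M.jump (u t)) := by
  have hC := hs.const_nonneg
  have hB := hw.bound_nonneg
  rw [hs.sum_laplacian_mul_inner ht fun i => w i.1, abs_mul]
  have h : |∑ i, ∑ j ∈ (M.nbr i).erase i,
      D t i j * inner ℝ (w j.1 - w i.1) (u t j - u t i)| ≤
      ∑ i, ∑ j ∈ (M.nbr i).erase i, 2 * (C * B * M.h ^ d) * ‖u t j - u t i‖ := by
    refine M.abs_sum_erase_le fun i j hj => ?_
    have hji := Finset.ne_of_mem_erase hj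
    rw [abs_mul, abs_of_nonneg ((hs.laplacian t ht).nonneg i j hji)]
    have h1 := norm_node_sub_node_le hL hw.supp hB hw.norm_sub_le hh (Finset.mem_of_mem_erase hj)
    have e : M.h ^ d = M.h ^ (d - 1) * M.h := by rw [← pow_succ, Nat.sub_add_cancel hd]
    calc D t i j * |inner ℝ (w j.1 - w i.1) (u t j - u t i)|
        ≤ C * M.h ^ (d - 1) * (2 * B * M.h * ‖u t j - u t i‖) := by
          refine mul_le_mul (hs.laplacian_le t ht i j hji) ((abs_real_inner_le_norm _ _).trans
            (mul_le_mul_of_nonneg_right h1 (norm_nonneg _))) (abs_nonneg _) (by positivity)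
      _ = _ := by rw [e]; ring
  rw [M.sum_erase_mul_norm] at h
  rw [show |(-(1 / 2) : ℝ)| = 1 / 2 by norm_num]
  linarith

/-- The nodal values of a test field in place of its averages in the discrete time derivative. -/
theorem abs_sum_inner_average_sub_le (hL : ∀ k, 0 < L k) {w : Vec d → Vec d}
    (hw : IsTestField L B ρ w) (hh : M.h < ρ) (c : M.Node → Vec d) :
    |∑ i, inner ℝ (c i) (∫ x in box L, M.phi i x • w x) -
      ∑ i, M.lump i * inner ℝ (c i) (w i.1)| ≤ B * M.h * ∑ i, M.lump i * ‖c i‖ := by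
  rw [← Finset.sum_sub_distrib, Finset.mul_sum]
  refine (Finset.abs_sum_le_sum_abs _ _).trans (Finset.sum_le_sum fun i _ => ?_)
  have hphi := M.continuous_phi hL i
  have hwc := hw.contDiff.continuous
  have e : (∫ x in box L, M.phi i x • w x) - M.lump i • w i.1 =
      ∫ x in box L, M.phi i x • (w x - w i.1) := by
    simp only [smul_sub]
    rw [integral_sub (integrableOn_box_of_continuous (by fun_prop))
      (integrableOn_box_of_continuous (by fun_prop)), integral_smul_const]
    rfl
  have h1 : ‖∫ x in box L, M.phi i x • (w x - w i.1)‖ ≤ M.lump i * (B * M.h) := by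
    rw [lump, ← integral_mul_const]
    refine norm_integral_le_of_norm_le (integrableOn_box_of_continuous (by fun_prop))
      ((ae_restrict_iff' (measurableSet_box L)).2 (ae_of_all _ fun x hx => ?_))
    rw [norm_smul, Real.norm_of_nonneg (M.phi_nonneg i x)]
    by_cases h0 : M.phi i x = 0
    · simp [h0]
    · exact mul_le_mul_of_nonneg_left (norm_sub_node_le hL hw.supp hw.bound_nonneg hw.norm_sub_le hh
        (box_subset_cellBox hx) h0) (M.phi_nonneg i x)
  rw [← real_inner_smul_right, ← inner_sub_right, e]
  refine (abs_real_inner_le_norm _ _).trans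
    ((mul_le_mul_of_nonneg_left h1 (norm_nonneg _)).trans (le_of_eq ?_))
  ring

/-- The consistency error of the momentum equation at a fixed time, for nodal velocities `c` with
time derivatives `c'`. -/
def momentumResidual (M : PeriodicMesh L) (c c' : M.Node → Vec d) (w : Vec d → Vec d) : ℝ :=
  ∑ i, inner ℝ (c' i) (∫ x in box L, M.phi i x • w x) -
    ∫ x in box L, inner ℝ (fderiv ℝ w x (M.fe c x)) (M.fe c x)

/-- The momentum residual is bounded by the mesh size, by the velocity jumps, by the discrete time
derivative and by the viscous term. -/
theorem IsBoundedSolution.abs_momentumResidual_le (hs : M.IsBoundedSolution ν ω T C D u p)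
    (hd : 0 < d) (hL : ∀ k, 0 < L k) (hω : 0 ≤ ω) (hK : M.IsRegular K) {w : Vec d → Vec d}
    (hw : IsTestField L B ρ w) (hdiv : ∀ x ∈ box L, divergence w x = 0) (hh : M.h < ρ) {t : ℝ}
    (ht : t ∈ Ioo 0 T) :
    |M.momentumResidual (u t) (fun i => deriv (fun s => u s i) t) w| ≤
      B * (M.h * ∑ i, M.lump i * ‖deriv (fun s => u s i) t‖) +
      (C * B + K ^ 2 * C * B + ω * K * C * B + 2 * B * C * K) * (M.h ^ d * M.jump (u t)) +
      ((C + C ^ 2) * B * K ^ 3 + ω * K ^ 2 * C ^ 2 * B) * volume.real (box L) * M.h +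
      ν * |M.stiffForm (fun i => w i.1) (u t)| := by
  have hlip := hK.lipschitzWith
  have hanti := hK.antisymm hL
  have hrow := sum_grad hL hlip
  have hC := hs.const_nonneg
  have hB := hw.bound_nonneg
  have hhp := hK.h_pos
  have hKp := hK.const_pos
  set Ω := volume.real (box L) with hΩ
  have hu := hs.norm_le t ht
  have hp := hs.abs_le t ht
  have h1 := abs_sum_inner_average_sub_le hL hw hh fun i => deriv (fun s => u s i) t
  have h2 := hs.sum_lump_mul_inner hanti ht fun i => w i.1
  have h3 := hs.abs_laplacian_le hd hL hhp hw hh ht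
  have h4 : |p t ⬝ᵥ M.discDiv fun i => w i.1| ≤ C * B * K ^ 3 * Ω * M.h := by
    have h5 : |p t ⬝ᵥ M.discDiv fun i => w i.1| ≤
        ∑ _j : M.Node, C * (B * K ^ 2 * M.h * M.h ^ d) := by
      refine (Finset.abs_sum_le_sum_abs _ _).trans (Finset.sum_le_sum fun j _ => ?_)
      rw [abs_mul]
      exact mul_le_mul (hp j) (hK.abs_discDiv_le hL hw hdiv hh j) (abs_nonneg _) hC
    rw [Finset.sum_const, nsmul_eq_mul, Finset.card_univ] at h5
    have h6 := mul_le_mul_of_nonneg_left (hK.card_node_mul_le hL)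
      (show 0 ≤ C * B * K ^ 2 * M.h by positivity)
    refine h5.trans (le_trans (le_of_eq ?_) (h6.trans (le_of_eq ?_))) <;> ring
  -- the divergence term in the skew-symmetric form
  have h7 : |∑ i, ∑ j, inner ℝ (M.grad i j) (u t j) * inner ℝ (u t i) (w i.1)| ≤
      ω * K * C * B * (M.h ^ d * M.jump (u t)) + 2 * (ω * K ^ 2 * C ^ 2 * B) * Ω * M.h := by
    have e : ∑ i, ∑ j, inner ℝ (M.grad i j) (u t j) * inner ℝ (u t i) (w i.1) =
        (fun i => inner ℝ (u t i) (w i.1)) ⬝ᵥ M.presStabLin ω (p t) := by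
      rw [hs.presStabLin_eq ht]
      refine Finset.sum_congr rfl fun i _ => ?_
      rw [← Finset.sum_mul, mul_comm]
      rfl
    rw [e]
    refine (hK.abs_dotProduct_presStabLin_le hL hω hp
      (G := fun i j => B * ‖u t j - u t i‖ + 2 * C * B * M.h) fun i j hj => ?_).trans ?_
    · have h8 := norm_node_sub_node_le hL hw.supp hB hw.norm_sub_le hh (Finset.mem_of_mem_erase hj)
      have e2 : inner ℝ (u t j) (w j.1) - inner ℝ (u t i) (w i.1) =
          inner ℝ (u t j - u t i) (w j.1) + inner ℝ (u t i) (w j.1 - w i.1) := by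
        simp only [inner_sub_left, inner_sub_right]
        ring
      simp only [e2]
      refine (abs_add_le _ _).trans ?_
      have h9 := (abs_real_inner_le_norm (u t j - u t i) (w j.1)).trans
        (mul_le_mul_of_nonneg_left (hw.norm_le j.1) (norm_nonneg _))
      have h10 := (abs_real_inner_le_norm (u t i) (w j.1 - w i.1)).trans
        (mul_le_mul (hu i) h8 (norm_nonneg _) hC)
      linarith
    · simp only [Finset.sum_add_distrib, M.sum_erase_const, M.sum_erase_mul_norm]
      have h11 := mul_le_mul_of_nonneg_left (hK.numPairs_mul_le hL)
        (show 0 ≤ ω * K * C * (2 * C * B * M.h) by positivity)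
      linarith
  -- the remainder of third order in the jumps
  have h12 : |1 / 4 * ∑ i, ∑ j, inner ℝ (M.grad i j) (u t j - u t i) *
      inner ℝ (u t j - u t i) (w j.1 - w i.1)| ≤ K ^ 2 * C * B * (M.h ^ d * M.jump (u t)) := by
    rw [M.sum_univ_eq_sum_erase (F := fun i j => inner ℝ (M.grad i j) (u t j - u t i) *
      inner ℝ (u t j - u t i) (w j.1 - w i.1)) (fun i => by simp)
      (fun i j hj => by rw [M.grad_eq_zero hj, inner_zero_left, zero_mul]), abs_mul]
    have h13 : |∑ i, ∑ j ∈ (M.nbr i).erase i, inner ℝ (M.grad i j) (u t j - u t i) *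
      inner ℝ (u t j - u t i) (w j.1 - w i.1)| ≤ ∑ i, ∑ j ∈ (M.nbr i).erase i,
        4 * (K ^ 2 * C * B * M.h ^ d) * ‖u t j - u t i‖ := by
      refine M.abs_sum_erase_le fun i j hj => ?_
      have h8 := norm_node_sub_node_le hL hw.supp hB hw.norm_sub_le hh (Finset.mem_of_mem_erase hj)
      have h14 : ‖u t j - u t i‖ ≤ 2 * C := by
        have := norm_sub_le (u t j) (u t i)
        have := hu i
        have := hu j
        linarith
      have h15 := (abs_real_inner_le_norm (M.grad i j) (u t j - u t i)).trans
        (mul_le_mul (hK.norm_grad_le hL i j) h14 (norm_nonneg _) (by positivity))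
      have h16 := (abs_real_inner_le_norm (u t j - u t i) (w j.1 - w i.1)).trans
        (mul_le_mul_of_nonneg_left h8 (norm_nonneg _))
      rw [abs_mul]
      refine (mul_le_mul h15 h16 (abs_nonneg _) (by positivity)).trans (le_of_eq ?_)
      field_simp
      ring
    rw [M.sum_erase_mul_norm] at h13
    rw [show |(1 / 4 : ℝ)| = 1 / 4 by norm_num]
    linarith
  have h17 := sum_conv_add_eq hanti hrow (u t) fun i => w i.1
  rw [← h17] at h12
  have h18 := hK.abs_convection_sub_le hL hw hh hu
  have h19 := hK.abs_convection_sub_exact_le hL hw hC hu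
  have h20 : |ν * M.stiffForm (fun i => w i.1) (u t)| =
      ν * |M.stiffForm (fun i => w i.1) (u t)| := by
    rw [abs_mul, abs_of_nonneg hs.visc_nonneg]
  rw [← h20, momentumResidual]
  simp only [conv] at h2
  rw [_root_.abs_le] at h1 h3 h4 h7 h12 h18 h19
  have h21 := neg_abs_le (ν * M.stiffForm (fun i => w i.1) (u t))
  have h22 := le_abs_self (ν * M.stiffForm (fun i => w i.1) (u t))
  have h23 : 0 ≤ ω * K * C * B * (M.h ^ d * M.jump (u t)) := by
    have := M.jump_nonneg (u t)
    positivity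
  rw [_root_.abs_le]
  constructor
  · linarith [h1.1, h3.1, h4.1, h7.2, h7.1, h12.1, h12.2, h18.1, h19.1]
  · linarith [h1.2, h3.2, h4.2, h7.2, h7.1, h12.1, h12.2, h18.2, h19.2]

/-- The divergence error at a fixed time. After integration by parts, `q` is split on the support of
each basis function into its nodal value, which yields the discrete divergence and hence by the
continuity equation the pressure stabilization, and a remainder of order `h`, which is paired with
differences of nodal velocities because the gradients of the basis functions add up to zero. -/
theorem IsBoundedSolution.abs_divError_le (hs : M.IsBoundedSolution ν ω T C D u p)
    (hL : ∀ k, 0 < L k) (hω : 0 ≤ ω) (hK : M.IsRegular K) {q : Vec d → ℝ} (hq : ContDiff ℝ 1 q)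
    (hρ : 0 < ρ) (hsupp : SupportedInside L ρ q) (hB : 0 ≤ B)
    (hlipq : ∀ x y, ‖q x - q y‖ ≤ B * ‖x - y‖) (hh : M.h < ρ) {t : ℝ} (ht : t ∈ Ioo 0 T) :
    |M.divError (u t) q| ≤ B * K ^ 2 * (M.h ^ d * M.jump (u t)) +
      2 * ω * K ^ 2 * C * B * volume.real (box L) * M.h := by
  have hlip := hK.lipschitzWith
  have hC := hs.const_nonneg
  have hhp := hK.h_pos
  have hKp := hK.const_pos
  have hqc := hq.continuous
  have hqd : Differentiable ℝ q := hq.differentiable one_ne_zero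
  have hqf : Continuous (fderiv ℝ q) := hq.continuous_fderiv one_ne_zero
  have hphi := M.continuous_phi hL
  have hqL : LipschitzWith B.toNNReal q := LipschitzWith.of_dist_le_mul fun x y => by
    rw [Real.coe_toNNReal _ hB, dist_eq_norm, dist_eq_norm]
    exact hlipq x y
  set c := u t with hc
  have hI1 : ∀ j, IntegrableOn (fun x => inner ℝ (gradient (M.phi j) x) (q x • c j)) (box L) :=
    fun j => integrableOn_inner_gradient_continuous hlip j (by fun_prop)
  have hI2 : ∀ k j, IntegrableOn
      (fun x => q k.1 * (M.phi k x * inner ℝ (gradient (M.phi j) x) (c j)))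
      (box L) := fun k j => (integrableOn_phi_mul_inner_gradient hL hlip k j (c j)).const_mul _
  have hI3 : ∀ k j, IntegrableOn (fun x => inner ℝ (gradient (M.phi j) x)
      ((M.phi k x * (q x - q k.1)) • (c j - c k))) (box L) := fun k j => by
    have := hphi k
    exact integrableOn_inner_gradient_continuous hlip j (by fun_prop)
  have e1 : M.divError c q = -∑ j, ∫ x in box L, inner ℝ (gradient (M.phi j) x) (q x • c j) := by
    simp only [setIntegral_inner_gradient_smul hlip _ hρ hqd hqL hsupp]
    rw [Finset.sum_neg_distrib, neg_neg, ← integral_finsetSum]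
    · refine integral_congr_ae (ae_of_all _ fun x => ?_)
      simp only [fe, sum_inner, real_inner_smul_left]
      exact Finset.sum_congr rfl fun j _ => by rw [real_inner_comm, inner_gradient_left]
    · intro j _
      have := hphi j
      exact integrableOn_box_of_continuous (by fun_prop)
  have e2 : ∑ j, ∫ x in box L, inner ℝ (gradient (M.phi j) x) (q x • c j) =
      (fun k => q k.1) ⬝ᵥ M.discDiv c + ∑ k, ∑ j, ∫ x in box L, inner ℝ (gradient (M.phi j) x)
        ((M.phi k x * (q x - q k.1)) • (c j - c k)) := by
    have h1 : (fun k => q k.1) ⬝ᵥ M.discDiv c =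
        ∑ k, ∑ j, ∫ x in box L, q k.1 * (M.phi k x * inner ℝ (gradient (M.phi j) x) (c j)) := by
      simp only [dotProduct, discDiv, Finset.mul_sum, inner_grad hL hlip, integral_const_mul]
    rw [h1]
    simp_rw [← integral_finsetSum _ fun j _ => hI2 _ j, ← integral_finsetSum _ fun j _ => hI3 _ j]
    rw [← integral_finsetSum _ fun j _ => hI1 j,
      ← integral_finsetSum _ fun k _ => integrable_finsetSum _ fun j _ => hI2 k j,
      ← integral_finsetSum _ fun k _ => integrable_finsetSum _ fun j _ => hI3 k j,
      ← integral_add (integrable_finsetSum _ fun k _ => integrable_finsetSum _ fun j _ => hI2 k j)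
        (integrable_finsetSum _ fun k _ => integrable_finsetSum _ fun j _ => hI3 k j)]
    refine integral_congr_ae (ae_restrict_of_ae ?_)
    filter_upwards [ae_sum_gradient_phi hL hlip] with x hx
    have h2 : ∀ k, ∑ j, inner ℝ (gradient (M.phi j) x) ((M.phi k x * (q x - q k.1)) • c k) = 0 :=
      fun k => by rw [← sum_inner, hx, inner_zero_left]
    have h3 : ∀ k, ∑ j, q k.1 * (M.phi k x * inner ℝ (gradient (M.phi j) x) (c j)) +
        ∑ j, inner ℝ (gradient (M.phi j) x) ((M.phi k x * (q x - q k.1)) • (c j - c k)) =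
        M.phi k x * ∑ j, inner ℝ (gradient (M.phi j) x) (q x • c j) := by
      intro k
      simp only [smul_sub, inner_sub_right, Finset.sum_sub_distrib, h2, sub_zero]
      rw [← Finset.sum_add_distrib, Finset.mul_sum]
      refine Finset.sum_congr rfl fun j _ => ?_
      simp only [real_inner_smul_right]
      ring
    rw [← Finset.sum_add_distrib]
    simp only [h3]
    rw [← Finset.sum_mul, M.sum_phi hL, one_mul]
  have h4 : |(fun k => q k.1) ⬝ᵥ M.discDiv c| ≤
      2 * ω * K ^ 2 * C * B * volume.real (box L) * M.h := by
    rw [hc, ← hs.presStabLin_eq ht]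
    refine (hK.abs_dotProduct_presStabLin_le hL hω (hs.abs_le t ht)
      (G := fun _ _ => 2 * B * M.h) fun i j hj =>
        norm_node_sub_node_le hL hsupp hB hlipq hh (Finset.mem_of_mem_erase hj)).trans ?_
    rw [M.sum_erase_const]
    have h5 := mul_le_mul_of_nonneg_left (hK.numPairs_mul_le hL)
        (show 0 ≤ ω * K * C * (2 * B * M.h) by positivity)
    linarith
  have h6 : |∑ k, ∑ j, ∫ x in box L, inner ℝ (gradient (M.phi j) x)
        ((M.phi k x * (q x - q k.1)) • (c j - c k))| ≤ B * K ^ 2 * (M.h ^ d * M.jump c) := by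
    rw [M.sum_univ_eq_sum_erase (F := fun k j => ∫ x in box L, inner ℝ (gradient (M.phi j) x)
        ((M.phi k x * (q x - q k.1)) • (c j - c k))) (fun k => by simp) ?_]
    · rw [← mul_assoc, ← M.sum_erase_mul_norm]
      refine M.abs_sum_erase_le fun k j _ => ?_
      rw [← Real.norm_eq_abs]
      refine (hK.norm_setIntegral_le k (B := K / M.h * (B * M.h * ‖c j - c k‖)) (fun x hx => ?_)
        (fun x _ h => by simp [h]) (by positivity)).trans (le_of_eq ?_)
      · refine (norm_inner_le_norm _ _).trans (mul_le_mul (hK.norm_gradient_le j x) ?_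
          (norm_nonneg _) (by positivity))
        rw [norm_smul, norm_mul, Real.norm_of_nonneg (M.phi_nonneg k x)]
        refine mul_le_mul_of_nonneg_right ?_ (norm_nonneg _)
        by_cases h0 : M.phi k x = 0
        · rw [h0, zero_mul]; positivity
        · have h7 := norm_sub_node_le hL hsupp hB hlipq hh (box_subset_cellBox hx) h0
          calc M.phi k x * ‖q x - q k.1‖ ≤ 1 * (B * M.h) :=
                mul_le_mul (M.phi_le_one hL k x) h7 (norm_nonneg _) zero_le_one
            _ = B * M.h := one_mul _
      · field_simp
    · intro k j hj
      refine integral_eq_zero_of_ae (ae_of_all _ fun x => ?_)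
      rcases M.phi_eq_zero_or_of_notMem_nbr hj x with h | h <;> simp [h, gradient_phi_eq_zero]
  rw [e1, abs_neg, e2]
  refine (abs_add_le _ _).trans ?_
  linarith

end PeriodicMesh
end PeriodicFEM

namespace PeriodicFEM

variable {d : ℕ} {L : Fin d → ℝ}

/-! ### Space-time test functions -/

/-- Functions supported in a compact subset of the period cell keep a common distance from its
boundary. -/
theorem exists_supportedInside {V : Type*} [NormedAddCommGroup V] {S : Set (Vec d)}
    (hS : IsCompact S) (hSL : S ⊆ box L) :
    ∃ ρ > 0, ∀ f : Vec d → V, (∀ x, f x ≠ 0 → x ∈ S) → SupportedInside L ρ f := by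
  obtain ⟨ρ, hρ, hsub⟩ := hS.exists_thickening_subset_open (isOpen_box L) hSL
  refine ⟨ρ, hρ, fun f hf x hx y hy => hsub (Metric.mem_thickening_iff.2 ⟨x, hf x hx, ?_⟩)⟩
  exact hy

section SpaceTime

variable {v : ℝ → Vec d → Vec d}

theorem hasDerivAt_curry (hv : ContDiff ℝ 2 (Function.uncurry v)) (t : ℝ) (x : Vec d) :
    HasDerivAt (fun s => v s x) (fderiv ℝ (Function.uncurry v) (t, x) (1, 0)) t := by
  have h1 : HasFDerivAt (Function.uncurry v) (fderiv ℝ (Function.uncurry v) (t, x)) (t, x) :=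
    (hv.differentiable two_ne_zero (t, x)).hasFDerivAt
  exact h1.comp_hasDerivAt t ((hasDerivAt_id t).prodMk (hasDerivAt_const t x))

theorem hasFDerivAt_curry (hv : ContDiff ℝ 2 (Function.uncurry v)) (t : ℝ) (x : Vec d) :
    HasFDerivAt (v t) ((fderiv ℝ (Function.uncurry v) (t, x)).comp
      (ContinuousLinearMap.inr ℝ ℝ (Vec d))) x := by
  have h1 : HasFDerivAt (Function.uncurry v) (fderiv ℝ (Function.uncurry v) (t, x)) (t, x) :=
    (hv.differentiable two_ne_zero (t, x)).hasFDerivAt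
  exact h1.comp x (hasFDerivAt_prodMk_right t x)

theorem continuous_deriv_curry (hv : ContDiff ℝ 2 (Function.uncurry v)) :
    Continuous fun q : ℝ × Vec d => deriv (fun s => v s q.2) q.1 := by
  have h1 : Continuous (fderiv ℝ (Function.uncurry v)) := hv.continuous_fderiv two_ne_zero
  simp only [fun q : ℝ × Vec d => (hasDerivAt_curry hv q.1 q.2).deriv]
  fun_prop

theorem continuous_fderiv_curry (hv : ContDiff ℝ 2 (Function.uncurry v)) :
    Continuous fun q : ℝ × Vec d => fderiv ℝ (v q.1) q.2 := by
  have h1 : Continuous (fderiv ℝ (Function.uncurry v)) := hv.continuous_fderiv two_ne_zero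
  simp only [fun q : ℝ × Vec d => (hasFDerivAt_curry hv q.1 q.2).fderiv]
  fun_prop

/-- The time slices of a space-time test function are test fields with uniform constants. -/
theorem exists_isTestField (hv : ContDiff ℝ 2 (Function.uncurry v))
    (hcs : HasCompactSupport (Function.uncurry v)) {S : Set ℝ}
    (hsupp : tsupport (Function.uncurry v) ⊆ S ×ˢ box L) :
    ∃ B ρ, (∀ t, IsTestField L B ρ (v t)) ∧ ∀ t x, ‖deriv (fun s => v s x) t‖ ≤ B := by
  set F := Function.uncurry v with hF
  have hF1 : ContDiff ℝ 1 (fderiv ℝ F) := hv.fderiv_right (by norm_num)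
  obtain ⟨B₀, hB₀⟩ := hcs.exists_bound_of_continuous hv.continuous
  obtain ⟨B₁, hB₁⟩ := (hcs.fderiv ℝ).exists_bound_of_continuous hF1.continuous
  obtain ⟨B₂, hB₂⟩ := hF1.lipschitzWith_of_hasCompactSupport (hcs.fderiv ℝ) one_ne_zero
  obtain ⟨ρ, hρ, hSI⟩ := exists_supportedInside (L := L) (V := Vec d) (hcs.image continuous_snd)
    (by rintro _ ⟨q, hq, rfl⟩; exact (hsupp hq).2)
  have hB₀0 : 0 ≤ B₀ := (norm_nonneg _).trans (hB₀ 0)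
  have hB₁0 : 0 ≤ B₁ := (norm_nonneg _).trans (hB₁ 0)
  have hfd : ∀ t x, ‖fderiv ℝ (v t) x‖ ≤ B₁ := fun t x => by
    rw [(hasFDerivAt_curry hv t x).fderiv]
    refine (ContinuousLinearMap.opNorm_comp_le _ _).trans ?_
    have h1 := hB₁ (t, x)
    have h2 := ContinuousLinearMap.norm_inr_le_one ℝ ℝ (Vec d)
    nlinarith [norm_nonneg (fderiv ℝ F (t, x)),
      norm_nonneg (ContinuousLinearMap.inr ℝ ℝ (Vec d))]
  have hfl : ∀ t x y, ‖fderiv ℝ (v t) y - fderiv ℝ (v t) x‖ ≤ B₂ * ‖y - x‖ := fun t x y => by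
    rw [(hasFDerivAt_curry hv t x).fderiv, (hasFDerivAt_curry hv t y).fderiv,
      ← ContinuousLinearMap.sub_comp]
    refine (ContinuousLinearMap.opNorm_comp_le _ _).trans ?_
    have h1 := hB₂.dist_le_mul (t, y) (t, x)
    rw [dist_eq_norm, dist_eq_norm] at h1
    have h3 : ‖((t, y) : ℝ × Vec d) - (t, x)‖ = ‖y - x‖ := by simp [Prod.norm_def]
    rw [h3] at h1
    have h2 := ContinuousLinearMap.norm_inr_le_one ℝ ℝ (Vec d)
    have h4 := norm_nonneg (fderiv ℝ F (t, y) - fderiv ℝ F (t, x))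
    calc _ ≤ ‖fderiv ℝ F (t, y) - fderiv ℝ F (t, x)‖ * 1 := mul_le_mul_of_nonneg_left h2 h4
      _ ≤ _ := by rw [mul_one]; exact h1
  have hsum1 : B₀ ≤ B₀ + B₁ + B₂ := by linarith [B₂.coe_nonneg]
  have hsum2 : B₁ ≤ B₀ + B₁ + B₂ := by linarith [B₂.coe_nonneg]
  have hsum3 : (B₂ : ℝ) ≤ B₀ + B₁ + B₂ := by linarith
  refine ⟨B₀ + B₁ + B₂, ρ, fun t => ⟨hρ, ?_, ?_, by positivity, fun x => (hB₀ (t, x)).trans hsum1,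
    fun x => (hfd t x).trans hsum2, fun x y => ?_, fun x y => ?_⟩, fun t x => ?_⟩
  · exact (hv.of_le one_le_two).comp (contDiff_prodMk_right t)
  · exact hSI _ fun x hx => ⟨(t, x), subset_tsupport _ hx, rfl⟩
  · refine (Convex.norm_image_sub_le_of_norm_fderiv_le (𝕜 := ℝ) (s := univ)
      (fun z _ => (hasFDerivAt_curry hv t z).differentiableAt) (fun z _ => hfd t z) convex_univ
      (mem_univ y) (mem_univ x)).trans ?_
    exact mul_le_mul_of_nonneg_right hsum2 (norm_nonneg _)
  · have h := Convex.norm_image_sub_le_of_norm_hasFDerivWithin_le' (𝕜 := ℝ) (f := v t)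
      (f' := fderiv ℝ (v t)) (φ := fderiv ℝ (v t) x) (s := Metric.closedBall x ‖y - x‖)
      (C := (B₀ + B₁ + B₂) * ‖y - x‖) (x := x) (y := y)
      (fun z _ => (hasFDerivAt_curry hv t z).differentiableAt.hasFDerivAt.hasFDerivWithinAt)
      (fun z hz => (hfl t x z).trans (mul_le_mul hsum3 (mem_closedBall_iff_norm.1 hz)
        (norm_nonneg _) (by positivity)))
      (convex_closedBall _ _) (Metric.mem_closedBall_self (norm_nonneg _))
      (mem_closedBall_iff_norm.2 le_rfl)
    rw [sq, ← mul_assoc]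
    exact h
  · rw [(hasDerivAt_curry hv t x).deriv]
    refine ((fderiv ℝ F (t, x)).le_opNorm _).trans ?_
    have h1 : ‖((1, 0) : ℝ × Vec d)‖ = 1 := by simp [Prod.norm_def]
    rw [h1, mul_one]
    exact (hB₁ _).trans hsum2

end SpaceTime

namespace PeriodicMesh

variable {M : PeriodicMesh L}
variable {ν ω T C : ℝ} {D : ℝ → M.Node → M.Node → ℝ} {u : ℝ → M.Node → Vec d}
  {p : ℝ → M.Node → ℝ} {B ρ : ℝ} {v : ℝ → Vec d → Vec d}

theorem isFiniteMeasure_box (L : Fin d → ℝ) : IsFiniteMeasure (volume.restrict (box L)) :=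
  ⟨by simpa using (volume_box_ne_top L).lt_top⟩

theorem hasDerivAt_setIntegral_phi_smul (hL : ∀ k, 0 < L k)
    (hv : ContDiff ℝ 2 (Function.uncurry v)) (hvt : ∀ t x, ‖deriv (fun s => v s x) t‖ ≤ B)
    (i : M.Node) (t : ℝ) :
    HasDerivAt (fun s => ∫ x in box L, M.phi i x • v s x)
      (∫ x in box L, M.phi i x • deriv (fun s => v s x) t) t := by
  have hphi := M.continuous_phi hL i
  have hvs : ∀ s, Continuous (v s) := fun s => hv.continuous.comp (Continuous.prodMk_right s)
  have hds : Continuous fun x => deriv (fun s => v s x) t :=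
    (continuous_deriv_curry hv).comp (Continuous.prodMk_right t)
  have := isFiniteMeasure_box L
  refine (hasDerivAt_integral_of_dominated_loc_of_deriv_le (bound := fun _ => B)
    (F := fun s x => M.phi i x • v s x) (F' := fun s x => M.phi i x • deriv (fun s => v s x) s)
    (s := univ) univ_mem ?_ ?_ ?_ ?_ (integrable_const B) ?_).2
  · exact Eventually.of_forall fun s => (hphi.smul (hvs s)).aestronglyMeasurable
  · exact integrableOn_box_of_continuous (hphi.smul (hvs t))
  · exact (hphi.smul hds).aestronglyMeasurable
  · refine ae_of_all _ fun x s _ => ?_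
    rw [norm_smul, Real.norm_of_nonneg (M.phi_nonneg i x)]
    calc M.phi i x * ‖deriv (fun s => v s x) s‖ ≤ 1 * B :=
          mul_le_mul (M.phi_le_one hL i x) (hvt s x) (norm_nonneg _) zero_le_one
      _ = B := one_mul _
  · exact ae_of_all _ fun x s _ =>
      (hasDerivAt_curry hv s x).differentiableAt.hasDerivAt.fun_const_smul _

theorem continuous_setIntegral_phi_smul_deriv (hL : ∀ k, 0 < L k)
    (hv : ContDiff ℝ 2 (Function.uncurry v)) (hvt : ∀ t x, ‖deriv (fun s => v s x) t‖ ≤ B)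
    (i : M.Node) : Continuous fun t => ∫ x in box L, M.phi i x • deriv (fun s => v s x) t := by
  have hphi := M.continuous_phi hL i
  have hd := continuous_deriv_curry hv
  have := isFiniteMeasure_box L
  refine continuous_of_dominated (bound := fun _ => B) (fun t => ?_) (fun t => ?_)
    (integrable_const B) (ae_of_all _ fun x => ?_)
  · exact (hphi.smul (hd.comp (Continuous.prodMk_right t))).aestronglyMeasurable
  · refine ae_of_all _ fun x => ?_
    rw [norm_smul, Real.norm_of_nonneg (M.phi_nonneg i x)]
    calc M.phi i x * ‖deriv (fun s => v s x) t‖ ≤ 1 * B :=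
          mul_le_mul (M.phi_le_one hL i x) (hvt t x) (norm_nonneg _) zero_le_one
      _ = B := one_mul _
  · exact (hd.comp (Continuous.prodMk_left x)).const_smul (M.phi i x)

theorem setIntegral_inner_fe (hL : ∀ k, 0 < L k) (c : M.Node → Vec d) {g : Vec d → Vec d}
    (hg : Continuous g) : ∫ x in box L, inner ℝ (M.fe c x) (g x) =
      ∑ i, inner ℝ (c i) (∫ x in box L, M.phi i x • g x) := by
  have hphi := M.continuous_phi hL
  have hint : ∀ i, IntegrableOn (fun x => M.phi i x • g x) (box L) := fun i =>
    integrableOn_box_of_continuous ((hphi i).smul hg)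
  have h : ∀ i, inner ℝ (c i) (∫ x in box L, M.phi i x • g x) =
      ∫ x in box L, inner ℝ (c i) (M.phi i x • g x) := fun i => (integral_inner (hint i) (c i)).symm
  simp only [h]
  rw [← integral_finsetSum _ fun i _ => (hint i).const_inner (c i)]
  refine integral_congr_ae (ae_of_all _ fun x => ?_)
  simp only [fe, sum_inner, real_inner_smul_left, real_inner_smul_right]

namespace IsBoundedSolution

theorem continuousOn_fe (hs : M.IsBoundedSolution ν ω T C D u p) (x : Vec d) :
    ContinuousOn (fun t => M.fe (u t) x) (Icc 0 T) :=
  continuousOn_finsetSum _ fun i _ => (hs.continuousOn i).const_smul (M.phi i x)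

theorem continuousOn_convection (hs : M.IsBoundedSolution ν ω T C D u p) (hL : ∀ k, 0 < L k)
    (hT : 0 < T) (hv : ContDiff ℝ 2 (Function.uncurry v)) (hw : ∀ t, IsTestField L B ρ (v t)) :
    ContinuousOn (fun t => ∫ x in box L,
      inner ℝ (fderiv ℝ (v t) x (M.fe (u t) x)) (M.fe (u t) x)) (Icc 0 T) := by
  have := isFiniteMeasure_box L
  have hd := continuous_fderiv_curry hv
  refine continuousOn_of_dominated (bound := fun _ => B * C * C) (fun t ht => ?_) (fun t ht => ?_)
    (integrable_const _) (ae_of_all _ fun x => ?_)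
  · have h1 := hd.comp (Continuous.prodMk_right t)
    have h2 := continuous_fe (M := M) hL (u t)
    exact ((h1.clm_apply h2).inner h2).aestronglyMeasurable
  · refine ae_of_all _ fun x => ?_
    have h1 := norm_fe_le hL (hs.norm_le_of_mem_Icc hT ht) x
    refine (norm_inner_le_norm _ _).trans (mul_le_mul ?_ h1 (norm_nonneg _)
      (mul_nonneg (hw t).bound_nonneg hs.const_nonneg))
    exact (ContinuousLinearMap.le_opNorm _ _).trans
      (mul_le_mul ((hw t).norm_fderiv_le x) h1 (norm_nonneg _) (hw t).bound_nonneg)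
  · have h1 := hd.comp (Continuous.prodMk_left x)
    have h2 := hs.continuousOn_fe x
    exact (h1.continuousOn.clm_apply h2).inner h2

theorem integrableOn_momentumResidual (hs : M.IsBoundedSolution ν ω T C D u p) (hL : ∀ k, 0 < L k)
    (hT : 0 < T) (hv : ContDiff ℝ 2 (Function.uncurry v)) (hw : ∀ t, IsTestField L B ρ (v t))
    (hvt : ∀ t x, ‖deriv (fun s => v s x) t‖ ≤ B) :
    IntegrableOn (fun t => M.momentumResidual (u t) (fun i => deriv (fun s => u s i) t) (v t))
      (Ioo 0 T) := by
  refine Integrable.sub (integrable_finsetSum _ fun i _ => ?_) ?_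
  · have hb : Continuous fun t => ∫ x in box L, M.phi i x • v t x :=
      continuous_iff_continuousAt.2 fun t =>
        (hasDerivAt_setIntegral_phi_smul hL hv hvt i t).continuousAt
    obtain ⟨B₁, hB₁⟩ := hs.exists_deriv_bound hL
    obtain ⟨B₂, hB₂⟩ := isCompact_Icc.exists_bound_of_continuousOn (s := Icc 0 T) hb.continuousOn
    have : IsFiniteMeasure (volume.restrict (Ioo 0 T)) := ⟨by simp⟩
    refine Integrable.of_bound ((measurable_deriv _).inner hb.measurable).aestronglyMeasurable
      (B₁ * B₂) ((ae_restrict_iff' measurableSet_Ioo).2 (ae_of_all _ fun t ht => ?_))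
    exact (norm_inner_le_norm _ _).trans (mul_le_mul (hB₁ t ht i) (hB₂ t (Ioo_subset_Icc_self ht))
      (norm_nonneg _) ((norm_nonneg _).trans (hB₁ t ht i)))
  · exact ((hs.continuousOn_convection hL hT hv hw).integrableOn_compact isCompact_Icc).mono_set
      Ioo_subset_Icc_self

/-- The momentum residual is the consistency error of the weak momentum equation. -/
theorem isMomentumError_momentumResidual (hs : M.IsBoundedSolution ν ω T C D u p)
    (hL : ∀ k, 0 < L k) (hT : 0 < T) (hv : ContDiff ℝ 2 (Function.uncurry v))
    (hw : ∀ t, IsTestField L B ρ (v t)) (hvt : ∀ t x, ‖deriv (fun s => v s x) t‖ ≤ B) :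
    M.IsMomentumError T u v
      fun t => M.momentumResidual (u t) (fun i => deriv (fun s => u s i) t) (v t) := by
  have hres := hs.integrableOn_momentumResidual hL hT hv hw hvt
  refine ⟨hres, fun τ hτ => ?_⟩
  have hvs : ∀ s, Continuous (v s) := fun s => hv.continuous.comp (Continuous.prodMk_right s)
  have hds : ∀ t, Continuous fun x => deriv (fun s => v s x) t := fun t =>
    (continuous_deriv_curry hv).comp (Continuous.prodMk_right t)
  have hfs : ∀ t, Continuous (fderiv ℝ (v t)) := fun t =>
    (continuous_fderiv_curry hv).comp (Continuous.prodMk_right t)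
  have hb := hasDerivAt_setIntegral_phi_smul (M := M) hL hv hvt
  have hsplit : ∀ t, ∫ x in box L, (inner ℝ (M.fe (u t) x) (deriv (fun s => v s x) t) +
        inner ℝ (fderiv ℝ (v t) x (M.fe (u t) x)) (M.fe (u t) x)) =
      ∑ i, inner ℝ (u t i) (∫ x in box L, M.phi i x • deriv (fun s => v s x) t) +
      ∫ x in box L, inner ℝ (fderiv ℝ (v t) x (M.fe (u t) x)) (M.fe (u t) x) := by
    intro t
    have h1 := continuous_fe (M := M) hL (u t)
    rw [← setIntegral_inner_fe hL (u t) (hds t)]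
    exact integral_add (integrableOn_box_of_continuous (h1.inner (hds t)))
      (integrableOn_box_of_continuous (((hfs t).clm_apply h1).inner h1))
  have hsub : Icc 0 τ ⊆ Icc 0 T := Icc_subset_Icc_right hτ.2
  have hc1 : ContinuousOn (fun t => ∑ i, inner ℝ (u t i)
      (∫ x in box L, M.phi i x • deriv (fun s => v s x) t) +
      ∫ x in box L, inner ℝ (fderiv ℝ (v t) x (M.fe (u t) x)) (M.fe (u t) x)) (Icc 0 τ) :=
    ((continuousOn_finsetSum _ fun i _ => (hs.continuousOn i).inner
      (continuous_setIntegral_phi_smul_deriv hL hv hvt i).continuousOn).add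
      (hs.continuousOn_convection hL hT hv hw)).mono hsub
  have hi1 := hc1.intervalIntegrable_of_Icc (μ := volume) hτ.1.le
  have hi2 : IntervalIntegrable
      (fun t => M.momentumResidual (u t) (fun i => deriv (fun s => u s i) t) (v t)) volume 0 τ := by
    rw [intervalIntegrable_iff_integrableOn_Ioo_of_le hτ.1.le]
    exact hres.mono_set (Ioo_subset_Ioo_right hτ.2)
  simp only [hsplit]
  rw [← intervalIntegral.integral_add hi1 hi2, setIntegral_inner_fe hL _ (hvs τ),
    setIntegral_inner_fe hL _ (hvs 0)]
  symm
  refine intervalIntegral.integral_eq_sub_of_hasDerivAt_of_le hτ.1.le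
    (f := fun t => ∑ i, inner ℝ (u t i) (∫ x in box L, M.phi i x • v t x)) ?_ ?_ (hi1.add hi2)
  · refine continuousOn_finsetSum _ fun i _ => ((hs.continuousOn i).mono hsub).inner ?_
    exact fun t _ => (hb i t).continuousAt.continuousWithinAt
  · intro t ht
    have ht' : t ∈ Ioo 0 T := ⟨ht.1, ht.2.trans_le hτ.2⟩
    have h := HasDerivAt.fun_sum (u := Finset.univ) fun i _ =>
      (hs.hasDerivAt ht' i).inner ℝ (hb i t)
    refine h.congr_deriv ?_
    rw [Finset.sum_add_distrib, momentumResidual]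
    ring

end IsBoundedSolution

/-- The consistency error of the weak momentum equation is unique up to null sets. -/
theorem IsMomentumError.ae_eq {e e' : ℝ → ℝ} (hT : 0 < T) (he : M.IsMomentumError T u v e)
    (he' : M.IsMomentumError T u v e') : e =ᵐ[volume.restrict (Ioo 0 T)] e' := by
  have hi : ∀ {f : ℝ → ℝ}, IntegrableOn f (Ioo 0 T) → IntervalIntegrable f volume 0 T :=
    fun hf => (intervalIntegrable_iff_integrableOn_Ioo_of_le hT.le).2 hf
  have hzero : ∀ τ ∈ Ioo 0 T, ∫ t in (0)..τ, (e t - e' t) = 0 := by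
    intro τ hτ
    have hsub : uIcc 0 τ ⊆ uIcc 0 T := by
      rw [uIcc_of_le hτ.1.le, uIcc_of_le hT.le]
      exact Icc_subset_Icc_right hτ.2.le
    rw [intervalIntegral.integral_sub ((hi he.1).mono_set hsub) ((hi he'.1).mono_set hsub)]
    have h1 := he.2 τ ⟨hτ.1, hτ.2.le⟩
    have h2 := he'.2 τ ⟨hτ.1, hτ.2.le⟩
    linarith
  have hd := ((hi he.1).sub (hi he'.1)).ae_hasDerivAt_integral
  refine (ae_restrict_iff' measurableSet_Ioo).2 ?_
  filter_upwards [hd] with x hx hxm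
  have hx1 := hx (by rw [uIcc_of_le hT.le]; exact Ioo_subset_Icc_self hxm) 0 left_mem_uIcc
  have hx2 : HasDerivAt (fun _ : ℝ => (0 : ℝ)) (e x - e' x) x :=
    hx1.congr_of_eventuallyEq (by
      filter_upwards [isOpen_Ioo.mem_nhds hxm] with y hy
      exact (hzero y hy).symm)
  exact sub_eq_zero.1 (hx2.unique (hasDerivAt_const x 0))

end PeriodicMesh
end PeriodicFEM

namespace PeriodicFEM
namespace PeriodicMesh

variable {d : ℕ} {L : Fin d → ℝ} {M : PeriodicMesh L}
variable {ν ω T C : ℝ} {D : ℝ → M.Node → M.Node → ℝ} {u : ℝ → M.Node → Vec d}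
  {p : ℝ → M.Node → ℝ} {B ρ K η E : ℝ}

/-! ### Bounds of the consistency errors integrated over time -/

/-- An inverse estimate for the Dirichlet energy of nodal values with jumps of size `G`. -/
theorem IsRegular.stiffForm_self_le (hK : M.IsRegular K) (hL : ∀ k, 0 < L k) {w : M.Node → Vec d}
    {G : ℝ} (hw : ∀ i, ∀ j ∈ (M.nbr i).erase i, ‖w j - w i‖ ≤ G) :
    M.stiffForm w w ≤ K ^ 4 * G ^ 2 * volume.real (box L) / (2 * M.h ^ 2) := by
  have hh := hK.h_pos
  have hKp := hK.const_pos
  rw [stiffForm_eq_sum_erase (sum_stiff hL hK.lipschitzWith)]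
  have h1 : |∑ i, ∑ j ∈ (M.nbr i).erase i, M.stiff i j * inner ℝ (w j - w i) (w j - w i)| ≤
      ∑ i, ∑ _j ∈ (M.nbr i).erase i, (K / M.h) ^ 2 * (K * M.h ^ d) * G ^ 2 := by
    refine M.abs_sum_erase_le fun i j hj => ?_
    rw [abs_mul, real_inner_self_eq_norm_sq, abs_of_nonneg (sq_nonneg ‖w j - w i‖)]
    exact mul_le_mul (hK.abs_stiff_le i j) (pow_le_pow_left₀ (norm_nonneg _) (hw i j hj) 2)
      (sq_nonneg _) (by positivity)
  rw [M.sum_erase_const] at h1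
  have h2 := mul_le_mul_of_nonneg_left (hK.numPairs_mul_le hL)
    (show 0 ≤ (K / M.h) ^ 2 * K * G ^ 2 by positivity)
  have e : K ^ 4 * G ^ 2 * volume.real (box L) / (2 * M.h ^ 2) =
      1 / 2 * ((K / M.h) ^ 2 * K * G ^ 2 * (K * volume.real (box L))) := by
    field_simp
  rw [e]
  have h3 := (abs_le.1 h1).1
  linarith

/-- Young's inequality for the stiffness form. -/
theorem two_mul_abs_stiffForm_le (hpsd : ∀ w : M.Node → Vec d, 0 ≤ M.stiffForm w w)
    (w z : M.Node → Vec d) {ε : ℝ} (hε : 0 < ε) :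
    2 * |M.stiffForm w z| ≤ ε * M.stiffForm z z + M.stiffForm w w / ε := by
  have key : ∀ σ : ℝ, M.stiffForm (fun i => ε • z i + σ • w i) (fun i => ε • z i + σ • w i) =
      ε ^ 2 * M.stiffForm z z + 2 * ε * σ * M.stiffForm w z + σ ^ 2 * M.stiffForm w w := by
    intro σ
    have e : 2 * ε * σ * M.stiffForm w z =
        ε * σ * M.stiffForm w z + ε * σ * M.stiffForm z w := by
      rw [stiffForm_comm z w]; ring
    rw [e]
    simp only [stiffForm, Finset.mul_sum, ← Finset.sum_add_distrib]
    refine Finset.sum_congr rfl fun i _ => Finset.sum_congr rfl fun j _ => ?_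
    simp only [inner_add_left, inner_add_right, real_inner_smul_left, real_inner_smul_right]
    ring
  have h1 := hpsd (fun i => ε • z i + (1 : ℝ) • w i)
  have h2 := hpsd (fun i => ε • z i + (-1 : ℝ) • w i)
  rw [key] at h1 h2
  have e : ε * M.stiffForm z z + M.stiffForm w w / ε =
      (ε ^ 2 * M.stiffForm z z + M.stiffForm w w) / ε := by field_simp
  rw [e, le_div_iff₀ hε]
  rcases abs_cases (M.stiffForm w z) with ⟨h, -⟩ | ⟨h, -⟩ <;> rw [h] <;> linarith

namespace IsBoundedSolution

/-- The bound of the forces on regular meshes, where `‖c_ij‖` is of order `h ^ (d - 1)` and the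
lumped masses are of order `h ^ d`. -/
theorem norm_force_sq_div_lump_le (hs : M.IsBoundedSolution ν ω T C D u p) (hd : 0 < d)
    (hL : ∀ k, 0 < L k) (hK : M.IsRegular K) {t : ℝ} (ht : t ∈ Ioo 0 T) (i : M.Node) :
    ‖∑ j, (D t i j - M.conv (u t) i j) • u t j‖ ^ 2 / M.lump i ≤
      (C * (1 + 2 * K ^ 2)) ^ 2 * K ^ 3 * M.h ^ (d - 1) / M.h *
        ∑ j ∈ (M.nbr i).erase i, ‖u t j - u t i‖ ^ 2 := by
  have hh := hK.h_pos
  have hKp := hK.const_pos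
  have hC := hs.const_nonneg
  have hm := M.lump_pos hL i
  have hpow : M.h ^ d = M.h ^ (d - 1) * M.h := by rw [← pow_succ, Nat.sub_add_cancel hd]
  have h1 := hs.norm_force_le (sum_grad hL hK.lipschitzWith) (hK.norm_grad_le hL) ht i
  set S := ∑ j ∈ (M.nbr i).erase i, ‖u t j - u t i‖ with hS
  set Q := ∑ j ∈ (M.nbr i).erase i, ‖u t j - u t i‖ ^ 2 with hQ
  have hQ0 : 0 ≤ Q := Finset.sum_nonneg fun j _ => sq_nonneg _
  have e1 : C * M.h ^ (d - 1) + 2 * C * (K / M.h * (K * M.h ^ d)) =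
      C * (1 + 2 * K ^ 2) * M.h ^ (d - 1) := by
    rw [hpow]; field_simp
  rw [e1] at h1
  have h2 : S ^ 2 ≤ K ^ 2 * Q := by
    refine (sq_sum_le_card_mul_sum_sq (s := (M.nbr i).erase i)
      (f := fun j => ‖u t j - u t i‖)).trans (mul_le_mul_of_nonneg_right ?_ hQ0)
    refine le_trans ?_ (hK.card_nbr_le hL i)
    exact_mod_cast Finset.card_le_card (Finset.erase_subset _ _)
  have h3 : ‖∑ j, (D t i j - M.conv (u t) i j) • u t j‖ ^ 2 ≤
      (C * (1 + 2 * K ^ 2) * M.h ^ (d - 1)) ^ 2 * (K ^ 2 * Q) := by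
    refine (pow_le_pow_left₀ (norm_nonneg _) h1 2).trans ?_
    rw [mul_pow]
    exact mul_le_mul_of_nonneg_left h2 (sq_nonneg _)
  rw [div_le_iff₀ hm]
  refine h3.trans ?_
  have h4 := mul_le_mul_of_nonneg_left (hK.le_lump hL i)
    (show 0 ≤ (C * (1 + 2 * K ^ 2)) ^ 2 * K ^ 2 * M.h ^ (d - 1) / M.h * Q by positivity)
  rw [hpow] at h4
  refine le_trans (le_of_eq ?_) (h4.trans (le_of_eq ?_))
  · field_simp
  · ring

theorem neg_dotProduct_presStabLin_le (hs : M.IsBoundedSolution ν ω T C D u p)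
    (hL : ∀ k, 0 < L k) (hω : 0 ≤ ω) (hK : M.IsRegular K) {t : ℝ} (ht : t ∈ Ioo 0 T) :
    -(p t ⬝ᵥ M.presStabLin ω (p t)) ≤ 2 * ω * K ^ 2 * C ^ 2 * volume.real (box L) := by
  have hp := hs.abs_le t ht
  have hC := hs.const_nonneg
  have hKp := hK.const_pos
  have h1 := hK.abs_dotProduct_presStabLin_le hL hω hp (q := p t) (G := fun _ _ => 2 * C)
    fun i j _ => by
      have h := abs_sub (p t j) (p t i)
      linarith [hp i, hp j]
  rw [M.sum_erase_const] at h1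
  have h2 := mul_le_mul_of_nonneg_left (hK.numPairs_mul_le hL)
    (show 0 ≤ 2 * ω * K * C ^ 2 by positivity)
  have h3 := (_root_.abs_le.1 h1).1
  linarith

theorem intervalIntegrable_lump_deriv_sq (hs : M.IsBoundedSolution ν ω T C D u p)
    (hL : ∀ k, 0 < L k) (hT : 0 < T) : IntervalIntegrable
      (fun t => ∑ i, M.lump i * ‖deriv (fun s => u s i) t‖ ^ 2) volume 0 T :=
  (intervalIntegrable_iff_integrableOn_Ioo_of_le hT.le).2 (hs.integrableOn_lump_deriv_sq hL)

theorem intervalIntegrable_lump_deriv (hs : M.IsBoundedSolution ν ω T C D u p)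
    (hL : ∀ k, 0 < L k) (hT : 0 < T) : IntervalIntegrable
      (fun t => ∑ i, M.lump i * ‖deriv (fun s => u s i) t‖) volume 0 T := by
  obtain ⟨B, hB⟩ := hs.exists_deriv_bound hL
  refine (intervalIntegrable_iff_integrableOn_Ioo_of_le hT.le).2
    (integrable_finsetSum _ fun i _ => Integrable.const_mul ?_ _)
  have : IsFiniteMeasure (volume.restrict (Ioo 0 T)) := ⟨by simp⟩
  refine Integrable.of_bound (measurable_deriv _).norm.aestronglyMeasurable B
    ((ae_restrict_iff' measurableSet_Ioo).2 (ae_of_all _ fun t ht => ?_))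
  rw [norm_norm]
  exact hB t ht i

theorem intervalIntegrable_jump (hs : M.IsBoundedSolution ν ω T C D u p) (hT : 0 < T) :
    IntervalIntegrable (fun t => M.jump (u t)) volume 0 T :=
  hs.continuousOn_jump.intervalIntegrable_of_Icc hT.le

theorem intervalIntegrable_jumpSq (hs : M.IsBoundedSolution ν ω T C D u p) (hT : 0 < T) :
    IntervalIntegrable (fun t => M.jumpSq (u t)) volume 0 T :=
  hs.continuousOn_jumpSq.intervalIntegrable_of_Icc hT.le

/-- Young's inequality turns the bound of the squared jumps into a rate for the jumps. -/
theorem integral_jump_le (hs : M.IsBoundedSolution ν ω T C D u p) (hd : 0 < d)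
    (hL : ∀ k, 0 < L k) (hT : 0 < T) (hK : M.IsRegular K)
    (hE : ∫ t in (0)..T, M.h ^ (d - 1) * M.jumpSq (u t) ≤ E) (hη : 0 < η) (hη2 : M.h ≤ η ^ 2) :
    ∫ t in (0)..T, M.h ^ d * M.jump (u t) ≤ (K * volume.real (box L) * T + E) / 2 * η := by
  have hh := hK.h_pos
  have hpow : M.h ^ d = M.h ^ (d - 1) * M.h := by rw [← pow_succ, Nat.sub_add_cancel hd]
  have h1 : ∫ t in (0)..T, M.h ^ d * M.jump (u t) ≤
      ∫ t in (0)..T, (η * (K * volume.real (box L)) / 2 +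
        η / 2 * (M.h ^ (d - 1) * M.jumpSq (u t))) := by
    refine intervalIntegral.integral_mono_on hT.le ((hs.intervalIntegrable_jump hT).const_mul _)
      (intervalIntegrable_const.add
        (((hs.intervalIntegrable_jumpSq hT).const_mul _).const_mul _)) fun t _ => ?_
    have h2 := mul_le_mul_of_nonneg_left (M.two_mul_jump_le (u t) hη) (pow_pos hh d).le
    have h3 := mul_le_mul_of_nonneg_left (hK.numPairs_mul_le hL) hη.le
    have h4 : M.h ^ d * (M.jumpSq (u t) / η) ≤ η * (M.h ^ (d - 1) * M.jumpSq (u t)) := by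
      rw [hpow, ← mul_div_assoc, div_le_iff₀ hη]
      have h5 := mul_le_mul_of_nonneg_left hη2
        (mul_nonneg (pow_pos hh (d - 1)).le (M.jumpSq_nonneg (u t)))
      linarith
    linarith
  refine h1.trans ?_
  rw [intervalIntegral.integral_add intervalIntegrable_const
    (((hs.intervalIntegrable_jumpSq hT).const_mul _).const_mul _),
    intervalIntegral.integral_const_mul, intervalIntegral.integral_const, smul_eq_mul, sub_zero]
  have h2 := mul_le_mul_of_nonneg_left hE (half_pos hη).le
  linarith

/-- The time derivative of the discrete velocity may blow up, but more slowly than `1 / h`: the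
squared `L²` norm is `O(1 + ν / h² + 1 / h)`, where `ν / h²` is due to the initial dissipation and
`1 / h` to the convective and artificially viscous forces. -/
theorem integral_lump_deriv_le (hs : M.IsBoundedSolution ν ω T C D u p) (hd : 0 < d)
    (hL : ∀ k, 0 < L k) (hT : 0 < T) (hω : 0 ≤ ω) (hK : M.IsRegular K)
    (hE : ∫ t in (0)..T, M.h ^ (d - 1) * M.jumpSq (u t) ≤ E) (hη : 0 < η) (hη1 : η ≤ 1)
    (hη2 : M.h ≤ η ^ 2) (hν : 0 ≤ ν) (hνη : ν ≤ η ^ 2) :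
    ∫ t in (0)..T, M.h * ∑ i, M.lump i * ‖deriv (fun s => u s i) t‖ ≤
      (volume.real (box L) * T + (2 * ω * K ^ 2 * C ^ 2 * volume.real (box L) +
        2 * K ^ 4 * C ^ 2 * volume.real (box L) + (C * (1 + 2 * K ^ 2)) ^ 2 * K ^ 3 * E)) / 2 *
      η := by
  have hh := hK.h_pos
  have hKp := hK.const_pos
  have hC := hs.const_nonneg
  have hΩ : 0 ≤ volume.real (box L) := measureReal_nonneg
  have hE0 : 0 ≤ E := le_trans (intervalIntegral.integral_nonneg hT.le fun t _ =>
    mul_nonneg (pow_pos hh _).le (M.jumpSq_nonneg _)) hE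
  have hpsd := stiffForm_self_nonneg (M := M) hK.lipschitzWith
  have hQ := hs.integral_lump_deriv_sq_le hL hT hω (hK.antisymm hL) hpsd
    (fun t ht => hs.neg_dotProduct_presStabLin_le hL hω hK ht)
    (fun t ht i => hs.norm_force_sq_div_lump_le hd hL hK ht i)
  rw [intervalIntegral.integral_const_mul] at hE
  set Q := ∫ t in (0)..T, ∑ i, M.lump i * ‖deriv (fun s => u s i) t‖ ^ 2 with hQdef
  have hS₀ : M.stiffForm (u 0) (u 0) ≤
      K ^ 4 * (2 * C) ^ 2 * volume.real (box L) / (2 * M.h ^ 2) :=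
    hK.stiffForm_self_le hL fun i j _ => by
      have h0 := hs.norm_le_of_mem_Icc hT (left_mem_Icc.2 hT.le)
      exact (norm_sub_le _ _).trans (by linarith [h0 i, h0 j])
  have hh2 : M.h ^ 2 ≤ η ^ 2 := by
    have : η ^ 2 ≤ 1 := pow_le_one₀ hη.le hη1
    nlinarith
  have hQh : M.h ^ 2 * Q ≤ η ^ 2 * (2 * ω * K ^ 2 * C ^ 2 * volume.real (box L) +
      2 * K ^ 4 * C ^ 2 * volume.real (box L) + (C * (1 + 2 * K ^ 2)) ^ 2 * K ^ 3 * E) := by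
    have h1 : M.h ^ 2 * (2 * ω * K ^ 2 * C ^ 2 * volume.real (box L)) ≤
        η ^ 2 * (2 * ω * K ^ 2 * C ^ 2 * volume.real (box L)) :=
      mul_le_mul_of_nonneg_right hh2 (by positivity)
    have h2 : M.h ^ 2 * (ν * M.stiffForm (u 0) (u 0)) ≤
        η ^ 2 * (2 * K ^ 4 * C ^ 2 * volume.real (box L)) := by
      have h3 : M.h ^ 2 * M.stiffForm (u 0) (u 0) ≤ 2 * K ^ 4 * C ^ 2 * volume.real (box L) := by
        refine (mul_le_mul_of_nonneg_left hS₀ (sq_nonneg _)).trans (le_of_eq ?_)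
        field_simp
      calc M.h ^ 2 * (ν * M.stiffForm (u 0) (u 0))
          = ν * (M.h ^ 2 * M.stiffForm (u 0) (u 0)) := by ring
        _ ≤ ν * (2 * K ^ 4 * C ^ 2 * volume.real (box L)) := mul_le_mul_of_nonneg_left h3 hν
        _ ≤ _ := mul_le_mul_of_nonneg_right hνη (by positivity)
    have h4 : M.h ^ 2 * ((C * (1 + 2 * K ^ 2)) ^ 2 * K ^ 3 * M.h ^ (d - 1) / M.h *
        ∫ t in (0)..T, M.jumpSq (u t)) ≤ η ^ 2 * ((C * (1 + 2 * K ^ 2)) ^ 2 * K ^ 3 * E) := by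
      calc M.h ^ 2 * ((C * (1 + 2 * K ^ 2)) ^ 2 * K ^ 3 * M.h ^ (d - 1) / M.h *
            ∫ t in (0)..T, M.jumpSq (u t))
          = M.h * ((C * (1 + 2 * K ^ 2)) ^ 2 * K ^ 3 *
            (M.h ^ (d - 1) * ∫ t in (0)..T, M.jumpSq (u t))) := by field_simp
        _ ≤ M.h * ((C * (1 + 2 * K ^ 2)) ^ 2 * K ^ 3 * E) := by gcongr
        _ ≤ _ := mul_le_mul_of_nonneg_right hη2 (by positivity)
    have h5 := mul_le_mul_of_nonneg_left hQ (sq_nonneg M.h)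
    linarith
  have h1 : ∫ t in (0)..T, M.h * ∑ i, M.lump i * ‖deriv (fun s => u s i) t‖ ≤
      ∫ t in (0)..T, (η * volume.real (box L) / 2 +
        M.h ^ 2 / (2 * η) * ∑ i, M.lump i * ‖deriv (fun s => u s i) t‖ ^ 2) := by
    refine intervalIntegral.integral_mono_on hT.le
      ((hs.intervalIntegrable_lump_deriv hL hT).const_mul _)
      (intervalIntegrable_const.add ((hs.intervalIntegrable_lump_deriv_sq hL hT).const_mul _))
      fun t _ => ?_
    rw [← M.sum_lump hL, Finset.mul_sum, Finset.mul_sum, Finset.mul_sum, Finset.sum_div,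
      ← Finset.sum_add_distrib]
    refine Finset.sum_le_sum fun i _ => ?_
    set y := ‖deriv (fun s => u s i) t‖
    have e : η * M.lump i / 2 + M.h ^ 2 / (2 * η) * (M.lump i * y ^ 2) - M.h * (M.lump i * y) =
        M.lump i / (2 * η) * (η - M.h * y) ^ 2 := by
      field_simp
      ring
    have h3 : 0 ≤ M.lump i / (2 * η) * (η - M.h * y) ^ 2 :=
      mul_nonneg (div_nonneg (M.lump_pos hL i).le (by positivity)) (sq_nonneg _)
    linarith
  refine h1.trans ?_
  rw [intervalIntegral.integral_add intervalIntegrable_const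
    ((hs.intervalIntegrable_lump_deriv_sq hL hT).const_mul _),
    intervalIntegral.integral_const_mul, intervalIntegral.integral_const, smul_eq_mul, sub_zero,
    ← hQdef]
  have h6 := mul_le_mul_of_nonneg_left hQh (show 0 ≤ 1 / (2 * η) by positivity)
  have e1 : 1 / (2 * η) * (M.h ^ 2 * Q) = M.h ^ 2 / (2 * η) * Q := by ring
  have e2 : ∀ X : ℝ, 1 / (2 * η) * (η ^ 2 * X) = η / 2 * X := fun X => by field_simp
  rw [e1, e2] at h6
  linarith

theorem continuousOn_stiffForm_curry (hs : M.IsBoundedSolution ν ω T C D u p)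
    {v : ℝ → Vec d → Vec d} (hv : ContDiff ℝ 2 (Function.uncurry v)) :
    ContinuousOn (fun t => M.stiffForm (fun i => v t i.1) (u t)) (Icc 0 T) := by
  refine continuousOn_finsetSum _ fun i _ => continuousOn_finsetSum _ fun j _ =>
    continuousOn_const.mul (ContinuousOn.inner ?_ (hs.continuousOn j))
  exact (hv.continuous.comp (Continuous.prodMk_left i.1)).continuousOn

/-- The viscous term vanishes in the limit because the energy bounds `ν ‖∇u_h‖²`. -/
theorem integral_abs_stiffForm_le (hs : M.IsBoundedSolution ν ω T C D u p)
    (hL : ∀ k, 0 < L k) (hT : 0 < T) (hω : 0 ≤ ω) (hK : M.IsRegular K)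
    {v : ℝ → Vec d → Vec d} (hv : ContDiff ℝ 2 (Function.uncurry v))
    (hw : ∀ t, IsTestField L B ρ (v t)) (hh : M.h < ρ) (hη : 0 < η) (hν : 0 ≤ ν)
    (hνη : ν ≤ η ^ 2) :
    ∫ t in (0)..T, ν * |M.stiffForm (fun i => v t i.1) (u t)| ≤
      (C ^ 2 * volume.real (box L) / 4 + K ^ 4 * B ^ 2 * volume.real (box L) * T) * η := by
  have hhp := hK.h_pos
  have hKp := hK.const_pos
  have hΩ : 0 ≤ volume.real (box L) := measureReal_nonneg
  have hpsd := stiffForm_self_nonneg (M := M) hK.lipschitzWith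
  have hen := hs.integral_stiffForm_le hL hT hω (hK.antisymm hL)
  have hi : IntervalIntegrable (fun t => 2 * ν * M.stiffForm (u t) (u t)) volume 0 T :=
    (continuousOn_const.mul hs.continuousOn_stiffForm).intervalIntegrable_of_Icc hT.le
  have h1 : ∫ t in (0)..T, ν * |M.stiffForm (fun i => v t i.1) (u t)| ≤
      ∫ t in (0)..T, (η / 4 * (2 * ν * M.stiffForm (u t) (u t)) +
        η * (K ^ 4 * B ^ 2 * volume.real (box L))) := by
    refine intervalIntegral.integral_mono_on hT.le
      ((continuousOn_const.mul (hs.continuousOn_stiffForm_curry hv).abs).intervalIntegrable_of_Icc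
        hT.le) ((hi.const_mul _).add intervalIntegrable_const) fun t _ => ?_
    have h2 := two_mul_abs_stiffForm_le hpsd (fun i => v t i.1) (u t) hη
    have h3 : M.stiffForm (fun i => v t i.1) (fun i => v t i.1) ≤
        2 * K ^ 4 * B ^ 2 * volume.real (box L) := by
      refine (hK.stiffForm_self_le hL fun i j hj => norm_node_sub_node_le hL (hw t).supp
        (hw t).bound_nonneg (hw t).norm_sub_le hh (Finset.mem_of_mem_erase hj)).trans
        (le_of_eq ?_)
      field_simp
    have h4 : ν * (M.stiffForm (fun i => v t i.1) (fun i => v t i.1) / η) ≤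
        η * (2 * K ^ 4 * B ^ 2 * volume.real (box L)) := by
      rw [← mul_div_assoc, div_le_iff₀ hη]
      calc ν * M.stiffForm (fun i => v t i.1) (fun i => v t i.1)
          ≤ η ^ 2 * (2 * K ^ 4 * B ^ 2 * volume.real (box L)) :=
            mul_le_mul hνη h3 (hpsd _) (sq_nonneg _)
        _ = _ := by ring
    have h5 := mul_le_mul_of_nonneg_left h2 hν
    linarith
  refine h1.trans ?_
  rw [intervalIntegral.integral_add (hi.const_mul _) intervalIntegrable_const,
    intervalIntegral.integral_const_mul, intervalIntegral.integral_const, smul_eq_mul, sub_zero]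
  have h6 := mul_le_mul_of_nonneg_left hen (show 0 ≤ η / 4 by positivity)
  linarith

end IsBoundedSolution

/-- The divergence error tends to zero at the rate `η`, uniformly over all regular meshes. -/
theorem exists_integral_abs_divError_le (hd : 0 < d) (hL : ∀ k, 0 < L k) (hT : 0 < T)
    (hω : 0 ≤ ω) {q : Vec d → ℝ} (hq : ContDiff ℝ 1 q) (hρ : 0 < ρ) (hsupp : SupportedInside L ρ q)
    (hB : 0 ≤ B) (hlipq : ∀ x y, ‖q x - q y‖ ≤ B * ‖x - y‖) (K C E : ℝ) :
    ∃ R, ∀ (M : PeriodicMesh L) (ν : ℝ) (D : ℝ → M.Node → M.Node → ℝ) (u : ℝ → M.Node → Vec d)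
      (p : ℝ → M.Node → ℝ) (η : ℝ), M.IsBoundedSolution ν ω T C D u p → M.IsRegular K →
      ∫ t in (0)..T, M.h ^ (d - 1) * M.jumpSq (u t) ≤ E → 0 < η → η ≤ 1 → M.h ≤ η ^ 2 →
      M.h < ρ → IntervalIntegrable (fun t => M.divError (u t) q) volume 0 T →
      ∫ t in (0)..T, |M.divError (u t) q| ≤ R * η := by
  refine ⟨B * K ^ 2 * ((K * volume.real (box L) * T + E) / 2) +
    2 * ω * K ^ 2 * C * B * volume.real (box L) * T,
    fun M ν D u p η hs hK hE hη hη1 hη2 hh hi => ?_⟩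
  have hC := hs.const_nonneg
  have hKp := hK.const_pos
  have hΩ : 0 ≤ volume.real (box L) := measureReal_nonneg
  have hhη : M.h ≤ η := by nlinarith
  have hij := (hs.intervalIntegrable_jump hT).const_mul (M.h ^ d)
  have h1 := intervalIntegral.integral_mono_on_of_le_Ioo hT.le hi.abs
    ((hij.const_mul (B * K ^ 2)).add intervalIntegrable_const)
    fun t ht => hs.abs_divError_le hL hω hK hq hρ hsupp hB hlipq hh ht
  rw [intervalIntegral.integral_add (hij.const_mul _) intervalIntegrable_const,
    intervalIntegral.integral_const_mul, intervalIntegral.integral_const, smul_eq_mul,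
    sub_zero] at h1
  have h2 := mul_le_mul_of_nonneg_left (hs.integral_jump_le hd hL hT hK hE hη hη2)
    (show 0 ≤ B * K ^ 2 by positivity)
  have h3 := mul_le_mul_of_nonneg_left hhη
    (show 0 ≤ 2 * ω * K ^ 2 * C * B * volume.real (box L) * T by positivity)
  linarith

/-- The momentum error tends to zero at the rate `η`, uniformly over all regular meshes. -/
theorem exists_integral_abs_momentumResidual_le (hd : 0 < d) (hL : ∀ k, 0 < L k) (hT : 0 < T)
    (hω : 0 ≤ ω) {v : ℝ → Vec d → Vec d} (hv : ContDiff ℝ 2 (Function.uncurry v))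
    (hw : ∀ t, IsTestField L B ρ (v t)) (hvt : ∀ t x, ‖deriv (fun s => v s x) t‖ ≤ B)
    (hdiv : ∀ t ∈ Ioo 0 T, ∀ x ∈ box L, divergence (v t) x = 0) (K C E : ℝ) :
    ∃ R, ∀ (M : PeriodicMesh L) (ν : ℝ) (D : ℝ → M.Node → M.Node → ℝ) (u : ℝ → M.Node → Vec d)
      (p : ℝ → M.Node → ℝ) (η : ℝ), M.IsBoundedSolution ν ω T C D u p → M.IsRegular K →
      ∫ t in (0)..T, M.h ^ (d - 1) * M.jumpSq (u t) ≤ E → 0 < η → η ≤ 1 → M.h ≤ η ^ 2 →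
      0 ≤ ν → ν ≤ η ^ 2 → M.h < ρ →
      ∫ t in (0)..T, |M.momentumResidual (u t) (fun i => deriv (fun s => u s i) t) (v t)| ≤
        R * η := by
  refine ⟨B * ((volume.real (box L) * T + (2 * ω * K ^ 2 * C ^ 2 * volume.real (box L) +
      2 * K ^ 4 * C ^ 2 * volume.real (box L) + (C * (1 + 2 * K ^ 2)) ^ 2 * K ^ 3 * E)) / 2) +
    (C * B + K ^ 2 * C * B + ω * K * C * B + 2 * B * C * K) *
      ((K * volume.real (box L) * T + E) / 2) +
    ((C + C ^ 2) * B * K ^ 3 + ω * K ^ 2 * C ^ 2 * B) * volume.real (box L) * T +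
    (C ^ 2 * volume.real (box L) / 4 + K ^ 4 * B ^ 2 * volume.real (box L) * T),
    fun M ν D u p η hs hK hE hη hη1 hη2 hν hνη hh => ?_⟩
  have hC := hs.const_nonneg
  have hKp := hK.const_pos
  have hB : 0 ≤ B := (hw 0).bound_nonneg
  have hΩ : 0 ≤ volume.real (box L) := measureReal_nonneg
  have hhη : M.h ≤ η := by nlinarith
  have hi := (intervalIntegrable_iff_integrableOn_Ioo_of_le hT.le).2
    (hs.integrableOn_momentumResidual hL hT hv hw hvt)
  have i1 := ((hs.intervalIntegrable_lump_deriv hL hT).const_mul M.h).const_mul B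
  have i2 := ((hs.intervalIntegrable_jump hT).const_mul (M.h ^ d)).const_mul
    (C * B + K ^ 2 * C * B + ω * K * C * B + 2 * B * C * K)
  have i3 : IntervalIntegrable (fun _ : ℝ => ((C + C ^ 2) * B * K ^ 3 + ω * K ^ 2 * C ^ 2 * B) *
    volume.real (box L) * M.h) volume 0 T := intervalIntegrable_const
  have i4 : IntervalIntegrable (fun t => ν * |M.stiffForm (fun i => v t i.1) (u t)|) volume 0 T :=
    (continuousOn_const.mul (hs.continuousOn_stiffForm_curry hv).abs).intervalIntegrable_of_Icc
      hT.le
  have h1 := intervalIntegral.integral_mono_on_of_le_Ioo hT.le hi.abs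
    (((i1.add i2).add i3).add i4)
    fun t ht => hs.abs_momentumResidual_le hd hL hω hK (hw t) (hdiv t ht) hh ht
  rw [intervalIntegral.integral_add ((i1.add i2).add i3) i4,
    intervalIntegral.integral_add (i1.add i2) i3, intervalIntegral.integral_add i1 i2,
    intervalIntegral.integral_const_mul B, intervalIntegral.integral_const_mul
      (C * B + K ^ 2 * C * B + ω * K * C * B + 2 * B * C * K),
    intervalIntegral.integral_const, smul_eq_mul, sub_zero] at h1
  have h2 := mul_le_mul_of_nonneg_left
    (hs.integral_lump_deriv_le hd hL hT hω hK hE hη hη1 hη2 hν hνη) hB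
  have h3 := mul_le_mul_of_nonneg_left (hs.integral_jump_le hd hL hT hK hE hη hη2)
    (show 0 ≤ C * B + K ^ 2 * C * B + ω * K * C * B + 2 * B * C * K by positivity)
  have h4 := mul_le_mul_of_nonneg_left hhη (show 0 ≤ ((C + C ^ 2) * B * K ^ 3 +
    ω * K ^ 2 * C ^ 2 * B) * volume.real (box L) * T by positivity)
  have h5 := hs.integral_abs_stiffForm_le hL hT hω hK hv hw hh hη hν hνη
  linarith

end PeriodicMesh
end PeriodicFEM

namespace PeriodicFEM

variable {d : ℕ} {L : Fin d → ℝ}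

/-! ### Passage to the limit -/

theorem tendsto_eLpNorm_zero_of_integral_abs_le {T R : ℝ} (hT : 0 < T) {f : ℕ → ℝ → ℝ} {η : ℕ → ℝ}
    (hη : Tendsto η atTop (𝓝 0))
    (hf : ∀ᶠ n in atTop, IntegrableOn (f n) (Ioo 0 T) ∧ ∫ t in (0)..T, |f n t| ≤ R * η n) :
    Tendsto (fun n => eLpNorm (f n) 1 (volume.restrict (Ioo 0 T))) atTop (𝓝 0) := by
  have h1 : Tendsto (fun n => ENNReal.ofReal (R * η n)) atTop (𝓝 0) := by
    simpa using ENNReal.tendsto_ofReal (hη.const_mul R)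
  refine tendsto_of_tendsto_of_tendsto_of_le_of_le' tendsto_const_nhds h1
    (Eventually.of_forall fun _ => zero_le) ?_
  filter_upwards [hf] with n ⟨hn, hle⟩
  rw [eLpNorm_one_eq_lintegral_enorm, ← ofReal_integral_norm_eq_lintegral_enorm hn]
  refine ENNReal.ofReal_le_ofReal (le_trans (le_of_eq ?_) hle)
  rw [intervalIntegral.integral_of_le hT.le, integral_Ioc_eq_integral_Ioo]
  rfl

namespace PeriodicMesh

variable {M : PeriodicMesh L} {ν ω T C : ℝ} {D : ℝ → M.Node → M.Node → ℝ}
  {u : ℝ → M.Node → Vec d} {p : ℝ → M.Node → ℝ}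

theorem IsBoundedSolution.integrableOn_divError (hs : M.IsBoundedSolution ν ω T C D u p)
    (hL : ∀ k, 0 < L k) {q : Vec d → ℝ} (hq : ContDiff ℝ 1 q) :
    IntegrableOn (fun t => M.divError (u t) q) (Ioo 0 T) := by
  have hg : Continuous (gradient q) :=
    (InnerProductSpace.toDual ℝ (Vec d)).symm.continuous.comp (hq.continuous_fderiv one_ne_zero)
  have e : ∀ t, M.divError (u t) q =
      ∑ i, inner ℝ (u t i) (∫ x in box L, M.phi i x • gradient q x) :=
    fun t => setIntegral_inner_fe hL (u t) hg
  have hc : ContinuousOn (fun t => M.divError (u t) q) (Icc 0 T) := by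
    simp only [e]
    exact continuousOn_finsetSum _ fun i _ => (hs.continuousOn i).inner continuousOn_const
  exact (hc.integrableOn_compact isCompact_Icc).mono_set Ioo_subset_Icc_self

end PeriodicMesh
end PeriodicFEM
end

open PeriodicFEM in
theorem theorem3 {d : ℕ} (hd : d = 2 ∨ d = 3) (L : Fin d → ℝ) (hL : ∀ k, 0 < L k)
    (T : ℝ) (hT : 0 < T) (ω : ℝ) (hω : 0 < ω)
    -- the meshes, the viscosities, the artificial viscosities and the numerical solutions
    (M : ℕ → PeriodicMesh L) (hM : Tendsto (fun n => (M n).h) atTop (𝓝 0)) (hreg : ShapeRegular M)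
    (ν : ℕ → ℝ) (hν : ∀ n, 0 ≤ ν n) (hν0 : Tendsto ν atTop (𝓝 0))
    (D : (n : ℕ) → ℝ → (M n).Node → (M n).Node → ℝ)
    (u : (n : ℕ) → ℝ → (M n).Node → Vec d) (p : (n : ℕ) → ℝ → (M n).Node → ℝ)
    (hD : ∀ n, ∀ t ∈ Ioo 0 T, (M n).IsGraphLaplacian (D n t))
    (hsol : ∀ n, (M n).IsSolution (ν n) ω T (D n) (u n) (p n))
    -- uniform boundedness
    (hbdd : ∃ C, ∀ n, ∀ t ∈ Ioo 0 T, ∀ i, ‖u n t i‖ ≤ C ∧ |p n t i| ≤ C)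
    -- the artificial viscosity coefficients are at most of order `h ^ (d - 1)`
    (hDmax : ∃ C, ∀ n, ∀ t ∈ Ioo 0 T, ∀ i j, j ≠ i → D n t i j ≤ C * (M n).h ^ (d - 1))
    -- up to a bounded remainder, the dissipation controls the velocity jumps
    (hDmin : ∃ C, ∀ n,
      ∫ t in (0)..T, (M n).h ^ (d - 1) *
          ∑ i, ∑ j ∈ ((M n).nbr i).erase i, ‖u n t j - u n t i‖ ^ 2 ≤
        C * (1 + ∫ t in (0)..T, ∑ i, ∑ j ∈ ((M n).nbr i).erase i,
          (D n t i j - ν n * (M n).stiff i j) * ‖u n t j - u n t i‖ ^ 2)) :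
    (∀ q : Vec d → ℝ, ContDiff ℝ 1 q → HasCompactSupport q → tsupport q ⊆ box L →
      (∀ n, IntegrableOn (fun t => (M n).divError (u n t) q) (Ioo 0 T)) ∧
      Tendsto (fun n => eLpNorm (fun t => (M n).divError (u n t) q) 1 (volume.restrict (Ioo 0 T)))
        atTop (𝓝 0)) ∧
    (∀ v : ℝ → Vec d → Vec d, ContDiff ℝ 2 (Function.uncurry v) →
      HasCompactSupport (Function.uncurry v) →
      tsupport (Function.uncurry v) ⊆ Iio T ×ˢ box L →
      (∀ t ∈ Ico 0 T, ∀ x ∈ box L, divergence (v t) x = 0) →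
      (∀ n, ∃ e, (M n).IsMomentumError T (u n) v e) ∧
      ∀ e : ℕ → ℝ → ℝ, (∀ n, (M n).IsMomentumError T (u n) v (e n)) →
        Tendsto (fun n => eLpNorm (e n) 1 (volume.restrict (Ioo 0 T))) atTop (𝓝 0)) := by
  have hd0 : 0 < d := by omega
  obtain ⟨C₁, hC₁⟩ := hbdd
  obtain ⟨C₂, hC₂⟩ := hDmax
  obtain ⟨C₃, hC₃⟩ := hDmin
  obtain ⟨K, hK⟩ := hreg.exists_isRegular hd0 hL hM
  set C := max (max C₁ C₂) 0
  have hle₁ : C₁ ≤ C := (le_max_left _ _).trans (le_max_left _ _)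
  have hle₂ : C₂ ≤ C := (le_max_right _ _).trans (le_max_left _ _)
  have hs : ∀ n, (M n).IsBoundedSolution (ν n) ω T C (D n) (u n) (p n) := fun n =>
    { hsol n with
      visc_nonneg := hν n
      laplacian := hD n
      norm_le := fun t ht i => (hC₁ n t ht i).1.trans hle₁
      abs_le := fun t ht i => (hC₁ n t ht i).2.trans hle₁
      laplacian_le := fun t ht i j hji => (hC₂ n t ht i j hji).trans
        (mul_le_mul_of_nonneg_right hle₂ (pow_nonneg ((M n).h_pos hd0 hL).le _))
      const_nonneg := le_max_right _ _ }
  -- A common rate dominating the square roots of the mesh size and of the viscosity.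
  set η : ℕ → ℝ := fun n => √((M n).h + ν n)
  have hh : ∀ n, 0 < (M n).h := fun n => (M n).h_pos hd0 hL
  have hη_pos : ∀ n, 0 < η n := fun n => Real.sqrt_pos.2 (add_pos_of_pos_of_nonneg (hh n) (hν n))
  have hη_sq : ∀ n, η n ^ 2 = (M n).h + ν n := fun n =>
    Real.sq_sqrt (add_nonneg (hh n).le (hν n))
  have hη_lim : Tendsto η atTop (𝓝 0) := by simpa using (hM.add hν0).sqrt
  have hη_one : ∀ᶠ n in atTop, η n ≤ 1 := hη_lim.eventually_le_const one_pos
  have hE : ∀ n, (M n).IsRegular K → ∫ t in (0)..T, (M n).h ^ (d - 1) * (M n).jumpSq (u n t) ≤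
      |C₃| * (1 + C ^ 2 * volume.real (box L)) := fun n hKn =>
    (hs n).integral_jumpSq_le hL hT hω.le (hKn.antisymm hL)
      (PeriodicMesh.sum_stiff hL hKn.lipschitzWith)
      (PeriodicMesh.stiffForm_self_nonneg hKn.lipschitzWith) (hC₃ n)
  refine ⟨fun q hq hqc hqs => ?_, fun v hv hvc hvs hdiv => ?_⟩
  · have hint : ∀ n, IntegrableOn (fun t => (M n).divError (u n t) q) (Ioo 0 T) := fun n =>
      (hs n).integrableOn_divError hL hq
    refine ⟨hint, ?_⟩
    obtain ⟨ρ, hρ, hSI⟩ := exists_supportedInside (V := ℝ) hqc hqs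
    obtain ⟨B, hB⟩ := hq.lipschitzWith_of_hasCompactSupport hqc one_ne_zero
    have hBq : ∀ x y, ‖q x - q y‖ ≤ B * ‖x - y‖ := fun x y => by
      simpa only [dist_eq_norm] using hB.dist_le_mul x y
    obtain ⟨R, hR⟩ := PeriodicMesh.exists_integral_abs_divError_le hd0 hL hT hω.le hq hρ
      (hSI q fun x hx => subset_tsupport _ hx) B.coe_nonneg hBq K C
      (|C₃| * (1 + C ^ 2 * volume.real (box L)))
    refine tendsto_eLpNorm_zero_of_integral_abs_le (R := R) hT hη_lim ?_
    filter_upwards [hK, hη_one, hM.eventually_lt_const hρ] with n hKn h1 hhρ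
    exact ⟨hint n, hR (M n) (ν n) (D n) (u n) (p n) (η n) (hs n) hKn (hE n hKn) (hη_pos n) h1
      (by rw [hη_sq]; linarith [hν n]) hhρ
      ((intervalIntegrable_iff_integrableOn_Ioo_of_le hT.le).2 (hint n))⟩
  · obtain ⟨B, ρ, hw, hvt⟩ := exists_isTestField hv hvc hvs
    have hres := fun n => (hs n).isMomentumError_momentumResidual hL hT hv hw hvt
    refine ⟨fun n => ⟨_, hres n⟩, fun e he => ?_⟩
    obtain ⟨R, hR⟩ := PeriodicMesh.exists_integral_abs_momentumResidual_le hd0 hL hT hω.le hv hw hvt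
      (fun t ht => hdiv t (Ioo_subset_Ico_self ht)) K C (|C₃| * (1 + C ^ 2 * volume.real (box L)))
    have hee : ∀ n, eLpNorm (e n) 1 (volume.restrict (Ioo 0 T)) = eLpNorm
        (fun t => (M n).momentumResidual (u n t) (fun i => deriv (fun s => u n s i) t) (v t)) 1
        (volume.restrict (Ioo 0 T)) := fun n => eLpNorm_congr_ae ((he n).ae_eq hT (hres n))
    simp only [hee]
    refine tendsto_eLpNorm_zero_of_integral_abs_le (R := R) hT hη_lim ?_
    filter_upwards [hK, hη_one, hM.eventually_lt_const (hw 0).pos] with n hKn h1 hhρ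
    exact ⟨(hres n).1, hR (M n) (ν n) (D n) (u n) (p n) (η n) (hs n) hKn (hE n hKn) (hη_pos n) h1
      (by rw [hη_sq]; linarith [hν n]) (hν n) (by rw [hη_sq]; linarith [hh n]) hhρ⟩
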